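/- Let $m\ge 2$, let $M$ be a closed connected smooth manifold of dimension $m+1$, and let $t_0<t_1<T$. Let $(g(t),p(t))$, $t\in[t_0,t_1]$, be a smooth solution on $M$ of the conformal Ricci flow $$\partial_t g=-2\big(\mathrm{Ric}+(m+p)g\big),\qquad (-\Delta+(m+1))p=\tfrac1m|\mathrm{Ric}+mg|^2,$$ with scalar curvature $R_{g(t)}\equiv-m(m+1)$; here $\mathrm{Ric}$, $\nabla$, $\Delta$, $|\cdot|$ and the volume measure $d\mu$ are those of $g(t)$. Put $\bar p(t)=\max_{x\in M}p(x,t)$. Let $f$ be a smooth function on $M\times[t_0,t_1]$ such that $H=(4\pi(T-t))^{-\frac{m+1}{2}}e^{-f}$ solves the conjugate heat equation $\partial_tH=-\Delta H+(m+1)pH$ and such that the measure $dV=H\,d\mu$ satisfies $\int_M dV=1$ for every $t\in[t_0,t_1]$. Let $h,k$ be smooth functions on $[t_0,t_1]$ with $h>0$, and suppose that $$\mathrm{Ric}+\mathrm{Hess} f\le\Big(\frac{k(t)}{2h(t)}+\frac{R_g}{m+1}\Big)g\qquad\text{on } M\times[t_0,t_1].$$ Let $v$ be a smooth function on $M\times[t_0,t_1]$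 with $$|(\partial_t-\Delta)v|\le\bar p(t)\,(|v|+|\nabla v|),$$ and set $$I(t)=\int_Mv^2\,dV,\qquad E(t)=h(t)\int_M|\nabla v|^2\,dV,\qquad Q(t)=\frac{E(t)}{I(t)}\,e^{-\int_{t_0}^t\left(2\bar p(s)+\frac{h'(s)+k(s)}{h(s)}\right)ds}.$$ Then at every $t\in[t_0,t_1]$ for which $v(\cdot,t)$ is not identically zero, the functions $\log I$, $Q$ and $\log(Q+h(t_0))$ are differentiable (one-sidedly at $t_0$ and $t_1$), and $$(\log I)'(t)\ge-3\bar p(t)-\frac{\bar p(t)+2}{h(t)}\,Q(t)\,e^{\int_{t_0}^t\left(2\bar p(s)+\frac{h'(s)+k(s)}{h(s)}\right)ds},$$ $$Q'(t)\le\bar p(t)^2\,\big(Q(t)+h(t_0)\big),\qquad \big[\log(Q+h(t_0))\big]'(t)\le\bar p(t)^2 .$$ -/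

import Mathlib

open Set MeasureTheory
open scoped Manifold ContDiff

noncomputable section

namespace CRF

/-- The model space of an `n`-dimensional manifold. -/
abbrev Model (n : ℕ) : Type := EuclideanSpace ℝ (Fin n)

/-- A smooth Riemannian metric on the `n`-manifold `M`. -/
abbrev Metric (n : ℕ) (M : Type*) [TopologicalSpace M] [ChartedSpace (Model n) M]
    [IsManifold (𝓡 n) ∞ M] : Type _ :=
  Bundle.ContMDiffRiemannianMetric (𝓡 n) ∞ (Model n) (fun x : M => TangentSpace (𝓡 n) x)

/-! ### Classical tensor calculus on an open subset of `ℝⁿ`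

`G y i j` are the components `g_{ij}(y)` of a metric in local coordinates. -/

section Coordinates

variable {n : ℕ}

/-- The partial derivative `∂ᵢ F` at `y`. -/
def pd (i : Fin n) (F : Model n → ℝ) (y : Model n) : ℝ :=
  fderiv ℝ F y (EuclideanSpace.single i 1)

/-- `Γᵏᵢⱼ = ½ gᵏˡ (∂ᵢ gⱼₗ + ∂ⱼ gᵢₗ - ∂ₗ gᵢⱼ)`. -/
def christoffel (G : Model n → Matrix (Fin n) (Fin n) ℝ) (k i j : Fin n) (y : Model n) : ℝ :=
  (1 / 2) * ∑ l, (G y)⁻¹ k l *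
    (pd i (fun z => G z j l) y + pd j (fun z => G z i l) y - pd l (fun z => G z i j) y)

/-- `Ricᵢⱼ = ∂ₖ Γᵏᵢⱼ - ∂ⱼ Γᵏᵢₖ + Γᵏₖₗ Γˡᵢⱼ - Γᵏⱼₗ Γˡᵢₖ`
(the sign for which round spheres have positive Ricci curvature). -/
def ricciCoord (G : Model n → Matrix (Fin n) (Fin n) ℝ) (y : Model n) :
    Matrix (Fin n) (Fin n) ℝ := fun i j =>
  ∑ k, pd k (christoffel G k i j) y - ∑ k, pd j (christoffel G k i k) y
    + ∑ k, ∑ l, christoffel G k k l y * christoffel G l i j y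
    - ∑ k, ∑ l, christoffel G k j l y * christoffel G l i k y

/-- `(Hess F)ᵢⱼ = ∂ᵢ ∂ⱼ F - Γᵏᵢⱼ ∂ₖ F`. -/
def hessCoord (G : Model n → Matrix (Fin n) (Fin n) ℝ) (F : Model n → ℝ) (y : Model n) :
    Matrix (Fin n) (Fin n) ℝ := fun i j =>
  pd i (pd j F) y - ∑ k, christoffel G k i j y * pd k F y

end Coordinates

section Geometry

variable {n : ℕ} {M : Type*} [TopologicalSpace M] [ChartedSpace (Model n) M]
  [IsManifold (𝓡 n) ∞ M]

/-- The components `g_{ij}` of the metric `g` in the chart at `x₀`: at the point `y` of the target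
of the chart, `g(∂ᵢ, ∂ⱼ)`, where `∂ᵢ` is the image of the `i`-th standard basis vector under the
differential of the inverse of the chart. -/
def gram (g : Metric n M) (x₀ : M) (y : Model n) : Matrix (Fin n) (Fin n) ℝ := fun i j =>
  g.inner ((extChartAt (𝓡 n) x₀).symm y)
    (mfderivWithin 𝓘(ℝ, Model n) (𝓡 n) (extChartAt (𝓡 n) x₀).symm (range (𝓡 n)) y
      (EuclideanSpace.single i 1 : Model n))
    (mfderivWithin 𝓘(ℝ, Model n) (𝓡 n) (extChartAt (𝓡 n) x₀).symm (range (𝓡 n)) y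
      (EuclideanSpace.single j 1 : Model n))

/-! Below, the components of a tensor at the point `x` are those in the chart at `x` itself.
Scalars formed by contraction with the metric and inequalities between symmetric bilinear forms
do not depend on this choice of a chart. -/

/-- The components of `g` at `x`. -/
def metricAt (g : Metric n M) (x : M) : Matrix (Fin n) (Fin n) ℝ :=
  gram g x (extChartAt (𝓡 n) x x)

/-- The components of the Ricci tensor at `x`. -/
def ricci (g : Metric n M) (x : M) : Matrix (Fin n) (Fin n) ℝ :=
  ricciCoord (gram g x) (extChartAt (𝓡 n) x x)

/-- The components of the Hessian of `u` at `x`. -/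
def hess (g : Metric n M) (u : M → ℝ) (x : M) : Matrix (Fin n) (Fin n) ℝ :=
  hessCoord (gram g x) (u ∘ (extChartAt (𝓡 n) x).symm) (extChartAt (𝓡 n) x x)

/-- The trace `gⁱʲ Aᵢⱼ` at `x`. -/
def traceAt (g : Metric n M) (x : M) (A : Matrix (Fin n) (Fin n) ℝ) : ℝ :=
  ∑ i, ∑ j, (metricAt g x)⁻¹ i j * A i j

/-- The squared norm `gⁱᵏ gʲˡ Aᵢⱼ Aₖₗ` at `x`. -/
def normSqAt (g : Metric n M) (x : M) (A : Matrix (Fin n) (Fin n) ℝ) : ℝ :=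
  ∑ i, ∑ j, ∑ k, ∑ l, (metricAt g x)⁻¹ i k * (metricAt g x)⁻¹ j l * A i j * A k l

/-- Scalar curvature. -/
def scalarCurvature (g : Metric n M) (x : M) : ℝ := traceAt g x (ricci g x)

/-- The Laplace-Beltrami operator `Δ u = tr_g Hess u`. -/
def laplacian (g : Metric n M) (u : M → ℝ) (x : M) : ℝ := traceAt g x (hess g u x)

/-- `|∇u|² = gⁱʲ ∂ᵢu ∂ⱼu`. -/
def gradSq (g : Metric n M) (u : M → ℝ) (x : M) : ℝ :=
  ∑ i, ∑ j, (metricAt g x)⁻¹ i j *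
    pd i (u ∘ (extChartAt (𝓡 n) x).symm) (extChartAt (𝓡 n) x x) *
    pd j (u ∘ (extChartAt (𝓡 n) x).symm) (extChartAt (𝓡 n) x x)

/-- The Bakry-Émery Ricci tensor `Ric + Hess f`. -/
def ricciBE (g : Metric n M) (f : M → ℝ) (x : M) : Matrix (Fin n) (Fin n) ℝ :=
  ricci g x + hess g f x

/-- `A ≤ B` as quadratic forms. -/
def FormLE (A B : Matrix (Fin n) (Fin n) ℝ) : Prop :=
  ∀ ξ : Fin n → ℝ, ∑ i, ∑ j, A i j * ξ i * ξ j ≤ ∑ i, ∑ j, B i j * ξ i * ξ j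

/-- The measure `√(det g_{ij}) dx¹ ⋯ dxⁿ` of the chart at `x₀`, as a measure on `M`
(concentrated on the domain of the chart). -/
def chartVolume [MeasurableSpace M] (g : Metric n M) (x₀ : M) : Measure M :=
  (((volume : Measure (Model n)).restrict (extChartAt (𝓡 n) x₀).target).withDensity
    (fun y => ENNReal.ofReal (Real.sqrt (gram g x₀ y).det))).map (extChartAt (𝓡 n) x₀).symm

/-- The Riemannian volume measure `dμ_g`. The measures `chartVolume g x₀` agree on the overlaps of
the chart domains, so their supremum is the measure that restricts to `chartVolume g x₀` on
the domain of the chart at `x₀`, for every `x₀`. -/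
def riemannianVolume [MeasurableSpace M] (g : Metric n M) : Measure M :=
  ⨆ x₀ : M, chartVolume g x₀

end Geometry

section Flow

variable {m : ℕ} {M : Type*} [TopologicalSpace M] [ChartedSpace (Model (m + 1)) M]

/-- `u` is smooth on `[t₀, t₁] × M`, up to the end points of the interval. -/
def SmoothOn (m : ℕ) {M : Type*} [TopologicalSpace M] [ChartedSpace (Model (m + 1)) M]
    (u : ℝ → M → ℝ) (t₀ t₁ : ℝ) : Prop :=
  ContMDiffOn (𝓘(ℝ, ℝ).prod (𝓡 (m + 1))) 𝓘(ℝ, ℝ) ∞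
    (fun q : ℝ × M => u q.1 q.2) (Icc t₀ t₁ ×ˢ univ)

/-- The time derivative `∂ₜu` on `[t₀, t₁]`, one-sided at the end points. -/
def dt (t₀ t₁ : ℝ) (u : ℝ → M → ℝ) (t : ℝ) (x : M) : ℝ :=
  derivWithin (fun s => u s x) (Icc t₀ t₁) t

/-- `p̄(t) = max_{x ∈ M} p(x, t)`. -/
def pmax (p : ℝ → M → ℝ) (t : ℝ) : ℝ := ⨆ x, p t x

/-- `∫_{t₀}^t (2 p̄(s) + (h'(s) + k(s)) / h(s)) ds`. -/
def rate (p : ℝ → M → ℝ) (h k : ℝ → ℝ) (t₀ t₁ t : ℝ) : ℝ :=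
  ∫ s in t₀..t, (2 * pmax p s + (derivWithin h (Icc t₀ t₁) s + k s) / h s)

/-- `H = (4πτ)^{-(m+1)/2} e^{-f}` with `τ = T - t`. -/
def kernelH (m : ℕ) (T : ℝ) (f : ℝ → M → ℝ) (t : ℝ) (x : M) : ℝ :=
  (4 * Real.pi * (T - t)) ^ (-(((m : ℝ) + 1) / 2)) * Real.exp (-f t x)

variable [IsManifold (𝓡 (m + 1)) ∞ M]

/-- The conformal Ricci flow with conformal pressure `p`, on the closed time interval `[t₀, t₁]`,
on a manifold of dimension `m + 1`. -/
structure IsConformalRicciFlow (g : ℝ → Metric (m + 1) M) (p : ℝ → M → ℝ) (t₀ t₁ : ℝ) :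
    Prop where
  /-- The metric is smooth in space and time. -/
  smooth_metric : ∀ (x₀ : M) (i j : Fin (m + 1)),
    ContDiffOn ℝ ∞ (fun q : ℝ × Model (m + 1) => gram (g q.1) x₀ q.2 i j)
      (Icc t₀ t₁ ×ˢ (extChartAt (𝓡 (m + 1)) x₀).target)
  smooth_pressure : SmoothOn m p t₀ t₁
  /-- `∂ₜ g = -2 (Ric + (m + p) g)`. -/
  evolution : ∀ t ∈ Icc t₀ t₁, ∀ (x : M) (i j : Fin (m + 1)),
    HasDerivWithinAt (fun s => metricAt (g s) x i j)
      (-2 * (ricci (g t) x i j + (m + p t x) * metricAt (g t) x i j)) (Icc t₀ t₁) t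
  /-- `(-Δ + (m + 1)) p = (1/m) |Ric + m g|²`. -/
  pressure_eq : ∀ t ∈ Icc t₀ t₁, ∀ x : M,
    -laplacian (g t) (p t) x + (m + 1) * p t x
      = 1 / m * normSqAt (g t) x (ricci (g t) x + (m : ℝ) • metricAt (g t) x)

variable [MeasurableSpace M]

/-- The weighted measure `dV = H dμ_g` at time `t`. -/
def weightedVolume (g : ℝ → Metric (m + 1) M) (T : ℝ) (f : ℝ → M → ℝ) (t : ℝ) : Measure M :=
  (riemannianVolume (g t)).withDensity (fun x => ENNReal.ofReal (kernelH m T f t x))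

/-- `f` is a smooth potential on `[t₀, t₁]` for which `H = (4πτ)^{-(m+1)/2} e^{-f}` solves the
conjugate heat equation, normalized by `∫_M dV = 1`. -/
structure IsConjugatePotential (g : ℝ → Metric (m + 1) M) (p f : ℝ → M → ℝ) (T t₀ t₁ : ℝ) :
    Prop where
  smooth : SmoothOn m f t₀ t₁
  /-- `∂ₜ H = -ΔH + (m + 1) p H`. -/
  conjugate_heat : ∀ t ∈ Icc t₀ t₁, ∀ x : M,
    dt t₀ t₁ (kernelH m T f) t x
      = -laplacian (g t) (kernelH m T f t) x + (m + 1) * p t x * kernelH m T f t x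
  normalized : ∀ t ∈ Icc t₀ t₁, weightedVolume g T f t univ = 1

/-- `I(t) = ∫ v² dV`. -/
def massI (g : ℝ → Metric (m + 1) M) (T : ℝ) (f v : ℝ → M → ℝ) (t : ℝ) : ℝ :=
  ∫ x, v t x ^ 2 ∂(weightedVolume g T f t)

/-- `E(t) = h(t) ∫ |∇v|² dV`. -/
def energyE (g : ℝ → Metric (m + 1) M) (T : ℝ) (f v : ℝ → M → ℝ) (h : ℝ → ℝ) (t : ℝ) : ℝ :=
  h t * ∫ x, gradSq (g t) (v t) x ∂(weightedVolume g T f t)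

/-- The parabolic frequency
`Q(t) = E(t) / I(t) * exp (-∫_{t₀}^t (2 p̄(s) + (h'(s) + k(s)) / h(s)) ds)`. -/
def freqQ (g : ℝ → Metric (m + 1) M) (p : ℝ → M → ℝ) (T : ℝ) (f v : ℝ → M → ℝ) (h k : ℝ → ℝ)
    (t₀ t₁ t : ℝ) : ℝ :=
  energyE g T f v h t / massI g T f v t * Real.exp (-rate p h k t₀ t₁ t)

end Flow

end CRF

end

/-! Write dV = H dμ, ψ = ∂ₜv - ⟨∇f, ∇v⟩, w = (∂ₜ - Δ)v, D = ∫ |∇v|² dV and P = p̄. Since R =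
-m(m+1), the flow gives ∂ₜ dμ = -(m+1)p dμ. This cancels the zeroth-order term of the conjugate heat
equation, so ∂ₜ(H dμ) = -ΔH dμ. Green's formula and ∇H = -H∇f then yield d/dt ∫ φ dV = ∫ (∂ₜφ - ⟨∇f,
∇φ⟩) dV (`hasDerivWithinAt_integral_weightedVolume`).

For φ = v² this is I' = 2∫ vψ dV. For φ = |∇v|², the evolution of the inverse metric produces
Ric(∇v, ∇v), and the identity ⟨∇f, ∇|∇v|²⟩ = 2⟨∇v, ∇⟨∇f, ∇v⟩⟩ - 2 Hess f(∇v, ∇v) produces Hess f(∇v,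
∇v). The assumed upper bound therefore gives D' ≤ (k/h + 2P) D + 2∫ ⟨∇v, ∇ψ⟩ dV, without Bochner's
formula (`exists_hasDerivWithinAt_dirichlet`).

The drift Laplacian Δv - ⟨∇f, ∇v⟩ equals ψ - w, so the weighted Green formula gives D = -∫ vψ + ∫ vw
and ∫ ⟨∇v, ∇ψ⟩ = -∫ ψ² + ∫ ψw. Completing squares around ψ - w/2 and applying Cauchy-Schwarz to v
and ψ - w/2 leaves only the error I ∫ w² / 2 in the numerator of (D/I)' (`frequency_deriv_le`). The
hypothesis on v gives ∫ w² ≤ 2P²(I + D), hence Q' ≤ P²(Q + h e^{-r}), where r is the integral in the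
exponent of Q.

It remains to bound h e^{-r} by h(t₀). Its derivative is -(2Ph + k)e^{-r}, which is nonpositive
because P ≥ 0 and k ≥ 0. Both signs follow by integrating a Laplacian over M: that of p for P, and
that of f, after tracing the Ricci hypothesis, for k. The bound on (log I)' comes from I' = -2D + 2∫
vw and Young's inequality.

The geometric input is proved in charts on the closed slab [t₀, t₁] × M, so that all time
derivatives include the end points. -/

noncomputable section

namespace CRF

/-! ### Derivatives of the determinant and of the inverse matrix. -/

section MatrixCalculus

variable {E : Type*} [NormedAddCommGroup E] [NormedSpace ℝ E] {ι : Type*} [Fintype ι]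
  [DecidableEq ι] {A : E → Matrix ι ι ℝ} {s : Set E} {x : E}

theorem contDiffWithinAt_matrix_det {N : ℕ∞ω}
    (h : ∀ i j, ContDiffWithinAt ℝ N (fun y => A y i j) s x) :
    ContDiffWithinAt ℝ N (fun y => (A y).det) s x := by
  simp only [Matrix.det_apply']
  exact ContDiffWithinAt.sum fun σ _ =>
    contDiffWithinAt_const.mul (contDiffWithinAt_prod fun i _ => h _ _)

theorem contDiffWithinAt_matrix_inv {N : ℕ∞ω}
    (h : ∀ i j, ContDiffWithinAt ℝ N (fun y => A y i j) s x) (hx : (A x).det ≠ 0) (i j : ι) :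
    ContDiffWithinAt ℝ N (fun y => (A y)⁻¹ i j) s x := by
  have hadj : ContDiffWithinAt ℝ N (fun y => (A y).adjugate i j) s x := by
    simp only [Matrix.adjugate_apply]
    refine contDiffWithinAt_matrix_det fun k l => ?_
    simp only [Matrix.updateRow_apply]
    split_ifs
    · exact contDiffWithinAt_const
    · exact h k l
  simp only [Matrix.inv_def, Matrix.smul_apply, Ring.inverse_eq_inv', smul_eq_mul]
  exact ((contDiffWithinAt_matrix_det h).inv hx).mul hadj

/-- Jacobi's formula. Differentiating the i-th factor of every term of the Leibniz expansion gives
the determinant whose i-th column is replaced by its derivative. Cramer's rule expresses this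
through the adjugate. -/
theorem hasFDerivWithinAt_matrix_det {A' : ι → ι → E →L[ℝ] ℝ}
    (h : ∀ i j, HasFDerivWithinAt (fun y => A y i j) (A' i j) s x) :
    HasFDerivWithinAt (fun y => (A y).det) (∑ i, ∑ j, (A x).adjugate i j • A' j i) s x := by
  simp only [Matrix.det_apply']
  have h1 : HasFDerivWithinAt
      (fun y => ∑ σ : Equiv.Perm ι, ((Equiv.Perm.sign σ : ℤ) : ℝ) * ∏ i, A y (σ i) i)
      (∑ σ : Equiv.Perm ι, ((Equiv.Perm.sign σ : ℤ) : ℝ) •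
        ∑ i, (∏ j ∈ Finset.univ.erase i, A x (σ j) j) • A' (σ i) i) s x :=
    HasFDerivWithinAt.fun_sum fun σ _ =>
      (HasFDerivWithinAt.finsetProd fun i _ => h (σ i) i).const_mul _
  refine h1.congr_fderiv ?_
  ext v
  simp only [_root_.sum_apply, _root_.smul_apply, smul_eq_mul,
    Finset.mul_sum]
  rw [Finset.sum_comm]
  refine Finset.sum_congr rfl fun i _ => ?_
  have h2 := congrFun (Matrix.cramer_eq_adjugate_mulVec (A x) (fun k => A' k i v)) i
  rw [Matrix.cramer_apply, Matrix.det_apply'] at h2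
  simp only [Matrix.mulVec, dotProduct] at h2
  rw [← h2]
  refine Finset.sum_congr rfl fun σ _ => ?_
  congr 1
  rw [← Finset.mul_prod_erase Finset.univ _ (Finset.mem_univ i), Matrix.updateCol_self, mul_comm]
  congr 1
  refine Finset.prod_congr rfl fun j hj => ?_
  rw [Matrix.updateCol_ne (Finset.ne_of_mem_erase hj)]

/-- The adjugate formula shows that the inverse is differentiable. The value of the derivative then
comes from differentiating A⁻¹A = 1 near x, where `hxs` allows the two derivatives of the constant
to be identified, and multiplying by A⁻¹ on the right. -/
theorem hasFDerivWithinAt_matrix_inv {A' : ι → ι → E →L[ℝ] ℝ}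
    (h : ∀ i j, HasFDerivWithinAt (fun y => A y i j) (A' i j) s x) (hx : (A x).det ≠ 0)
    (hxs : UniqueDiffWithinAt ℝ s x) (i j : ι) :
    HasFDerivWithinAt (fun y => (A y)⁻¹ i j)
      (-∑ k, ∑ l, ((A x)⁻¹ i k * (A x)⁻¹ l j) • A' k l) s x := by
  have hd : ∀ k l, DifferentiableWithinAt ℝ (fun y => (A y)⁻¹ k l) s x := by
    have hdet : ∀ {B : E → Matrix ι ι ℝ},
        (∀ i j, DifferentiableWithinAt ℝ (fun y => B y i j) s x) →
        DifferentiableWithinAt ℝ (fun y => (B y).det) s x := fun hB =>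
      (hasFDerivWithinAt_matrix_det fun i j => (hB i j).hasFDerivWithinAt).differentiableWithinAt
    intro k l
    simp only [Matrix.inv_def, Matrix.smul_apply, Ring.inverse_eq_inv', smul_eq_mul]
    refine ((hdet fun i j => (h i j).differentiableWithinAt).fun_inv hx).mul ?_
    simp only [Matrix.adjugate_apply]
    refine hdet fun i j => ?_
    simp only [Matrix.updateRow_apply]
    split_ifs
    · exact differentiableWithinAt_const _
    · exact (h i j).differentiableWithinAt
  have hev : ∀ᶠ y in nhdsWithin x s, (A y).det ≠ 0 :=
    (hasFDerivWithinAt_matrix_det h).continuousWithinAt.eventually_ne hx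
  have key : ∀ k l, ∑ r, ((A x)⁻¹ k r • A' r l
      + A x r l • fderivWithin ℝ (fun y => (A y)⁻¹ k r) s x) = 0 := by
    intro k l
    have h1 : HasFDerivWithinAt (fun y => ∑ r, (A y)⁻¹ k r * A y r l)
        (∑ r, ((A x)⁻¹ k r • A' r l + A x r l • fderivWithin ℝ (fun y => (A y)⁻¹ k r) s x)) s x :=
      HasFDerivWithinAt.fun_sum fun r _ => (hd k r).hasFDerivWithinAt.mul (h r l)
    have h2 : HasFDerivWithinAt (fun y => ∑ r, (A y)⁻¹ k r * A y r l) (0 : E →L[ℝ] ℝ) s x := by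
      refine (hasFDerivWithinAt_const ((1 : Matrix ι ι ℝ) k l) x s).congr_of_eventuallyEq ?_ ?_
      · filter_upwards [hev] with y hy
        rw [← Matrix.nonsing_inv_mul (A y) (isUnit_iff_ne_zero.2 hy), Matrix.mul_apply]
      · rw [← Matrix.nonsing_inv_mul (A x) (isUnit_iff_ne_zero.2 hx), Matrix.mul_apply]
    exact hxs.eq h1 h2
  refine (hd i j).hasFDerivWithinAt.congr_fderiv ?_
  ext v
  have h3 : ∀ l, ∑ r, A x r l * fderivWithin ℝ (fun y => (A y)⁻¹ i r) s x v
      = -∑ r, (A x)⁻¹ i r * A' r l v := by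
    intro l
    have := congrArg (fun L : E →L[ℝ] ℝ => L v) (key i l)
    simp only [_root_.sum_apply, _root_.add_apply,
      _root_.smul_apply, smul_eq_mul, _root_.zero_apply,
      Finset.sum_add_distrib] at this
    linarith
  have h4 : ∀ r, ∑ l, A x r l * (A x)⁻¹ l j = (1 : Matrix ι ι ℝ) r j := fun r => by
    rw [← Matrix.mul_nonsing_inv (A x) (isUnit_iff_ne_zero.2 hx), Matrix.mul_apply]
  simp only [_root_.neg_apply, _root_.sum_apply,
    _root_.smul_apply, smul_eq_mul]
  calc fderivWithin ℝ (fun y => (A y)⁻¹ i j) s x v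
      = ∑ r, (∑ l, A x r l * (A x)⁻¹ l j) * fderivWithin ℝ (fun y => (A y)⁻¹ i r) s x v := by
        simp [h4, Matrix.one_apply]
    _ = ∑ l, (A x)⁻¹ l j * ∑ r, A x r l * fderivWithin ℝ (fun y => (A y)⁻¹ i r) s x v := by
        simp only [Finset.sum_mul, Finset.mul_sum]
        rw [Finset.sum_comm]
        exact Finset.sum_congr rfl fun _ _ => Finset.sum_congr rfl fun _ _ => by ring
    _ = -∑ k, ∑ l, (A x)⁻¹ i k * (A x)⁻¹ l j * A' k l v := by
        simp only [h3, mul_neg, Finset.sum_neg_distrib, Finset.mul_sum]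
        rw [Finset.sum_comm]
        congr 1
        exact Finset.sum_congr rfl fun _ _ => Finset.sum_congr rfl fun _ _ => by ring

end MatrixCalculus

/-! ### The Laplacian and integration by parts on an open set of coordinate space. -/

section CoordinateCalculus

variable {n : ℕ} {U : Set (Model n)} {u w : Model n → ℝ} {y : Model n}
  {G : Model n → Matrix (Fin n) (Fin n) ℝ}

theorem _root_.HasFDerivAt.pd_eq {F : Model n → ℝ} {F' : Model n →L[ℝ] ℝ} (h : HasFDerivAt F F' y)
    (i : Fin n) : pd i F y = F' (EuclideanSpace.single i 1) := by
  rw [pd, h.fderiv]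

theorem pd_congr {F F' : Model n → ℝ} (h : F =ᶠ[nhds y] F') (i : Fin n) : pd i F y = pd i F' y := by
  rw [pd, pd, h.fderiv_eq]

theorem pd_mul (hu : DifferentiableAt ℝ u y) (hw : DifferentiableAt ℝ w y) (i : Fin n) :
    pd i (fun z => u z * w z) y = u y * pd i w y + w y * pd i u y := by
  rw [HasFDerivAt.pd_eq (F := fun z => u z * w z) (hu.hasFDerivAt.mul hw.hasFDerivAt)]
  simp [pd]

theorem pd_sum {κ : Type*} {S : Finset κ} {F : κ → Model n → ℝ}
    (h : ∀ k ∈ S, DifferentiableAt ℝ (F k) y) (i : Fin n) :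
    pd i (fun z => ∑ k ∈ S, F k z) y = ∑ k ∈ S, pd i (F k) y := by
  rw [(HasFDerivAt.fun_sum fun k hk => (h k hk).hasFDerivAt).pd_eq]
  simp [pd]

theorem contDiffOn_pd (hU : IsOpen U) (hu : ContDiffOn ℝ ∞ u U) (i : Fin n) :
    ContDiffOn ℝ ∞ (pd i u) U :=
  (hu.fderiv_of_isOpen hU (m := ∞) (by simp)).clm_apply contDiffOn_const

/-- The pairing of the differentials of `u` and `w` with respect to the inverse of `G`. -/
def coordInner (G : Model n → Matrix (Fin n) (Fin n) ℝ) (u w : Model n → ℝ) (y : Model n) : ℝ :=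
  ∑ i, ∑ j, (G y)⁻¹ i j * pd i u y * pd j w y

/-- The trace of the coordinate Hessian. -/
def coordLaplacian (G : Model n → Matrix (Fin n) (Fin n) ℝ) (u : Model n → ℝ) (y : Model n) : ℝ :=
  ∑ i, ∑ j, (G y)⁻¹ i j * hessCoord G u y i j

theorem contDiffOn_inv_apply (hG : ∀ i j, ContDiffOn ℝ ∞ (fun y => G y i j) U)
    (hdet : ∀ y ∈ U, (G y).det ≠ 0) (i j : Fin n) :
    ContDiffOn ℝ ∞ (fun y => (G y)⁻¹ i j) U := fun y hy =>
  contDiffWithinAt_matrix_inv (fun i j => hG i j y hy) (hdet y hy) i j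

theorem contDiffOn_coordInner (hU : IsOpen U) (hG : ∀ i j, ContDiffOn ℝ ∞ (fun y => G y i j) U)
    (hdet : ∀ y ∈ U, (G y).det ≠ 0) (hu : ContDiffOn ℝ ∞ u U) (hw : ContDiffOn ℝ ∞ w U) :
    ContDiffOn ℝ ∞ (coordInner G u w) U :=
  ContDiffOn.sum fun i _ => ContDiffOn.sum fun j _ =>
    ((contDiffOn_inv_apply hG hdet i j).mul (contDiffOn_pd hU hu i)).mul (contDiffOn_pd hU hw j)

theorem contDiffOn_christoffel (hU : IsOpen U) (hG : ∀ i j, ContDiffOn ℝ ∞ (fun y => G y i j) U)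
    (hdet : ∀ y ∈ U, (G y).det ≠ 0) (k i j : Fin n) :
    ContDiffOn ℝ ∞ (christoffel G k i j) U :=
  contDiffOn_const.mul (ContDiffOn.sum fun l _ => (contDiffOn_inv_apply hG hdet k l).mul
    (((contDiffOn_pd hU (hG j l) i).add (contDiffOn_pd hU (hG i l) j)).sub
      (contDiffOn_pd hU (hG i j) l)))

theorem contDiffOn_coordLaplacian (hU : IsOpen U)
    (hG : ∀ i j, ContDiffOn ℝ ∞ (fun y => G y i j) U)
    (hdet : ∀ y ∈ U, (G y).det ≠ 0) (hu : ContDiffOn ℝ ∞ u U) :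
    ContDiffOn ℝ ∞ (coordLaplacian G u) U :=
  ContDiffOn.sum fun i _ => ContDiffOn.sum fun j _ => (contDiffOn_inv_apply hG hdet i j).mul
    ((contDiffOn_pd hU (contDiffOn_pd hU hu j) i).sub
      (ContDiffOn.sum fun k _ => (contDiffOn_christoffel hU hG hdet k i j).mul
        (contDiffOn_pd hU hu k)))

/-- The index computation behind `divergence_form`, with a = g⁻¹, c i j k = ∂ᵢ gⱼₖ and ξ = du. The
first summand comes from ∂ᵢ √det g and the second from ∂ᵢ gⁱʲ; together they leave -gⁱʲ Γᵏᵢⱼ ∂ₖu, by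
relabelling and the symmetries of a and c. -/
theorem christoffel_contraction (a : Fin n → Fin n → ℝ) (c : Fin n → Fin n → Fin n → ℝ)
    (ha : ∀ i j, a i j = a j i) (hc : ∀ i j k, c i j k = c i k j) (ξ : Fin n → ℝ) :
    ∑ i, ∑ j, ((1 / 2) * (∑ r, ∑ s, a r s * c i s r) * a i j * ξ j
        - (∑ r, ∑ s, a i r * a s j * c i r s) * ξ j)
      = -∑ i, ∑ j, a i j * ∑ k, ((1 / 2) * ∑ l, a k l * (c i j l + c j i l - c l i j)) * ξ k := by
  have e1 : ∑ i, ∑ j, (1 / 2) * (∑ r, ∑ s, a r s * c i s r) * a i j * ξ j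
      = (1 / 2) * ∑ i, ∑ j, ∑ k, ∑ l, a i j * a k l * c l i j * ξ k := by
    simp only [Finset.mul_sum, Finset.sum_mul]
    calc _ = ∑ l, ∑ i, ∑ j, ∑ k, 1 / 2 * (a i j * a k l * c l i j * ξ k) := by
          refine Finset.sum_congr rfl fun l _ => ?_
          rw [Finset.sum_comm]
          refine Finset.sum_congr rfl fun i _ => ?_
          rw [Finset.sum_comm]
          refine Finset.sum_congr rfl fun j _ => Finset.sum_congr rfl fun k _ => ?_
          rw [hc l j i, ha l k]; ring
      _ = _ := by
          rw [Finset.sum_comm]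
          refine Finset.sum_congr rfl fun i _ => ?_
          rw [Finset.sum_comm]
          refine Finset.sum_congr rfl fun j _ => ?_
          rw [Finset.sum_comm]
  have e2 : ∑ i, ∑ j, (∑ r, ∑ s, a i r * a s j * c i r s) * ξ j
      = ∑ i, ∑ j, ∑ k, ∑ l, a i j * a k l * c i j l * ξ k := by
    simp only [Finset.sum_mul]
    refine Finset.sum_congr rfl fun i _ => ?_
    rw [Finset.sum_comm]
    refine Finset.sum_congr rfl fun j _ => Finset.sum_congr rfl fun k _ =>
      Finset.sum_congr rfl fun l _ => ?_
    rw [ha l k]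
  have e3 : ∑ i, ∑ j, ∑ k, ∑ l, a i j * a k l * c j i l * ξ k
      = ∑ i, ∑ j, ∑ k, ∑ l, a i j * a k l * c i j l * ξ k := by
    rw [Finset.sum_comm]
    refine Finset.sum_congr rfl fun i _ => Finset.sum_congr rfl fun j _ => ?_
    rw [ha j i]
  have e4 : ∑ i, ∑ j, a i j * ∑ k, ((1 / 2) * ∑ l, a k l * (c i j l + c j i l - c l i j)) * ξ k
      = (1 / 2) * (∑ i, ∑ j, ∑ k, ∑ l, a i j * a k l * c i j l * ξ k
        + ∑ i, ∑ j, ∑ k, ∑ l, a i j * a k l * c j i l * ξ k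
        - ∑ i, ∑ j, ∑ k, ∑ l, a i j * a k l * c l i j * ξ k) := by
    simp only [← Finset.sum_add_distrib, ← Finset.sum_sub_distrib, Finset.mul_sum, Finset.sum_mul]
    refine Finset.sum_congr rfl fun i _ => Finset.sum_congr rfl fun j _ =>
      Finset.sum_congr rfl fun k _ => Finset.sum_congr rfl fun l _ => ?_
    ring
  simp only [Finset.sum_sub_distrib]
  rw [e1, e2, e4, e3]
  ring

theorem _root_.ContDiffOn.differentiableAt_of_isOpen {F : Model n → ℝ} (hF : ContDiffOn ℝ ∞ F U)
    (hU : IsOpen U) (hy : y ∈ U) : DifferentiableAt ℝ F y :=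
  (hF.contDiffAt (hU.mem_nhds hy)).differentiableAt (by simp)

theorem pd_inv_apply (h : ∀ i j, DifferentiableAt ℝ (fun z => G z i j) y) (hdet : (G y).det ≠ 0)
    (i k l : Fin n) : pd i (fun z => (G z)⁻¹ k l) y
      = -∑ r, ∑ s, (G y)⁻¹ k r * (G y)⁻¹ s l * pd i (fun z => G z r s) y := by
  have := hasFDerivWithinAt_matrix_inv (s := univ) (A := G)
    (fun i j => (h i j).hasFDerivAt.hasFDerivWithinAt) hdet uniqueDiffWithinAt_univ k l
  rw [(hasFDerivWithinAt_univ.1 this).pd_eq]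
  simp [pd, _root_.sum_apply]

theorem pd_sqrt_det (h : ∀ i j, DifferentiableAt ℝ (fun z => G z i j) y) (hdet : 0 < (G y).det)
    (i : Fin n) : pd i (fun z => Real.sqrt (G z).det) y
      = (1 / 2) * (∑ r, ∑ s, (G y)⁻¹ r s * pd i (fun z => G z s r) y)
        * Real.sqrt (G y).det := by
  have h1 := hasFDerivWithinAt_univ.1 (hasFDerivWithinAt_matrix_det (s := univ) (A := G)
    (fun i j => (h i j).hasFDerivAt.hasFDerivWithinAt))
  rw [(h1.sqrt hdet.ne').pd_eq]
  have hs : 0 < Real.sqrt (G y).det := Real.sqrt_pos.2 hdet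
  have hs2 : Real.sqrt (G y).det ^ 2 = (G y).det := Real.sq_sqrt hdet.le
  have hadj : ∀ r s, (G y).adjugate r s = (G y).det * (G y)⁻¹ r s := fun r s => by
    rw [Matrix.inv_def, Matrix.smul_apply, Ring.inverse_eq_inv', smul_eq_mul,
      mul_inv_cancel_left₀ hdet.ne']
  simp only [_root_.smul_apply, _root_.sum_apply, smul_eq_mul, hadj, mul_assoc, ← Finset.mul_sum]
  change _ * (_ * ∑ r, ∑ s, (G y)⁻¹ r s * pd i (fun z => G z s r) y) = _
  rw [← hs2]
  field_simp
  rw [Real.sqrt_sq hs.le]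

/-- The divergence form of the Laplacian. -/
theorem divergence_form (hU : IsOpen U) (hG : ∀ i j, ContDiffOn ℝ ∞ (fun y => G y i j) U)
    (hsymm : ∀ y i j, G y i j = G y j i) (hdet : ∀ y ∈ U, 0 < (G y).det)
    (hu : ContDiffOn ℝ ∞ u U) (hy : y ∈ U) :
    ∑ i, pd i (fun z => Real.sqrt (G z).det * ∑ j, (G z)⁻¹ i j * pd j u z) y
      = coordLaplacian G u y * Real.sqrt (G y).det := by
  have hdet' : ∀ y ∈ U, (G y).det ≠ 0 := fun y hy => (hdet y hy).ne'
  have hGd : ∀ i j, DifferentiableAt ℝ (fun z => G z i j) y := fun i j =>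
    (hG i j).differentiableAt_of_isOpen hU hy
  have hid : ∀ i j, DifferentiableAt ℝ (fun z => (G z)⁻¹ i j) y := fun i j =>
    (contDiffOn_inv_apply hG hdet' i j).differentiableAt_of_isOpen hU hy
  have hud : ∀ j, DifferentiableAt ℝ (pd j u) y := fun j =>
    (contDiffOn_pd hU hu j).differentiableAt_of_isOpen hU hy
  have hsd : DifferentiableAt ℝ (fun z => Real.sqrt (G z).det) y :=
    ((hasFDerivWithinAt_univ.1 (hasFDerivWithinAt_matrix_det (s := univ) (A := G)
    (fun i j => (hGd i j).hasFDerivAt.hasFDerivWithinAt))).sqrt (hdet' y hy)).differentiableAt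
  have hGsymm : ∀ i j, (G y)⁻¹ i j = (G y)⁻¹ j i := fun i j => by
    have : (G y).transpose = G y := Matrix.ext fun i j => hsymm y j i
    conv_lhs => rw [← this, ← Matrix.transpose_nonsing_inv, Matrix.transpose_apply]
  have e1 : ∀ i, pd i (fun z => Real.sqrt (G z).det * ∑ j, (G z)⁻¹ i j * pd j u z) y
      = Real.sqrt (G y).det * ∑ j, ((G y)⁻¹ i j * pd i (pd j u) y
        + ((1 / 2) * (∑ r, ∑ s, (G y)⁻¹ r s * pd i (fun z => G z s r) y) * (G y)⁻¹ i j * pd j u y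
        - (∑ r, ∑ s, (G y)⁻¹ i r * (G y)⁻¹ s j * pd i (fun z => G z r s) y) * pd j u y)) := by
    intro i
    rw [pd_mul hsd (DifferentiableAt.fun_sum fun j _ => (hid i j).fun_mul (hud j)),
      pd_sum (fun j _ => (hid i j).fun_mul (hud j)), pd_sqrt_det hGd (hdet y hy)]
    generalize (∑ r, ∑ s, (G y)⁻¹ r s * pd i (fun z => G z s r) y) = c
    have e2 : ∀ j, pd i (fun z => (G z)⁻¹ i j * pd j u z) y
        = (G y)⁻¹ i j * pd i (pd j u) y
          - (∑ r, ∑ s, (G y)⁻¹ i r * (G y)⁻¹ s j * pd i (fun z => G z r s) y) * pd j u y :=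
      fun j => by rw [pd_mul (hid i j) (hud j), pd_inv_apply hGd (hdet' y hy)]; ring
    simp only [e2, Finset.sum_add_distrib, Finset.sum_sub_distrib, mul_assoc, ← Finset.mul_sum]
    ring
  simp only [e1, ← Finset.mul_sum, Finset.sum_add_distrib]
  rw [christoffel_contraction (fun i j => (G y)⁻¹ i j) (fun i j k => pd i (fun z => G z j k) y)
    hGsymm (fun i j k => by simp only [hsymm _ j k])]
  rw [mul_comm, ← sub_eq_add_neg]
  congr 1
  simp only [coordLaplacian, hessCoord, christoffel, mul_sub, Finset.sum_sub_distrib]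

theorem continuous_of_eq_zero_off {X Y : Type*} [TopologicalSpace X] [TopologicalSpace Y] [Zero Y]
    {U K : Set X} (hU : IsOpen U) (hK : IsClosed K) (hKU : K ⊆ U) {F : X → Y}
    (hF : ContinuousOn F U) (h0 : ∀ x ∉ K, F x = 0) : Continuous F := by
  rw [continuous_iff_continuousAt]
  intro x
  by_cases hx : x ∈ U
  · exact hF.continuousAt (hU.mem_nhds hx)
  · have : F =ᶠ[nhds x] fun _ => 0 := by
      filter_upwards [hK.isOpen_compl.mem_nhds fun h => hx (hKU h)] with z hz using h0 z hz
    exact continuousAt_const.congr this.symm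

theorem integrable_of_eq_zero_off {X : Type*} [TopologicalSpace X] [T2Space X] [MeasurableSpace X]
    [BorelSpace X] {μ : Measure X} [IsFiniteMeasureOnCompacts μ]
    {U K : Set X} (hU : IsOpen U) (hK : IsCompact K) (hKU : K ⊆ U) {F : X → ℝ}
    (hF : ContinuousOn F U) (h0 : ∀ x ∉ K, F x = 0) : Integrable F μ :=
  (continuous_of_eq_zero_off hU hK.isClosed hKU hF h0).integrable_of_hasCompactSupport
    (HasCompactSupport.intro hK h0)

/-- The divergence form is integrated by parts in each coordinate. Because w vanishes off a compact
subset of U, all the products are continuous with compact support on the whole space, although G and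
u are controlled on U only. -/
theorem integral_mul_coordLaplacian (hU : IsOpen U)
    (hG : ∀ i j, ContDiffOn ℝ ∞ (fun y => G y i j) U)
    (hsymm : ∀ y i j, G y i j = G y j i) (hdet : ∀ y ∈ U, 0 < (G y).det)
    (hu : ContDiffOn ℝ ∞ u U) {K : Set (Model n)} (hK : IsCompact K) (hKU : K ⊆ U)
    (hw : ContDiffOn ℝ ∞ w U) (hw0 : ∀ y ∉ K, w y = 0) :
    ∫ y, w y * coordLaplacian G u y * Real.sqrt (G y).det
      = -∫ y, coordInner G w u y * Real.sqrt (G y).det := by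
  have hdet' : ∀ y ∈ U, (G y).det ≠ 0 := fun y hy => (hdet y hy).ne'
  set X : Fin n → Model n → ℝ :=
    fun i z => Real.sqrt (G z).det * ∑ j, (G z)⁻¹ i j * pd j u z with hX
  have hXs : ∀ i, ContDiffOn ℝ ∞ (X i) U := fun i => by
    refine ContDiffOn.mul (fun y hy => ?_) (ContDiffOn.sum fun j _ =>
      (contDiffOn_inv_apply hG hdet' i j).mul (contDiffOn_pd hU hu j))
    exact (contDiffWithinAt_matrix_det fun i j => hG i j y hy).sqrt (hdet' y hy)
  have hpw0 : ∀ i, ∀ y ∉ K, pd i w y = 0 := fun i y hy => by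
    have : w =ᶠ[nhds y] fun _ => 0 := by
      filter_upwards [hK.isClosed.isOpen_compl.mem_nhds hy] with z hz using hw0 z hz
    rw [pd_congr this]
    simp [pd]
  have hdiff : ∀ y, DifferentiableAt ℝ w y := fun y => by
    by_cases hy : y ∈ U
    · exact hw.differentiableAt_of_isOpen hU hy
    · have : w =ᶠ[nhds y] fun _ => 0 := by
        filter_upwards [hK.isClosed.isOpen_compl.mem_nhds fun h => hy (hKU h)] with z hz
          using hw0 z hz
      exact (differentiableAt_const _).congr_of_eventuallyEq this
  have hsupp : tsupport w ⊆ K :=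
    closure_minimal (fun z hz => by_contra fun h => hz (hw0 z h)) hK.isClosed
  have i1 : ∀ i, Integrable (fun y => w y * pd i (X i) y) := fun i =>
    integrable_of_eq_zero_off hU hK hKU
      (hw.continuousOn.mul (contDiffOn_pd hU (hXs i) i).continuousOn)
      fun y hy => by simp [hw0 y hy]
  have i2 : ∀ i, Integrable (fun y => pd i w y * X i y) := fun i =>
    integrable_of_eq_zero_off hU hK hKU
      ((contDiffOn_pd hU hw i).continuousOn.mul (hXs i).continuousOn)
      fun y hy => by simp [hpw0 i y hy]
  have i3 : ∀ i, Integrable (fun y => w y * X i y) := fun i =>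
    integrable_of_eq_zero_off hU hK hKU (hw.continuousOn.mul (hXs i).continuousOn)
      fun y hy => by simp [hw0 y hy]
  calc ∫ y, w y * coordLaplacian G u y * Real.sqrt (G y).det
      = ∫ y, ∑ i, w y * pd i (X i) y := by
        congr 1
        ext y
        by_cases hy : y ∈ K
        · rw [mul_assoc, ← divergence_form hU hG hsymm hdet hu (hKU hy), Finset.mul_sum]
        · simp [hw0 y hy]
    _ = ∑ i, ∫ y, w y * pd i (X i) y := integral_finsetSum _ fun i _ => i1 i
    _ = ∑ i, -∫ y, pd i w y * X i y := Finset.sum_congr rfl fun i _ =>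
        integral_mul_fderiv_eq_neg_fderiv_mul_of_integrable (i2 i) (i1 i) (i3 i)
          (fun y _ => hdiff y)
          fun y hy => (hXs i).differentiableAt_of_isOpen hU (hKU (hsupp hy))
    _ = -∫ y, ∑ i, pd i w y * X i y := by
        rw [Finset.sum_neg_distrib, integral_finsetSum _ fun i _ => i2 i]
    _ = -∫ y, coordInner G w u y * Real.sqrt (G y).det := by
        congr 2
        ext y
        simp only [coordInner, hX, Finset.sum_mul, Finset.mul_sum]
        exact Finset.sum_congr rfl fun i _ => Finset.sum_congr rfl fun j _ => by ring

end CoordinateCalculus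

/-! ### Changes of charts and the invariance of the gradient pairing. -/

section Charts

variable {n : ℕ} {M : Type*} [TopologicalSpace M] [ChartedSpace (Model n) M]
  [IsManifold (𝓡 n) ∞ M]

set_option linter.unusedSectionVars false

/-- The differential of the inverse of the chart at `a`. -/
def chartFrame (a : M) (y : Model n) :
    Model n →L[ℝ] TangentSpace (𝓡 n) ((extChartAt (𝓡 n) a).symm y) :=
  mfderivWithin 𝓘(ℝ, Model n) (𝓡 n) (extChartAt (𝓡 n) a).symm (range (𝓡 n)) y

theorem gram_apply (g : Metric n M) (a : M) (y : Model n) (i j : Fin n) :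
    gram g a y i j = g.inner ((extChartAt (𝓡 n) a).symm y)
      (chartFrame a y (EuclideanSpace.single i 1)) (chartFrame a y (EuclideanSpace.single j 1)) :=
  rfl

theorem gram_symm (g : Metric n M) (a : M) (y : Model n) (i j : Fin n) :
    gram g a y i j = gram g a y j i := g.symm _ _ _

theorem isOpen_target (a : M) : IsOpen (extChartAt (𝓡 n) a).target :=
  isOpen_extChartAt_target a

theorem sum_single_eq (ξ : Model n) : ∑ i, ξ i • (EuclideanSpace.single i 1 : Model n) = ξ := by
  ext j
  simp [Finset.sum_apply, Pi.single_apply]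

theorem gram_quadratic (g : Metric n M) (a : M) (y : Model n) (ξ η : Model n) :
    ∑ i, ∑ j, gram g a y i j * ξ i * η j
      = g.inner ((extChartAt (𝓡 n) a).symm y) (chartFrame a y ξ) (chartFrame a y η) := by
  conv_rhs => rw [← sum_single_eq ξ, ← sum_single_eq η]
  simp only [map_sum, map_smul, _root_.sum_apply, _root_.smul_apply, smul_eq_mul, gram_apply]
  rw [Finset.sum_comm]
  refine Finset.sum_congr rfl fun i _ => ?_
  rw [Finset.mul_sum]
  exact Finset.sum_congr rfl fun j _ => by ring

theorem chartFrame_injective {a : M} {y : Model n} (hy : y ∈ (extChartAt (𝓡 n) a).target) :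
    Function.Injective (chartFrame a y) :=
  (isInvertible_mfderivWithin_extChartAt_symm (I := 𝓡 n) hy).injective

theorem gram_posDef (g : Metric n M) {a : M} {y : Model n}
    (hy : y ∈ (extChartAt (𝓡 n) a).target) : (gram g a y).PosDef := by
  refine Matrix.PosDef.of_dotProduct_mulVec_pos (Matrix.ext fun i j => ?_) fun ξ hξ => ?_
  · simp [gram_symm g a y i j]
  · have h1 := gram_quadratic g a y (WithLp.toLp 2 ξ) (WithLp.toLp 2 ξ)
    have h2 : chartFrame a y (WithLp.toLp 2 ξ) ≠ 0 := fun h => hξ <| by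
      have := chartFrame_injective hy (h.trans (map_zero _).symm)
      simpa using this
    have h3 := g.pos _ _ h2
    rw [← h1] at h3
    simp only [dotProduct, Matrix.mulVec, Finset.mul_sum]
    refine h3.trans_eq (Finset.sum_congr rfl fun i _ => Finset.sum_congr rfl fun j _ => ?_)
    simp
    ring

theorem gram_det_pos (g : Metric n M) {a : M} {y : Model n}
    (hy : y ∈ (extChartAt (𝓡 n) a).target) : 0 < (gram g a y).det := (gram_posDef g hy).det_pos

/-- The change of coordinates from the chart at `a` to the chart at `b`. -/
def transition (a b : M) (y : Model n) : Model n :=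
  extChartAt (𝓡 n) b ((extChartAt (𝓡 n) a).symm y)

/-- The domain of the change of coordinates from the chart at `a` to the chart at `b`. -/
def overlap (a b : M) : Set (Model n) :=
  (extChartAt (𝓡 n) a).target ∩ (extChartAt (𝓡 n) a).symm ⁻¹' (extChartAt (𝓡 n) b).source

theorem isOpen_overlap (a b : M) : IsOpen (overlap (n := n) a b) :=
  (continuousOn_extChartAt_symm a).isOpen_inter_preimage (isOpen_target a)
    (isOpen_extChartAt_source b)

theorem contDiffOn_transition (a b : M) : ContDiffOn ℝ ∞ (transition (n := n) a b) (overlap a b) := by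
  rw [← contMDiffOn_iff_contDiffOn]
  exact (contMDiffOn_extChartAt (I := 𝓡 n) (x := b)).comp
    ((contMDiffOn_extChartAt_symm (I := 𝓡 n) a).mono inter_subset_left)
    fun y hy => by simpa using hy.2

theorem transition_mem_overlap {a b : M} {y : Model n} (hy : y ∈ overlap a b) :
    transition a b y ∈ overlap b a := by
  refine ⟨(extChartAt (𝓡 n) b).map_source hy.2, ?_⟩
  rw [mem_preimage, transition, (extChartAt (𝓡 n) b).left_inv hy.2]
  exact (extChartAt (𝓡 n) a).map_target hy.1

theorem symm_transition {a b : M} {y : Model n} (hy : y ∈ overlap a b) :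
    (extChartAt (𝓡 n) b).symm (transition a b y) = (extChartAt (𝓡 n) a).symm y :=
  (extChartAt (𝓡 n) b).left_inv hy.2

theorem transition_transition {a b : M} {y : Model n} (hy : y ∈ overlap a b) :
    transition b a (transition a b y) = y := by
  rw [transition, symm_transition hy, (extChartAt (𝓡 n) a).right_inv hy.1]

theorem mdifferentiableAt_symm {a : M} {y : Model n} (hy : y ∈ (extChartAt (𝓡 n) a).target) :
    MDifferentiableAt 𝓘(ℝ, Model n) (𝓡 n) (extChartAt (𝓡 n) a).symm y :=
  ((contMDiffOn_extChartAt_symm (I := 𝓡 n) (n := ∞) a).contMDiffAt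
    ((isOpen_target a).mem_nhds hy)).mdifferentiableAt (by simp)

theorem differentiableAt_transition {a b : M} {y : Model n} (hy : y ∈ overlap a b) :
    DifferentiableAt ℝ (transition (n := n) a b) y :=
  ((contDiffOn_transition a b).contDiffAt ((isOpen_overlap a b).mem_nhds hy)).differentiableAt
    (by simp)

theorem chartFrame_transition {a b : M} {y : Model n} (hy : y ∈ overlap a b) (ξ : Model n) :
    (chartFrame a y ξ : Model n)
      = chartFrame b (transition a b y) (fderiv ℝ (transition a b) y ξ) := by
  have hev : (extChartAt (𝓡 n) a).symm
      =ᶠ[nhds y] (extChartAt (𝓡 n) b).symm ∘ transition a b := by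
    filter_upwards [(isOpen_overlap a b).mem_nhds hy] with z hz using (symm_transition hz).symm
  have h1 := mfderiv_comp (I := 𝓘(ℝ, Model n)) (I' := 𝓘(ℝ, Model n)) (I'' := 𝓡 n) y
    (mdifferentiableAt_symm (transition_mem_overlap hy).1)
    (differentiableAt_transition hy).mdifferentiableAt
  have h2 := hev.mfderiv_eq (I := 𝓘(ℝ, Model n)) (I' := 𝓡 n)
  rw [h1, mfderiv_eq_fderiv] at h2
  have h3 := congrArg (fun L : Model n →L[ℝ] Model n => L ξ) h2
  simp only [chartFrame, ModelWithCorners.range_eq_univ, mfderivWithin_univ]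
  exact h3

/-- The Jacobian matrix of the change of coordinates from the chart at `a` to the chart at `b`. -/
def jacobian (a b : M) (y : Model n) : Matrix (Fin n) (Fin n) ℝ :=
  fun k i => fderiv ℝ (transition (n := n) a b) y (EuclideanSpace.single i 1) k

theorem inner_congr (g : Metric n M) {x x' : M} (h : x = x') (ξ η : Model n) :
    g.inner x (ξ : TangentSpace (𝓡 n) x) (η : TangentSpace (𝓡 n) x)
      = g.inner x' (ξ : TangentSpace (𝓡 n) x') (η : TangentSpace (𝓡 n) x') := by
  subst h
  rfl

theorem gram_transition (g : Metric n M) {a b : M} {y : Model n} (hy : y ∈ overlap a b) :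
    gram g a y = (jacobian a b y).transpose * gram g b (transition a b y) * jacobian a b y := by
  ext i j
  rw [gram_apply]
  have h1 := chartFrame_transition hy (EuclideanSpace.single i 1)
  have h2 := chartFrame_transition hy (EuclideanSpace.single j 1)
  have h3 := inner_congr g (symm_transition hy).symm (chartFrame a y (EuclideanSpace.single i 1))
    (chartFrame a y (EuclideanSpace.single j 1))
  refine h3.trans ?_
  rw [h1, h2]
  refine (gram_quadratic g b _ _ _).symm.trans ?_
  simp only [Matrix.mul_apply, Matrix.transpose_apply, Finset.sum_mul, jacobian]
  rw [Finset.sum_comm]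
  exact Finset.sum_congr rfl fun i _ => Finset.sum_congr rfl fun j _ => by ring

theorem jacobian_det_ne_zero (g : Metric n M) {a b : M} {y : Model n} (hy : y ∈ overlap a b) :
    (jacobian a b y).det ≠ 0 := fun h => by
  have := (gram_det_pos g hy.1).ne'
  rw [gram_transition g hy] at this
  simp [h] at this

theorem fderiv_eq_sum_pd (F : Model n → ℝ) (z ξ : Model n) :
    fderiv ℝ F z ξ = ∑ k, ξ k * pd k F z := by
  conv_lhs => rw [← sum_single_eq ξ]
  simp [pd]

/-- The coordinate expression of `u` in the chart at `a`. -/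
def inChart (a : M) (u : M → ℝ) (y : Model n) : ℝ := u ((extChartAt (𝓡 n) a).symm y)

theorem inChart_transition {a b : M} {y : Model n} (hy : y ∈ overlap a b) (u : M → ℝ) :
    inChart b u (transition a b y) = inChart a u y := by
  rw [inChart, symm_transition hy, inChart]

theorem pd_inChart_transition {a b : M} {y : Model n} (hy : y ∈ overlap a b) {u : M → ℝ}
    (hu : DifferentiableAt ℝ (inChart (n := n) b u) (transition a b y)) (i : Fin n) :
    pd i (inChart a u) y = ∑ k, jacobian a b y k i * pd k (inChart b u) (transition a b y) := by
  have hev : inChart a u =ᶠ[nhds y] inChart b u ∘ transition a b := by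
    filter_upwards [(isOpen_overlap a b).mem_nhds hy] with z hz
      using (inChart_transition hz u).symm
  rw [pd_congr hev, pd, fderiv_comp y hu (differentiableAt_transition hy)]
  exact fderiv_eq_sum_pd _ _ _

theorem coordInner_eq_dotProduct (G : Model n → Matrix (Fin n) (Fin n) ℝ) (u w : Model n → ℝ)
    (y : Model n) : coordInner G u w y
      = (fun i => pd i u y) ⬝ᵥ (((G y)⁻¹).mulVec fun j => pd j w y) := by
  simp only [coordInner, dotProduct, Matrix.mulVec, Finset.mul_sum]
  exact Finset.sum_congr rfl fun i _ => Finset.sum_congr rfl fun j _ => by ring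

/-- Differentials pull back by Jᵀ and Gram matrices by Jᵀ G J, where J is the Jacobian of the
transition map, so the factors J cancel against those of the inverse matrix. -/
theorem coordInner_transition (g : Metric n M) {a b : M} {y : Model n} (hy : y ∈ overlap a b)
    {u w : M → ℝ} (hu : DifferentiableAt ℝ (inChart (n := n) b u) (transition a b y))
    (hw : DifferentiableAt ℝ (inChart (n := n) b w) (transition a b y)) :
    coordInner (gram g a) (inChart a u) (inChart a w) y
      = coordInner (gram g b) (inChart b u) (inChart b w) (transition a b y) := by
  have hJ : IsUnit (jacobian a b y).det := isUnit_iff_ne_zero.2 (jacobian_det_ne_zero g hy)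
  have e : ∀ {u : M → ℝ}, DifferentiableAt ℝ (inChart (n := n) b u) (transition a b y) →
      (fun i => pd i (inChart a u) y)
        = (jacobian a b y).transpose.mulVec fun k => pd k (inChart b u) (transition a b y) :=
    fun hu => funext fun i => by rw [pd_inChart_transition hy hu]; rfl
  rw [coordInner_eq_dotProduct, coordInner_eq_dotProduct, e hu, e hw, gram_transition g hy,
    Matrix.mul_inv_rev, Matrix.mul_inv_rev, Matrix.mulVec_transpose, ← Matrix.dotProduct_mulVec,
    Matrix.mulVec_mulVec, Matrix.mulVec_mulVec, ← Matrix.mul_assoc,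
    Matrix.mul_nonsing_inv _ hJ, Matrix.one_mul, Matrix.mul_assoc,
    Matrix.nonsing_inv_mul _ (by rwa [Matrix.det_transpose]), Matrix.mul_one]

end Charts

/-! ### The Riemannian volume measure and its description in a chart. -/

section Volume

variable {n : ℕ} {M : Type*} [TopologicalSpace M] [ChartedSpace (Model n) M]
  [IsManifold (𝓡 n) ∞ M]

set_option linter.unusedSectionVars false

/-- The components of `g` are smooth in every chart. -/
def SmoothGram (g : Metric n M) : Prop := ∀ (a : M) (i j : Fin n),
  ContDiffOn ℝ ∞ (fun y => gram g a y i j) (extChartAt (𝓡 n) a).target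

/-- The density of the volume measure in the chart at `a`. -/
def chartDensity (g : Metric n M) (a : M) (y : Model n) : ℝ := Real.sqrt (gram g a y).det

theorem chartDensity_pos (g : Metric n M) {a : M} {y : Model n}
    (hy : y ∈ (extChartAt (𝓡 n) a).target) : 0 < chartDensity g a y :=
  Real.sqrt_pos.2 (gram_det_pos g hy)

theorem SmoothGram.contDiffOn_density {g : Metric n M} (hg : SmoothGram g) (a : M) :
    ContDiffOn ℝ ∞ (chartDensity g a) (extChartAt (𝓡 n) a).target := fun y hy =>
  (contDiffWithinAt_matrix_det fun i j => hg a i j y hy).sqrt (gram_det_pos g hy).ne'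

theorem chartDensity_transition (g : Metric n M) {a b : M} {y : Model n} (hy : y ∈ overlap a b) :
    chartDensity g a y
      = |(fderiv ℝ (transition (n := n) a b) y).det| * chartDensity g b (transition a b y) := by
  have h1 : (fderiv ℝ (transition (n := n) a b) y).det = (jacobian a b y).det := by
    rw [ContinuousLinearMap.det,
      ← LinearMap.det_toMatrix (EuclideanSpace.basisFun (Fin n) ℝ).toBasis]
    congr 1
  rw [chartDensity, gram_transition g hy, h1, Matrix.det_mul, Matrix.det_mul,
    Matrix.det_transpose, chartDensity, ← Real.sqrt_sq_eq_abs, ← Real.sqrt_mul (sq_nonneg _)]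
  ring_nf

variable [MeasurableSpace M] [BorelSpace M]

theorem _root_.ContinuousOn.measurableSet_preimage_inter {X Y : Type*} [TopologicalSpace X]
    [MeasurableSpace X] [OpensMeasurableSpace X] [TopologicalSpace Y] [MeasurableSpace Y]
    [BorelSpace Y] {f : X → Y} {s : Set X} (hf : ContinuousOn f s) (hs : MeasurableSet s)
    {t : Set Y} (ht : MeasurableSet t) : MeasurableSet (f ⁻¹' t ∩ s) := by
  have h1 := (continuousOn_iff_continuous_domRestrict.1 hf).measurable ht
  have h2 := hs.subtype_image h1
  convert h2 using 1
  ext x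
  simp [and_comm]

theorem measurableSet_symm_preimage (a : M) {S : Set M} (hS : MeasurableSet S) :
    MeasurableSet ((extChartAt (𝓡 n) a).symm ⁻¹' S ∩ (extChartAt (𝓡 n) a).target) :=
  (continuousOn_extChartAt_symm a).measurableSet_preimage_inter (isOpen_target a).measurableSet hS

theorem aemeasurable_symm (a : M) : AEMeasurable (extChartAt (𝓡 n) a).symm
    ((volume : Measure (Model n)).restrict (extChartAt (𝓡 n) a).target) :=
  (continuousOn_extChartAt_symm a).aemeasurable (isOpen_target a).measurableSet

theorem chartVolume_apply (g : Metric n M) (a : M) {S : Set M} (hS : MeasurableSet S) :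
    chartVolume g a S
      = ∫⁻ y in (extChartAt (𝓡 n) a).symm ⁻¹' S ∩ (extChartAt (𝓡 n) a).target,
          ENNReal.ofReal (chartDensity g a y) := by
  rw [chartVolume, Measure.map_apply_of_aemeasurable
    ((aemeasurable_symm a).mono_ac (withDensity_absolutelyContinuous _ _)) hS, withDensity_apply',
    Measure.restrict_restrict' (isOpen_target a).measurableSet]
  rfl

/-- Change of variables along the transition map: its |det J| is exactly the factor by which the
densities √det g differ. -/
theorem chartVolume_apply_eq (g : Metric n M) (a b : M) {S : Set M} (hS : MeasurableSet S)
    (ha : S ⊆ (extChartAt (𝓡 n) a).source) (hb : S ⊆ (extChartAt (𝓡 n) b).source) :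
    chartVolume g a S = chartVolume g b S := by
  have hsub : ∀ {c d : M}, S ⊆ (extChartAt (𝓡 n) d).source →
      (extChartAt (𝓡 n) c).symm ⁻¹' S ∩ (extChartAt (𝓡 n) c).target ⊆ overlap c d :=
    fun hd y hy => ⟨hy.2, hd hy.1⟩
  have himg : (extChartAt (𝓡 n) b).symm ⁻¹' S ∩ (extChartAt (𝓡 n) b).target
      = transition a b '' ((extChartAt (𝓡 n) a).symm ⁻¹' S ∩ (extChartAt (𝓡 n) a).target) := by
    ext z
    constructor
    · intro hz
      have hz' : z ∈ overlap b a := hsub ha hz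
      refine ⟨transition b a z, ⟨?_, (transition_mem_overlap hz').1⟩, transition_transition hz'⟩
      rw [mem_preimage, symm_transition hz']
      exact hz.1
    · rintro ⟨y, hy, rfl⟩
      have hy' : y ∈ overlap a b := hsub hb hy
      refine ⟨?_, (transition_mem_overlap hy').1⟩
      rw [mem_preimage, symm_transition hy']
      exact hy.1
  rw [chartVolume_apply g a hS, chartVolume_apply g b hS, himg,
    lintegral_image_eq_lintegral_abs_det_fderiv_mul volume (measurableSet_symm_preimage a hS)
      (fun y hy => (differentiableAt_transition (hsub hb hy)).hasFDerivAt.hasFDerivWithinAt)]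
  · refine setLIntegral_congr_fun (measurableSet_symm_preimage a hS) fun y hy => ?_
    rw [chartDensity_transition g (hsub hb hy), ENNReal.ofReal_mul (abs_nonneg _)]
  · intro y hy z hz h
    rw [← transition_transition (hsub hb hy), h, transition_transition (hsub hb hz)]

theorem measurableSet_source (a : M) : MeasurableSet (extChartAt (𝓡 n) a).source :=
  (isOpen_extChartAt_source a).measurableSet

theorem chartVolume_compl_source (g : Metric n M) (a : M) :
    chartVolume g a (extChartAt (𝓡 n) a).sourceᶜ = 0 := by
  rw [chartVolume_apply g a (measurableSet_source a).compl]
  convert setLIntegral_empty _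
  ext y
  simp only [mem_inter_iff, mem_preimage, mem_compl_iff, mem_empty_iff_false, iff_false, not_and]
  exact fun h hy => h ((extChartAt (𝓡 n) a).map_target hy)

/-- A supremum of measures could exceed each of them on a given set. Splitting sets along the chart
domain shows that `chartVolume g a`, plus the supremum restricted to the complement of that domain,
dominates every chart volume and hence the supremum. The second term vanishes on S. -/
theorem riemannianVolume_apply (g : Metric n M) (a : M) {S : Set M} (hS : MeasurableSet S)
    (ha : S ⊆ (extChartAt (𝓡 n) a).source) : riemannianVolume g S = chartVolume g a S := by
  refine le_antisymm ?_ (le_iSup (chartVolume g) a S)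
  have h1 : riemannianVolume g
      ≤ chartVolume g a + (riemannianVolume g).restrict (extChartAt (𝓡 n) a).sourceᶜ := by
    refine iSup_le fun x => Measure.le_iff.2 fun A hA => ?_
    rw [← measure_inter_add_sdiff A (measurableSet_source (n := n) a), Measure.add_apply]
    refine add_le_add ?_ ?_
    · rw [← measure_inter_add_sdiff (_ ∩ _) (measurableSet_source (n := n) x)]
      have h2 : chartVolume g x ((A ∩ (extChartAt (𝓡 n) a).source) \ (extChartAt (𝓡 n) x).source)
          = 0 := measure_mono_null (fun z hz => hz.2) (chartVolume_compl_source g x)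
      rw [h2, add_zero, chartVolume_apply_eq g x a
        ((hA.inter (measurableSet_source a)).inter (measurableSet_source x))
        inter_subset_right fun z hz => hz.1.2]
      exact measure_mono fun z hz => hz.1.1
    · rw [Measure.restrict_apply hA]
      exact le_iSup (chartVolume g) x _
  refine (h1 S).trans ?_
  rw [Measure.add_apply, Measure.restrict_apply hS]
  have : S ∩ (extChartAt (𝓡 n) a).sourceᶜ = ∅ := by
    ext z
    simpa using fun hz => ha hz
  rw [this, measure_empty, add_zero]

theorem restrict_riemannianVolume (g : Metric n M) (a : M) :
    (riemannianVolume g).restrict (extChartAt (𝓡 n) a).source = chartVolume g a := by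
  ext S hS
  rw [Measure.restrict_apply hS, riemannianVolume_apply g a (hS.inter (measurableSet_source a))
    inter_subset_right, ← measure_inter_add_sdiff S (measurableSet_source (n := n) a) (μ := chartVolume g a)]
  have : chartVolume g a (S \ (extChartAt (𝓡 n) a).source) = 0 :=
    measure_mono_null (fun z hz => hz.2) (chartVolume_compl_source g a)
  rw [this, add_zero]

theorem isOpenPosMeasure_riemannianVolume {g : Metric n M} (hg : SmoothGram g) :
    (riemannianVolume g).IsOpenPosMeasure := by
  refine ⟨fun U hU ⟨x, hx⟩ h0 => ?_⟩
  have h1 : chartVolume g x U = 0 := le_antisymm ((le_iSup (chartVolume g) x U).trans h0.le) bot_le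
  rw [chartVolume_apply g x hU.measurableSet] at h1
  set W := (extChartAt (𝓡 n) x).symm ⁻¹' U ∩ (extChartAt (𝓡 n) x).target with hW
  have hWo : IsOpen W := by
    rw [hW, inter_comm]
    exact (continuousOn_extChartAt_symm x).isOpen_inter_preimage (isOpen_target x) hU
  have hne : W.Nonempty := ⟨extChartAt (𝓡 n) x x, by simpa [hW] using hx⟩
  rw [setLIntegral_eq_zero_iff' hWo.measurableSet
    (((hg.contDiffOn_density x).continuousOn.mono inter_subset_right).aemeasurable
      hWo.measurableSet).ennreal_ofReal] at h1
  refine (hWo.measure_pos volume hne).ne' (measure_mono_null (fun y hy => ?_) (ae_iff.1 h1))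
  simpa [hy] using chartDensity_pos g hy.2

theorem integral_riemannianVolume {g : Metric n M} (hg : SmoothGram g) (a : M) {F : M → ℝ}
    (hF : AEStronglyMeasurable F (riemannianVolume g))
    (h0 : ∀ x ∉ (extChartAt (𝓡 n) a).source, F x = 0) :
    ∫ x, F x ∂(riemannianVolume g)
      = ∫ y in (extChartAt (𝓡 n) a).target, inChart a F y * chartDensity g a y := by
  rw [← setIntegral_eq_integral_of_forall_compl_eq_zero h0, restrict_riemannianVolume, chartVolume,
    integral_map ((aemeasurable_symm a).mono_ac (withDensity_absolutelyContinuous _ _)),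
    integral_withDensity_eq_integral_toReal_smul₀]
  · refine setIntegral_congr_fun (isOpen_target a).measurableSet fun y hy => ?_
    simp only [smul_eq_mul, inChart]
    rw [ENNReal.toReal_ofReal (Real.sqrt_nonneg _), mul_comm]
    rfl
  · exact ((hg.contDiffOn_density a).continuousOn.aemeasurable
      (isOpen_target a).measurableSet).ennreal_ofReal
  · simp
  · have := hF.mono_measure (Measure.restrict_le_self (s := (extChartAt (𝓡 n) a).source))
    rwa [restrict_riemannianVolume] at this

end Volume

/-! ### Green's formula on a closed manifold and chart independence of the Laplacian. -/

section IntegrationByParts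

variable {n : ℕ} {M : Type*} [TopologicalSpace M] [ChartedSpace (Model n) M]
  [IsManifold (𝓡 n) ∞ M]

set_option linter.unusedSectionVars false

/-- A real function on `M` is smooth. -/
abbrev Smooth (n : ℕ) {M : Type*} [TopologicalSpace M] [ChartedSpace (Model n) M]
    (u : M → ℝ) : Prop := ContMDiff (𝓡 n) 𝓘(ℝ, ℝ) ∞ u

theorem Smooth.inChart {u : M → ℝ} (hu : Smooth n u) (a : M) :
    ContDiffOn ℝ ∞ (inChart (n := n) a u) (extChartAt (𝓡 n) a).target := by
  rw [← contMDiffOn_iff_contDiffOn]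
  exact hu.comp_contMDiffOn (contMDiffOn_extChartAt_symm (I := 𝓡 n) a)

theorem contMDiffOn_of_inChart {u : M → ℝ} {a : M}
    (hu : ContDiffOn ℝ ∞ (inChart (n := n) a u) (extChartAt (𝓡 n) a).target) :
    ContMDiffOn (𝓡 n) 𝓘(ℝ, ℝ) ∞ u (extChartAt (𝓡 n) a).source := by
  have h := (contMDiffOn_iff_contDiffOn.2 hu).comp
    (contMDiffOn_extChartAt (I := 𝓡 n) (x := a) (n := ∞))
    (fun x hx => (extChartAt (𝓡 n) a).map_source (by simpa using hx))
  rw [← extChartAt_source (𝓡 n)] at h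
  refine h.congr fun x hx => ?_
  simp only [Function.comp, CRF.inChart, (extChartAt (𝓡 n) a).left_inv hx]

theorem smooth_of_inChart {u : M → ℝ}
    (hu : ∀ a, ContDiffOn ℝ ∞ (inChart (n := n) a u) (extChartAt (𝓡 n) a).target) :
    Smooth n u := fun x =>
  (contMDiffOn_of_inChart (hu x)).contMDiffAt (extChartAt_source_mem_nhds x)

theorem Smooth.differentiableAt_inChart {u : M → ℝ} (hu : Smooth n u) {a : M} {y : Model n}
    (hy : y ∈ (extChartAt (𝓡 n) a).target) : DifferentiableAt ℝ (CRF.inChart (n := n) a u) y :=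
  (hu.inChart a).differentiableAt_of_isOpen (isOpen_target a) hy

/-- `⟨∇u, ∇w⟩`. -/
def gradInner (g : Metric n M) (u w : M → ℝ) (x : M) : ℝ :=
  coordInner (gram g x) (inChart x u) (inChart x w) (extChartAt (𝓡 n) x x)

theorem gradSq_eq (g : Metric n M) (u : M → ℝ) : gradSq g u = gradInner g u u := rfl

/-- The Laplacian computed in the chart at `a`. -/
def chartLaplacian (g : Metric n M) (a : M) (u : M → ℝ) (x : M) : ℝ :=
  coordLaplacian (gram g a) (inChart a u) (extChartAt (𝓡 n) a x)

theorem inChart_gradInner (g : Metric n M) {u w : M → ℝ} (hu : Smooth n u) (hw : Smooth n w)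
    {a : M} {y : Model n} (hy : y ∈ (extChartAt (𝓡 n) a).target) :
    inChart a (gradInner g u w) y = coordInner (gram g a) (inChart a u) (inChart a w) y := by
  have hov : y ∈ overlap a ((extChartAt (𝓡 n) a).symm y) := ⟨hy, mem_extChartAt_source _⟩
  have hov' := (transition_mem_overlap hov).1
  exact (coordInner_transition g hov (hu.differentiableAt_inChart hov')
    (hw.differentiableAt_inChart hov')).symm

theorem SmoothGram.gradInner {g : Metric n M} (hg : SmoothGram g) {u w : M → ℝ} (hu : Smooth n u)
    (hw : Smooth n w) : Smooth n (gradInner g u w) :=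
  smooth_of_inChart fun a => (contDiffOn_coordInner (isOpen_target a) (hg a)
    (fun _ hy => (gram_det_pos g hy).ne') (hu.inChart a) (hw.inChart a)).congr fun _ hy =>
      inChart_gradInner g hu hw hy

theorem SmoothGram.contDiffOn_coordLaplacian {g : Metric n M} (hg : SmoothGram g) {u : M → ℝ}
    (hu : Smooth n u) (a : M) : ContDiffOn ℝ ∞ (coordLaplacian (gram g a) (CRF.inChart a u))
      (extChartAt (𝓡 n) a).target :=
  CRF.contDiffOn_coordLaplacian (isOpen_target a) (hg a)
    (fun _ hy => (gram_det_pos g hy).ne') (hu.inChart a)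

theorem SmoothGram.continuousOn_chartLaplacian {g : Metric n M} (hg : SmoothGram g) {u : M → ℝ}
    (hu : Smooth n u) (a : M) :
    ContinuousOn (chartLaplacian g a u) (extChartAt (𝓡 n) a).source :=
  (hg.contDiffOn_coordLaplacian hu a).continuousOn.comp (continuousOn_extChartAt a)
    fun _ hx => (extChartAt (𝓡 n) a).map_source hx

variable [MeasurableSpace M] [BorelSpace M] [T2Space M] [CompactSpace M]

theorem coordInner_congr_left {G : Model n → Matrix (Fin n) (Fin n) ℝ} {u u' w : Model n → ℝ}
    {y : Model n} (h : u =ᶠ[nhds y] u') : coordInner G u w y = coordInner G u' w y := by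
  simp only [coordInner, pd_congr h]

/-- Green's formula for a test function supported in one chart domain. The right-hand side no longer
refers to the chart; `laplacian_eq_chartLaplacian` rests on this. -/
theorem integral_mul_chartLaplacian {g : Metric n M} (hg : SmoothGram g) {u w : M → ℝ}
    (hu : Smooth n u) (hw : Smooth n w) {a : M} (hs : tsupport w ⊆ (extChartAt (𝓡 n) a).source) :
    ∫ x, w x * chartLaplacian g a u x ∂(riemannianVolume g)
      = -∫ x, gradInner g w u x ∂(riemannianVolume g) := by
  have h0 : ∀ x ∉ tsupport w, w x = 0 := fun x hx => image_eq_zero_of_notMem_tsupport hx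
  have hcont : Continuous fun x => w x * chartLaplacian g a u x :=
    continuous_of_eq_zero_off (isOpen_extChartAt_source a) (isClosed_tsupport w) hs
      (hw.continuous.continuousOn.mul (hg.continuousOn_chartLaplacian hu a))
      fun x hx => by simp [h0 x hx]
  set U := (extChartAt (𝓡 n) a).target with hU
  set K := extChartAt (𝓡 n) a '' tsupport w with hK
  have hKc : IsCompact K := (isClosed_tsupport w).isCompact.image_of_continuousOn
    ((continuousOn_extChartAt a).mono hs)
  have hKU : K ⊆ U := by
    rintro _ ⟨x, hx, rfl⟩
    exact (extChartAt (𝓡 n) a).map_source (hs hx)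
  -- The inverse chart has arbitrary values off its target, so the coordinate expression of w has to
  -- be cut off there.
  set w' : Model n → ℝ := U.indicator (inChart a w) with hw'
  have hw'U : EqOn w' (inChart a w) U := fun y hy => indicator_of_mem hy _
  have hw'0 : ∀ y ∉ K, w' y = 0 := fun y hy => by
    by_cases hyU : y ∈ U
    · rw [hw'U hyU, inChart, h0]
      exact fun h => hy ⟨_, h, (extChartAt (𝓡 n) a).right_inv hyU⟩
    · exact indicator_of_notMem hyU _
  have hgr0 : ∀ x ∉ (extChartAt (𝓡 n) a).source, gradInner g w u x = 0 := fun x hx => by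
    have hx' : x ∉ tsupport w := fun h => hx (hs h)
    have hev : inChart x w =ᶠ[nhds (extChartAt (𝓡 n) x x)] fun _ => 0 := by
      have h1 : (tsupport w)ᶜ ∈ nhds ((extChartAt (𝓡 n) x).symm (extChartAt (𝓡 n) x x)) := by
        rw [extChartAt_to_inv]
        exact (isClosed_tsupport w).isOpen_compl.mem_nhds hx'
      filter_upwards [(continuousAt_extChartAt_symm (I := 𝓡 n) x).preimage_mem_nhds h1]
        with y hy using h0 _ hy
    rw [gradInner, coordInner_congr_left hev]
    simp [coordInner, pd]
  rw [integral_riemannianVolume hg a hcont.aestronglyMeasurable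
      (fun x hx => by rw [h0 x fun h => hx (hs h), zero_mul]),
    integral_riemannianVolume hg a (hg.gradInner hw hu).continuous.aestronglyMeasurable hgr0]
  have e1 : ∫ y in U, inChart a (fun x => w x * chartLaplacian g a u x) y * chartDensity g a y
      = ∫ y, w' y * coordLaplacian (gram g a) (inChart a u) y * Real.sqrt (gram g a y).det := by
    rw [← setIntegral_eq_integral_of_forall_compl_eq_zero (s := U) (f := fun y =>
      w' y * coordLaplacian (gram g a) (inChart a u) y * Real.sqrt (gram g a y).det)
      (fun y hy => by rw [hw'0 y fun h => hy (hKU h)]; simp)]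
    refine setIntegral_congr_fun (isOpen_target a).measurableSet fun y hy => ?_
    simp only [hw'U hy, inChart, chartLaplacian, (extChartAt (𝓡 n) a).right_inv hy]
    rfl
  have e2 : ∫ y in U, inChart a (gradInner g w u) y * chartDensity g a y
      = ∫ y, coordInner (gram g a) w' (inChart a u) y * Real.sqrt (gram g a y).det := by
    rw [← setIntegral_eq_integral_of_forall_compl_eq_zero (s := U) (f := fun y =>
      coordInner (gram g a) w' (inChart a u) y * Real.sqrt (gram g a y).det)]
    · refine setIntegral_congr_fun (isOpen_target a).measurableSet fun y hy => ?_
      rw [inChart_gradInner g hw hu hy, coordInner_congr_left (u' := w')]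
      · rfl
      · filter_upwards [(isOpen_target a).mem_nhds hy] with z hz using (hw'U hz).symm
    · intro y hy
      have hev : w' =ᶠ[nhds y] fun _ => 0 := by
        filter_upwards [hKc.isClosed.isOpen_compl.mem_nhds fun h => hy (hKU h)] with z hz
          using hw'0 z hz
      rw [coordInner_congr_left hev]
      simp [coordInner, pd]
  rw [e1, e2]
  exact integral_mul_coordLaplacian (isOpen_target a) (hg a) (gram_symm g a)
    (fun y hy => gram_det_pos g hy) (hu.inChart a) hKc hKU ((hw.inChart a).congr hw'U) hw'0

/-- This replaces the transformation law of the Christoffel symbols. Tested against any smooth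
function supported in the overlap, the two chart Laplacians give the same invariant quantity -∫ ⟨∇w,
∇u⟩. They are therefore equal almost everywhere there, and everywhere by continuity, since the
volume charges every nonempty open set. -/
theorem laplacian_eq_chartLaplacian {g : Metric n M} (hg : SmoothGram g)
    [IsFiniteMeasure (riemannianVolume g)] {u : M → ℝ} (hu : Smooth n u) {a x : M}
    (hx : x ∈ (extChartAt (𝓡 n) a).source) : laplacian g u x = chartLaplacian g a u x := by
  have := isOpenPosMeasure_riemannianVolume hg
  set V := (extChartAt (𝓡 n) x).source ∩ (extChartAt (𝓡 n) a).source with hV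
  have hVo : IsOpen V := (isOpen_extChartAt_source x).inter (isOpen_extChartAt_source a)
  have hcx : ContinuousOn (chartLaplacian g x u) V :=
    (hg.continuousOn_chartLaplacian hu x).mono inter_subset_left
  have hca : ContinuousOn (chartLaplacian g a u) V :=
    (hg.continuousOn_chartLaplacian hu a).mono inter_subset_right
  have hae : ∀ᵐ z ∂(riemannianVolume g), z ∈ V →
      chartLaplacian g x u z - chartLaplacian g a u z = 0 := by
    refine hVo.ae_eq_zero_of_integral_contMDiff_smul_eq_zero (𝓡 n)
      (f := fun z => chartLaplacian g x u z - chartLaplacian g a u z)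
      ((hcx.sub hca).locallyIntegrableOn hVo.measurableSet) fun w hw _ hsupp => ?_
    have hi : ∀ {c : M}, ContinuousOn (chartLaplacian g c u) V →
        Integrable (fun z => w z * chartLaplacian g c u z) (riemannianVolume g) := fun hc =>
      integrable_of_eq_zero_off hVo (isClosed_tsupport w).isCompact hsupp
        (hw.continuous.continuousOn.mul hc)
        fun z hz => by simp [image_eq_zero_of_notMem_tsupport hz]
    simp only [smul_eq_mul, mul_sub]
    rw [integral_sub (hi hcx) (hi hca),
      integral_mul_chartLaplacian hg hu hw (hsupp.trans inter_subset_left),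
      integral_mul_chartLaplacian hg hu hw (hsupp.trans inter_subset_right), sub_self]
  have hae' : chartLaplacian g x u =ᵐ[(riemannianVolume g).restrict V] chartLaplacian g a u := by
    rw [Filter.EventuallyEq, ae_restrict_iff' hVo.measurableSet]
    filter_upwards [hae] with z hz hzV using sub_eq_zero.1 (hz hzV)
  exact Measure.eqOn_open_of_ae_eq hae' hVo hcx hca ⟨mem_extChartAt_source x, hx⟩

theorem inChart_laplacian {g : Metric n M} (hg : SmoothGram g)
    [IsFiniteMeasure (riemannianVolume g)] {u : M → ℝ} (hu : Smooth n u) {a : M} {y : Model n}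
    (hy : y ∈ (extChartAt (𝓡 n) a).target) :
    inChart a (laplacian g u) y = coordLaplacian (gram g a) (inChart a u) y := by
  rw [inChart, laplacian_eq_chartLaplacian hg hu ((extChartAt (𝓡 n) a).map_target hy),
    chartLaplacian, (extChartAt (𝓡 n) a).right_inv hy]

theorem SmoothGram.laplacian {g : Metric n M} (hg : SmoothGram g)
    [IsFiniteMeasure (riemannianVolume g)] {u : M → ℝ} (hu : Smooth n u) :
    Smooth n (laplacian g u) :=
  smooth_of_inChart fun a => (hg.contDiffOn_coordLaplacian hu a).congr fun _ hy =>
    inChart_laplacian hg hu hy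

theorem _root_.Continuous.integrable_of_compactSpace {X : Type*} [TopologicalSpace X]
    [CompactSpace X] [T2Space X] [MeasurableSpace X] [BorelSpace X] {μ : Measure X} [IsFiniteMeasure μ]
    {F : X → ℝ} (hF : Continuous F) : Integrable F μ := by
  rw [← integrableOn_univ]
  exact hF.continuousOn.integrableOn_compact isCompact_univ

theorem exists_finite_partition (n : ℕ) (M : Type*) [TopologicalSpace M]
    [ChartedSpace (Model n) M] [IsManifold (𝓡 n) ∞ M] [T2Space M] [CompactSpace M] :
    ∃ (S : Finset M) (ρ : S → M → ℝ), (∀ i, Smooth n (ρ i)) ∧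
      (∀ i : S, tsupport (ρ i) ⊆ (extChartAt (𝓡 n) (i : M)).source) ∧ ∀ x, ∑ i, ρ i x = 1 := by
  obtain ⟨S, hS⟩ := CompactSpace.elim_nhds_subcover
    (fun a : M => (extChartAt (𝓡 n) a).source) (fun a => extChartAt_source_mem_nhds a)
  obtain ⟨ρ, hρ⟩ := SmoothPartitionOfUnity.exists_isSubordinate (𝓡 n) (isClosed_univ (X := M))
    (fun i : S => (extChartAt (𝓡 n) (i : M)).source) (fun i => isOpen_extChartAt_source _)
    (fun x _ => by
      have : x ∈ ⋃ a ∈ S, (extChartAt (𝓡 n) a).source := hS ▸ mem_univ x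
      simpa using this)
  refine ⟨S, fun i => ρ i, fun i => (ρ i).contMDiff, hρ, fun x => ?_⟩
  rw [← ρ.sum_eq_one (mem_univ x), finsum_eq_sum_of_fintype]

theorem coordInner_sum_left {κ : Type*} {S : Finset κ} {G : Model n → Matrix (Fin n) (Fin n) ℝ}
    {u : κ → Model n → ℝ} {w : Model n → ℝ} {y : Model n}
    (h : ∀ k ∈ S, DifferentiableAt ℝ (u k) y) :
    coordInner G (fun z => ∑ k ∈ S, u k z) w y = ∑ k ∈ S, coordInner G (u k) w y := by
  simp only [coordInner, pd_sum h, Finset.mul_sum, Finset.sum_mul]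
  exact ((Finset.sum_congr rfl fun i _ => Finset.sum_comm).trans Finset.sum_comm)

/-- Green's formula on a closed manifold. -/
theorem integral_mul_laplacian {g : Metric n M} (hg : SmoothGram g)
    [IsFiniteMeasure (riemannianVolume g)] {u w : M → ℝ} (hu : Smooth n u) (hw : Smooth n w) :
    ∫ x, w x * laplacian g u x ∂(riemannianVolume g)
      = -∫ x, gradInner g w u x ∂(riemannianVolume g) := by
  obtain ⟨S, ρ, hρ, hsub, hsum⟩ := exists_finite_partition n M
  -- The partition of unity is attached to w, which is not differentiated on the left. Hence only
  -- linearity of the pairing in its first argument is needed and no derivative of ρ has to be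
  -- tracked.
  have hρw : ∀ i, Smooth n (fun x => ρ i x * w x) := fun i => (hρ i).mul hw
  have hts : ∀ i : S, tsupport (fun x => ρ i x * w x) ⊆ (extChartAt (𝓡 n) (i : M)).source :=
    fun i => (tsupport_mul_subset_left (f := ρ i) (g := w)).trans (hsub i)
  have e1 : ∀ x, w x * laplacian g u x = ∑ i, (ρ i x * w x) * laplacian g u x := fun x => by
    rw [← Finset.sum_mul, ← Finset.sum_mul, hsum, one_mul]
  have e2 : ∀ x, gradInner g w u x = ∑ i, gradInner g (fun x => ρ i x * w x) u x := fun x => by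
    have h1 : inChart x w = fun y => ∑ i, inChart (n := n) x (fun x => ρ i x * w x) y := by
      ext y
      simp only [inChart]
      rw [← Finset.sum_mul, hsum, one_mul]
    simp only [gradInner]
    rw [h1, coordInner_sum_left fun i _ =>
      (hρw i).differentiableAt_inChart (mem_extChartAt_target x)]
  simp only [e1, e2]
  rw [integral_finsetSum _ fun i _ => ((hρw i).continuous.fun_mul
      (hg.laplacian hu).continuous).integrable_of_compactSpace,
    integral_finsetSum _ fun i _ => (hg.gradInner (hρw i) hu).continuous.integrable_of_compactSpace,
    ← Finset.sum_neg_distrib]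
  refine Finset.sum_congr rfl fun i _ => ?_
  rw [← integral_mul_chartLaplacian hg hu (hρw i) (hts i)]
  congr 1
  ext x
  by_cases hx : x ∈ (extChartAt (𝓡 n) (i : M)).source
  · rw [laplacian_eq_chartLaplacian hg hu hx]
  · rw [image_eq_zero_of_notMem_tsupport (f := fun x => ρ i x * w x) fun h => hx (hts i h)]
    simp

end IntegrationByParts

/-! ### Smoothness and commuting derivatives on a closed time slab in coordinates. -/

section SlabCoordinates

variable {n : ℕ} {t₀ t₁ t : ℝ} {U : Set (Model n)} {y : Model n} {F : ℝ × Model n → ℝ}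

theorem uniqueDiffOn_slab (h01 : t₀ < t₁) (hU : IsOpen U) :
    UniqueDiffOn ℝ (Icc t₀ t₁ ×ˢ U) := (uniqueDiffOn_Icc h01).prod hU.uniqueDiffOn

theorem hasFDerivAt_slice (hU : IsOpen U) (hF : DifferentiableOn ℝ F (Icc t₀ t₁ ×ˢ U))
    (ht : t ∈ Icc t₀ t₁) (hy : y ∈ U) : HasFDerivAt (fun z => F (t, z))
      ((fderivWithin ℝ F (Icc t₀ t₁ ×ˢ U) (t, y)).comp (ContinuousLinearMap.inr ℝ ℝ (Model n)))
      y := by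
  have h1 : HasFDerivWithinAt (fun z : Model n => (t, z))
      (ContinuousLinearMap.inr ℝ ℝ (Model n)) U y :=
    (hasFDerivAt_prodMk_right t y).hasFDerivWithinAt
  exact ((hF (t, y) ⟨ht, hy⟩).hasFDerivWithinAt.comp y h1 fun z hz => ⟨ht, hz⟩).hasFDerivAt
    (hU.mem_nhds hy)

theorem pd_slice (hU : IsOpen U) (hF : DifferentiableOn ℝ F (Icc t₀ t₁ ×ˢ U))
    (ht : t ∈ Icc t₀ t₁) (hy : y ∈ U) (i : Fin n) : pd i (fun z => F (t, z)) y
      = fderivWithin ℝ F (Icc t₀ t₁ ×ˢ U) (t, y) (0, EuclideanSpace.single i 1) := by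
  rw [(hasFDerivAt_slice hU hF ht hy).pd_eq]
  simp

theorem hasDerivWithinAt_slice {E : Type*} [NormedAddCommGroup E] [NormedSpace ℝ E]
    {F : ℝ × Model n → E} (hF : DifferentiableOn ℝ F (Icc t₀ t₁ ×ˢ U))
    (ht : t ∈ Icc t₀ t₁) (hy : y ∈ U) : HasDerivWithinAt (fun s => F (s, y))
      (fderivWithin ℝ F (Icc t₀ t₁ ×ˢ U) (t, y) (1, 0)) (Icc t₀ t₁) t := by
  have h1 : HasDerivWithinAt (fun s : ℝ => (s, y)) ((1 : ℝ), (0 : Model n)) (Icc t₀ t₁) t :=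
    (hasDerivWithinAt_id t _).prodMk (hasDerivWithinAt_const t _ y)
  exact (hF (t, y) ⟨ht, hy⟩).hasFDerivWithinAt.comp_hasDerivWithinAt t h1
    (show MapsTo (fun s => (s, y)) (Icc t₀ t₁) (Icc t₀ t₁ ×ˢ U) from fun s hs => ⟨hs, hy⟩)

theorem contDiffOn_slab_pd (h01 : t₀ < t₁) (hU : IsOpen U)
    (hF : ContDiffOn ℝ ∞ F (Icc t₀ t₁ ×ˢ U)) (i : Fin n) :
    ContDiffOn ℝ ∞ (fun q : ℝ × Model n => pd i (fun z => F (q.1, z)) q.2) (Icc t₀ t₁ ×ˢ U) :=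
  ((hF.fderivWithin (m := ∞) (uniqueDiffOn_slab h01 hU) (by simp)).clm_apply
    (contDiffOn_const (c := ((0 : ℝ), (EuclideanSpace.single i 1 : Model n))))).congr fun q hq =>
      pd_slice hU (hF.differentiableOn (by simp)) hq.1 hq.2 i

theorem contDiffOn_slab_dt (h01 : t₀ < t₁) (hU : IsOpen U)
    (hF : ContDiffOn ℝ ∞ F (Icc t₀ t₁ ×ˢ U)) :
    ContDiffOn ℝ ∞ (fun q : ℝ × Model n => derivWithin (fun s => F (s, q.2)) (Icc t₀ t₁) q.1)
      (Icc t₀ t₁ ×ˢ U) :=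
  ((hF.fderivWithin (m := ∞) (uniqueDiffOn_slab h01 hU) (by simp)).clm_apply
    (contDiffOn_const (c := ((1 : ℝ), (0 : Model n))))).congr fun q hq =>
      (hasDerivWithinAt_slice (hF.differentiableOn (by simp)) hq.1 hq.2).derivWithin
        (uniqueDiffOn_Icc h01 _ hq.1)

/-- Time and space derivatives commute by symmetry of the second derivative within the slab. The end
points are included because the slab lies in the closure of its interior. -/
theorem hasDerivWithinAt_pd (h01 : t₀ < t₁) (hU : IsOpen U)
    (hF : ContDiffOn ℝ ∞ F (Icc t₀ t₁ ×ˢ U)) (ht : t ∈ Icc t₀ t₁) (hy : y ∈ U) (i : Fin n) :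
    HasDerivWithinAt (fun s => pd i (fun z => F (s, z)) y)
      (pd i (fun z => derivWithin (fun s => F (s, z)) (Icc t₀ t₁) t) y) (Icc t₀ t₁) t := by
  set S : Set (ℝ × Model n) := Icc t₀ t₁ ×ˢ U with hS
  have hud : UniqueDiffOn ℝ S := uniqueDiffOn_slab h01 hU
  have hd : DifferentiableOn ℝ F S := hF.differentiableOn (by simp)
  have hd2 : DifferentiableOn ℝ (fderivWithin ℝ F S) S :=
    (hF.fderivWithin (m := ∞) hud (by simp)).differentiableOn (by simp)
  have hmem : (t, y) ∈ S := ⟨ht, hy⟩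
  have hcl : (t, y) ∈ closure (interior S) := by
    rw [hS, interior_prod_eq, interior_Icc, hU.interior_eq, closure_prod_eq,
      closure_Ioo h01.ne]
    exact ⟨ht, subset_closure hy⟩
  have hsymm := (hF (t, y) hmem).isSymmSndFDerivWithinAt
    (by rw [minSmoothness_of_isRCLikeNormedField]; exact ENat.LEInfty.out) hud hcl hmem
  have h1 := (hasDerivWithinAt_slice hd2 ht hy).clm_apply
    (hasDerivWithinAt_const t (Icc t₀ t₁) ((0 : ℝ), (EuclideanSpace.single i 1 : Model n)))
  have h2 : pd i (fun z => derivWithin (fun s => F (s, z)) (Icc t₀ t₁) t) y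
      = fderivWithin ℝ (fderivWithin ℝ F S) S (t, y) (0, EuclideanSpace.single i 1) (1, 0) := by
    have hev : (fun z => derivWithin (fun s => F (s, z)) (Icc t₀ t₁) t)
        =ᶠ[nhds y] fun z => fderivWithin ℝ F S (t, z) (1, 0) := by
      filter_upwards [hU.mem_nhds hy] with z hz
      exact (hasDerivWithinAt_slice hd ht hz).derivWithin (uniqueDiffOn_Icc h01 _ ht)
    have hG : DifferentiableOn ℝ (fun q => fderivWithin ℝ F S q (1, 0)) S :=
      hd2.clm_apply (differentiableOn_const _)
    rw [pd_congr hev, pd_slice hU hG ht hy,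
      fderivWithin_clm_apply (hud _ hmem) (hd2 _ hmem) (differentiableWithinAt_const _)]
    simp
  rw [h2, hsymm.eq]
  simp only [map_zero, add_zero] at h1
  exact h1.congr_of_mem (fun s hs => pd_slice hU hd hs hy i) ht

end SlabCoordinates

/-! ### Time-dependent functions on the manifold and differentiation under the integral. -/

section Slab

variable {n : ℕ} {M : Type*} [TopologicalSpace M] [ChartedSpace (Model n) M]
  [IsManifold (𝓡 n) ∞ M] {t₀ t₁ t : ℝ}

set_option linter.unusedSectionVars false

/-- The coordinate expressions of `u` are smooth on `[t₀, t₁]` times the target of the chart. -/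
def SlabSmooth (n : ℕ) {M : Type*} [TopologicalSpace M] [ChartedSpace (Model n) M] (t₀ t₁ : ℝ)
    (u : ℝ → M → ℝ) : Prop :=
  ∀ a : M, ContDiffOn ℝ ∞ (fun q : ℝ × Model n => inChart a (u q.1) q.2)
    (Icc t₀ t₁ ×ˢ (extChartAt (𝓡 n) a).target)

/-- The metrics `g t` are smooth on `[t₀, t₁]` times the target of any chart. -/
def SlabSmoothGram (t₀ t₁ : ℝ) (g : ℝ → Metric n M) : Prop := ∀ (a : M) (i j : Fin n),
  ContDiffOn ℝ ∞ (fun q : ℝ × Model n => gram (g q.1) a q.2 i j)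
    (Icc t₀ t₁ ×ˢ (extChartAt (𝓡 n) a).target)

theorem SmoothOn.slabSmooth {m : ℕ} {M : Type*} [TopologicalSpace M]
    [ChartedSpace (Model (m + 1)) M] [IsManifold (𝓡 (m + 1)) ∞ M] {u : ℝ → M → ℝ}
    (hu : SmoothOn m u t₀ t₁) : SlabSmooth (m + 1) t₀ t₁ u := fun a => by
  rw [← contMDiffOn_iff_contDiffOn]
  have h1 : ContMDiffOn 𝓘(ℝ, ℝ × Model (m + 1)) (𝓘(ℝ, ℝ).prod (𝓡 (m + 1))) ∞
      (fun q : ℝ × Model (m + 1) => (q.1, (extChartAt (𝓡 (m + 1)) a).symm q.2))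
      (Icc t₀ t₁ ×ˢ (extChartAt (𝓡 (m + 1)) a).target) := by
    refine ContMDiffOn.prodMk (contDiff_fst.contMDiff.contMDiffOn) ?_
    exact (contMDiffOn_extChartAt_symm (I := 𝓡 (m + 1)) a).comp
      (contDiff_snd.contMDiff.contMDiffOn) fun q hq => hq.2
  exact ContMDiffOn.comp hu h1 fun q hq => ⟨hq.1, mem_univ _⟩

theorem contDiffOn_slab_slice {U : Set (Model n)} {F : ℝ × Model n → ℝ}
    (hF : ContDiffOn ℝ ∞ F (Icc t₀ t₁ ×ˢ U)) (ht : t ∈ Icc t₀ t₁) :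
    ContDiffOn ℝ ∞ (fun y => F (t, y)) U :=
  hF.comp (contDiff_prodMk_right t).contDiffOn fun _ hy => ⟨ht, hy⟩

theorem SlabSmooth.slice {u : ℝ → M → ℝ} (hu : SlabSmooth n t₀ t₁ u) (ht : t ∈ Icc t₀ t₁) :
    Smooth n (u t) := smooth_of_inChart fun a => contDiffOn_slab_slice (hu a) ht

theorem SlabSmoothGram.slice {g : ℝ → Metric n M} (hg : SlabSmoothGram t₀ t₁ g)
    (ht : t ∈ Icc t₀ t₁) : SmoothGram (g t) := fun a i j => contDiffOn_slab_slice (hg a i j) ht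

theorem SlabSmooth.mul {u w : ℝ → M → ℝ} (hu : SlabSmooth n t₀ t₁ u)
    (hw : SlabSmooth n t₀ t₁ w) : SlabSmooth n t₀ t₁ fun s x => u s x * w s x :=
  fun a => (hu a).mul (hw a)

theorem SlabSmooth.dt (h01 : t₀ < t₁) {u : ℝ → M → ℝ} (hu : SlabSmooth n t₀ t₁ u) :
    SlabSmooth n t₀ t₁ fun s x => derivWithin (fun r => u r x) (Icc t₀ t₁) s := fun a =>
  contDiffOn_slab_dt h01 (isOpen_target a) (hu a)

theorem SlabSmooth.gradInner (h01 : t₀ < t₁) {g : ℝ → Metric n M} (hg : SlabSmoothGram t₀ t₁ g)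
    {u w : ℝ → M → ℝ} (hu : SlabSmooth n t₀ t₁ u) (hw : SlabSmooth n t₀ t₁ w) :
    SlabSmooth n t₀ t₁ fun s => gradInner (g s) (u s) (w s) := fun a => by
  have h1 : ContDiffOn ℝ ∞ (fun q : ℝ × Model n =>
      ∑ i, ∑ j, (gram (g q.1) a q.2)⁻¹ i j * pd i (inChart a (u q.1)) q.2
        * pd j (inChart a (w q.1)) q.2) (Icc t₀ t₁ ×ˢ (extChartAt (𝓡 n) a).target) := by
    refine ContDiffOn.sum fun i _ => ContDiffOn.sum fun j _ => ContDiffOn.mul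
      (ContDiffOn.mul (fun q hq => ?_) ?_) ?_
    · exact contDiffWithinAt_matrix_inv (A := fun q : ℝ × Model n => gram (g q.1) a q.2)
        (fun i j => hg a i j q hq) (gram_det_pos (g q.1) hq.2).ne' i j
    · exact contDiffOn_slab_pd h01 (isOpen_target a) (hu a) i
    · exact contDiffOn_slab_pd h01 (isOpen_target a) (hw a) j
  exact h1.congr fun q hq => inChart_gradInner (g q.1) (hu.slice hq.1) (hw.slice hq.1) hq.2

theorem SlabSmooth.continuousOn {u : ℝ → M → ℝ} (hu : SlabSmooth n t₀ t₁ u) :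
    ContinuousOn (fun q : ℝ × M => u q.1 q.2) (Icc t₀ t₁ ×ˢ univ) := by
  intro q hq
  have h1 : ContinuousOn (fun r : ℝ × M => (r.1, extChartAt (𝓡 n) q.2 r.2))
      (Icc t₀ t₁ ×ˢ (extChartAt (𝓡 n) q.2).source) :=
    continuousOn_fst.prodMk ((continuousOn_extChartAt q.2).comp continuousOn_snd fun r hr => hr.2)
  have h2 := (hu q.2).continuousOn.comp h1
    fun r hr => ⟨hr.1, (extChartAt (𝓡 n) q.2).map_source hr.2⟩
  have h3 : ContinuousOn (fun q : ℝ × M => u q.1 q.2)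
      (Icc t₀ t₁ ×ˢ (extChartAt (𝓡 n) q.2).source) := h2.congr fun r hr => by
    simp only [Function.comp, inChart, (extChartAt (𝓡 n) q.2).left_inv hr.2]
  refine (h3 q ⟨hq.1, mem_extChartAt_source _⟩).mono_of_mem_nhdsWithin ?_
  have h4 : (univ : Set ℝ) ×ˢ (extChartAt (𝓡 n) q.2).source ∈ nhds q :=
    (isOpen_univ.prod (isOpen_extChartAt_source q.2)).mem_nhds
      ⟨mem_univ _, mem_extChartAt_source _⟩
  filter_upwards [self_mem_nhdsWithin, mem_nhdsWithin_of_mem_nhds h4] with r hr hr'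
    using ⟨hr.1, hr'.2⟩

theorem SlabSmooth.hasDerivWithinAt {u : ℝ → M → ℝ} (hu : SlabSmooth n t₀ t₁ u)
    (ht : t ∈ Icc t₀ t₁) (x : M) : HasDerivWithinAt (fun s => u s x)
      (derivWithin (fun s => u s x) (Icc t₀ t₁) t) (Icc t₀ t₁) t := by
  have h := hasDerivWithinAt_slice ((hu x).differentiableOn (by simp)) ht
    (mem_extChartAt_target x)
  simp only [inChart, extChartAt_to_inv] at h
  exact h.differentiableWithinAt.hasDerivWithinAt

variable [CompactSpace M]

theorem SlabSmooth.exists_bound {u : ℝ → M → ℝ} (hu : SlabSmooth n t₀ t₁ u) :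
    ∃ C, ∀ s ∈ Icc t₀ t₁, ∀ x, |u s x| ≤ C := by
  obtain ⟨C, hC⟩ := (isCompact_Icc.prod isCompact_univ).exists_bound_of_continuousOn
    hu.continuousOn
  exact ⟨C, fun s hs x => hC (s, x) ⟨hs, mem_univ x⟩⟩

variable [MeasurableSpace M] [BorelSpace M] [T2Space M]

/-- Differentiation under the integral sign on a closed manifold, with one-sided derivatives at
the end points. -/
theorem SlabSmooth.hasDerivWithinAt_integral (h01 : t₀ < t₁) {μ : Measure M} [IsFiniteMeasure μ]
    {u : ℝ → M → ℝ} (hu : SlabSmooth n t₀ t₁ u) (ht : t ∈ Icc t₀ t₁) :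
    HasDerivWithinAt (fun s => ∫ x, u s x ∂μ)
      (∫ x, derivWithin (fun s => u s x) (Icc t₀ t₁) t ∂μ) (Icc t₀ t₁) t := by
  obtain ⟨C, hC⟩ := (hu.dt h01).exists_bound
  have hint : ∀ s ∈ Icc t₀ t₁, Integrable (u s) μ := fun s hs =>
    (hu.slice hs).continuous.integrable_of_compactSpace
  -- The mean value inequality turns the bound on the time derivative into a bound on all difference
  -- quotients. This constant dominates, since the measure is finite.
  have hlip : ∀ s ∈ Icc t₀ t₁, ∀ x, |u s x - u t x| ≤ C * |s - t| := fun s hs x =>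
    (convex_Icc t₀ t₁).norm_image_sub_le_of_norm_hasDerivWithin_le
      (fun r hr => hu.hasDerivWithinAt hr x) (fun r hr => hC r hr x) ht hs
  rw [hasDerivWithinAt_iff_tendsto_slope]
  have hmem : ∀ᶠ s in nhdsWithin t (Icc t₀ t₁ \ {t}), s ∈ Icc t₀ t₁ \ {t} := self_mem_nhdsWithin
  have h1 : Filter.Tendsto (fun s => ∫ x, slope (fun r => u r x) t s ∂μ)
      (nhdsWithin t (Icc t₀ t₁ \ {t}))
      (nhds (∫ x, derivWithin (fun s => u s x) (Icc t₀ t₁) t ∂μ)) := by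
    refine tendsto_integral_filter_of_dominated_convergence (fun _ => C) ?_ ?_
      (integrable_const C) (Filter.Eventually.of_forall fun x =>
        hasDerivWithinAt_iff_tendsto_slope.1 (hu.hasDerivWithinAt ht x))
    · filter_upwards [hmem] with s hs
      simp only [slope_def_field]
      exact (((hint s hs.1).sub (hint t ht)).div_const _).aestronglyMeasurable
    · filter_upwards [hmem] with s hs
      refine Filter.Eventually.of_forall fun x => ?_
      have hne : 0 < |s - t| := abs_pos.2 (sub_ne_zero.2 hs.2)
      rw [slope_def_field, Real.norm_eq_abs, abs_div, div_le_iff₀ hne]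
      exact hlip s hs.1 x
  refine h1.congr' ?_
  filter_upwards [hmem] with s hs
  simp only [slope_def_field]
  rw [integral_div, integral_sub (hint s hs.1) (hint t ht)]

end Slab

/-! ### First derivatives of gradient pairings, and the Hessian. -/

section Gradient

variable {n : ℕ} {G : Model n → Matrix (Fin n) (Fin n) ℝ} {U : Set (Model n)} {y : Model n}
  {u w : Model n → ℝ}

/-- The components of the gradient. -/
def coordGrad (G : Model n → Matrix (Fin n) (Fin n) ℝ) (u : Model n → ℝ) (y : Model n)
    (k : Fin n) : ℝ := ∑ i, (G y)⁻¹ k i * pd i u y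

theorem inv_symm_apply {A : Matrix (Fin n) (Fin n) ℝ} (h : ∀ i j, A i j = A j i) (i j : Fin n) :
    A⁻¹ i j = A⁻¹ j i := by
  have : A.transpose = A := Matrix.ext fun i j => h j i
  conv_lhs => rw [← this, ← Matrix.transpose_nonsing_inv, Matrix.transpose_apply]

theorem coordInner_eq_grad (hs : ∀ i j, G y i j = G y j i) (u w : Model n → ℝ) :
    coordInner G u w y = ∑ k, coordGrad G u y k * pd k w y := by
  simp only [coordInner, coordGrad, Finset.sum_mul]
  rw [Finset.sum_comm]
  exact Finset.sum_congr rfl fun i _ => Finset.sum_congr rfl fun j _ => by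
    rw [inv_symm_apply hs]

theorem coordInner_comm (hs : ∀ i j, G y i j = G y j i) (u w : Model n → ℝ) :
    coordInner G u w y = coordInner G w u y := by
  simp only [coordInner]
  rw [Finset.sum_comm]
  exact Finset.sum_congr rfl fun i _ => Finset.sum_congr rfl fun j _ => by
    rw [inv_symm_apply hs]; ring

theorem quadratic_coordGrad (hdet : (G y).det ≠ 0) :
    ∑ i, ∑ j, G y i j * coordGrad G u y i * coordGrad G u y j = coordInner G u u y := by
  have h1 : ∀ i, ∑ j, G y i j * coordGrad G u y j = pd i u y := fun i => by
    have h2 : (G y).mulVec ((G y)⁻¹.mulVec fun k => pd k u y) i = pd i u y := by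
      rw [Matrix.mulVec_mulVec, Matrix.mul_nonsing_inv _ (isUnit_iff_ne_zero.2 hdet),
        Matrix.one_mulVec]
    exact h2
  calc _ = ∑ i, coordGrad G u y i * ∑ j, G y i j * coordGrad G u y j := by
        simp only [Finset.mul_sum]
        exact Finset.sum_congr rfl fun i _ => Finset.sum_congr rfl fun j _ => by ring
    _ = _ := by
        simp only [h1]
        simp only [coordInner, coordGrad, Finset.sum_mul]
        exact Finset.sum_congr rfl fun i _ => Finset.sum_congr rfl fun j _ => by ring

/-- Contracting the derivative of g⁻¹ with two covectors is minus contracting the derivative c of g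
with the corresponding raised vectors. It serves both for space derivatives (`pd_coordInner`) and
for the time derivative of |∇v|². -/
theorem sum_quadratic_inv {A : Matrix (Fin n) (Fin n) ℝ} (hs : ∀ i j, A i j = A j i)
    (c : Fin n → Fin n → ℝ) (ξ η : Fin n → ℝ) :
    ∑ i, ∑ j, (-∑ k, ∑ l, A⁻¹ i k * A⁻¹ l j * c k l) * ξ i * η j
      = -∑ k, ∑ l, c k l * (∑ i, A⁻¹ k i * ξ i) * ∑ j, A⁻¹ l j * η j := by
  simp only [neg_mul, Finset.sum_neg_distrib, Finset.sum_mul, Finset.mul_sum]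
  congr 1
  calc _ = ∑ i, ∑ k, ∑ j, ∑ l, A⁻¹ i k * A⁻¹ l j * c k l * ξ i * η j :=
        Finset.sum_congr rfl fun i _ => Finset.sum_comm
    _ = ∑ k, ∑ i, ∑ l, ∑ j, A⁻¹ i k * A⁻¹ l j * c k l * ξ i * η j := by
        rw [Finset.sum_comm]
        exact Finset.sum_congr rfl fun i _ => Finset.sum_congr rfl fun j _ => Finset.sum_comm
    _ = ∑ k, ∑ l, ∑ i, ∑ j, A⁻¹ i k * A⁻¹ l j * c k l * ξ i * η j :=
        Finset.sum_congr rfl fun i _ => Finset.sum_comm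
    _ = ∑ k, ∑ l, ∑ j, ∑ i, c k l * (A⁻¹ k i * ξ i) * (A⁻¹ l j * η j) := by
        refine Finset.sum_congr rfl fun k _ => Finset.sum_congr rfl fun l _ => ?_
        rw [Finset.sum_comm]
        exact Finset.sum_congr rfl fun j _ => Finset.sum_congr rfl fun i _ => by
          rw [inv_symm_apply hs i k]; ring

theorem pd_coordInner (hU : IsOpen U) (hG : ∀ i j, ContDiffOn ℝ ∞ (fun y => G y i j) U)
    (hdet : ∀ y ∈ U, (G y).det ≠ 0) (hs : ∀ i j, G y i j = G y j i) (hu : ContDiffOn ℝ ∞ u U)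
    (hw : ContDiffOn ℝ ∞ w U) (hy : y ∈ U) (k : Fin n) :
    pd k (coordInner G u w) y
      = -(∑ r, ∑ s, pd k (fun z => G z r s) y * coordGrad G u y r * coordGrad G w y s)
        + ∑ i, coordGrad G w y i * pd k (pd i u) y + ∑ i, coordGrad G u y i * pd k (pd i w) y := by
  have hid : ∀ i j, DifferentiableAt ℝ (fun z => (G z)⁻¹ i j) y := fun i j =>
    (contDiffOn_inv_apply hG hdet i j).differentiableAt_of_isOpen hU hy
  have hud : ∀ j, DifferentiableAt ℝ (pd j u) y := fun j =>
    (contDiffOn_pd hU hu j).differentiableAt_of_isOpen hU hy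
  have hwd : ∀ j, DifferentiableAt ℝ (pd j w) y := fun j =>
    (contDiffOn_pd hU hw j).differentiableAt_of_isOpen hU hy
  have hd1 : ∀ i j, DifferentiableAt ℝ (fun z => (G z)⁻¹ i j * pd i u z * pd j w z) y :=
    fun i j => ((hid i j).fun_mul (hud i)).fun_mul (hwd j)
  have h1 : pd k (coordInner G u w) y
      = ∑ i, ∑ j, pd k (fun z => (G z)⁻¹ i j * pd i u z * pd j w z) y := by
    change pd k (fun z => ∑ i, ∑ j, (G z)⁻¹ i j * pd i u z * pd j w z) y = _
    rw [pd_sum fun i _ => DifferentiableAt.fun_sum fun j _ => hd1 i j]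
    exact Finset.sum_congr rfl fun i _ => pd_sum (fun j _ => hd1 i j) k
  have h2 : ∀ i j, pd k (fun z => (G z)⁻¹ i j * pd i u z * pd j w z) y
      = (-∑ r, ∑ s, (G y)⁻¹ i r * (G y)⁻¹ s j * pd k (fun z => G z r s) y)
          * pd i u y * pd j w y
        + (G y)⁻¹ i j * pd j w y * pd k (pd i u) y
        + (G y)⁻¹ i j * pd i u y * pd k (pd j w) y := fun i j => by
    rw [pd_mul ((hid i j).fun_mul (hud i)) (hwd j), pd_mul (hid i j) (hud i),
      pd_inv_apply (fun i j => (hG i j).differentiableAt_of_isOpen hU hy) (hdet y hy)]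
    ring
  rw [h1]
  simp only [h2, Finset.sum_add_distrib]
  rw [sum_quadratic_inv hs]
  refine congrArg₂ _ (congrArg₂ _ rfl ?_) ?_
  · simp only [coordGrad, Finset.sum_mul]
  · simp only [coordGrad, Finset.sum_mul]
    rw [Finset.sum_comm]
    exact Finset.sum_congr rfl fun i _ => Finset.sum_congr rfl fun j _ => by
      rw [inv_symm_apply hs]

theorem pd_comm (hU : IsOpen U) (hu : ContDiffOn ℝ ∞ u U) (hy : y ∈ U) (i j : Fin n) :
    pd i (pd j u) y = pd j (pd i u) y := by
  have hc : ContDiffAt ℝ ∞ u y := hu.contDiffAt (hU.mem_nhds hy)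
  have hs : IsSymmSndFDerivAt ℝ u y := hc.isSymmSndFDerivAt
    (by rw [minSmoothness_of_isRCLikeNormedField]; exact ENat.LEInfty.out)
  have hd : DifferentiableAt ℝ (fderiv ℝ u) y :=
    (hc.fderiv_right (m := ∞) (by simp)).differentiableAt (by simp)
  have e : ∀ i j, pd i (pd j u) y = fderiv ℝ (fderiv ℝ u) y (EuclideanSpace.single i 1)
      (EuclideanSpace.single j 1) := fun i j => by
    rw [pd]
    change fderiv ℝ (fun z => fderiv ℝ u z (EuclideanSpace.single j 1)) y _ = _
    rw [fderiv_clm_apply hd (differentiableAt_const _)]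
    simp
  rw [e, e, hs.eq]

/-- The index computation behind `coordInner_coordInner_self`: c k r s = ∂ₖ gᵣₛ, d and e are the
second partial derivatives of f and u, and F and V are their gradients. The terms in e agree by
symmetry, those in d cancel against the Hessian of f, and two of the three Christoffel terms cancel
the derivative of the metric in ∇⟨∇f, ∇u⟩, leaving the one on the left. -/
theorem hessian_contraction (c : Fin n → Fin n → Fin n → ℝ) (hc : ∀ i j k, c i j k = c i k j)
    (d e : Fin n → Fin n → ℝ) (he : ∀ i j, e i j = e j i) (F V : Fin n → ℝ) :
    ∑ k, F k * (-(∑ r, ∑ s, c k r s * V r * V s) + ∑ i, V i * e k i + ∑ i, V i * e k i)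
      = 2 * ∑ k, V k * (-(∑ r, ∑ s, c k r s * F r * V s) + ∑ i, V i * d k i + ∑ i, F i * e k i)
        - 2 * ∑ i, ∑ j, (d i j - (1 / 2) * ∑ l, F l * (c i j l + c j i l - c l i j))
          * V i * V j := by
  have e1 : ∑ k, F k * ∑ i, V i * e k i = ∑ k, V k * ∑ i, F i * e k i := by
    simp only [Finset.mul_sum]
    rw [Finset.sum_comm]
    exact Finset.sum_congr rfl fun i _ => Finset.sum_congr rfl fun j _ => by rw [he j i]; ring
  have e2 : ∑ i, ∑ j, d i j * V i * V j = ∑ k, V k * ∑ i, V i * d k i := by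
    simp only [Finset.mul_sum]
    exact Finset.sum_congr rfl fun i _ => Finset.sum_congr rfl fun j _ => by ring
  have e3 : ∑ i, ∑ j, ((1 / 2) * ∑ l, F l * (c i j l + c j i l - c l i j)) * V i * V j
      = (1 / 2) * (∑ i, ∑ j, ∑ l, F l * c i j l * V i * V j
        + ∑ i, ∑ j, ∑ l, F l * c j i l * V i * V j
        - ∑ i, ∑ j, ∑ l, F l * c l i j * V i * V j) := by
    simp only [← Finset.sum_add_distrib, ← Finset.sum_sub_distrib, Finset.mul_sum, Finset.sum_mul]
    refine Finset.sum_congr rfl fun i _ => Finset.sum_congr rfl fun j _ =>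
      Finset.sum_congr rfl fun l _ => ?_
    ring
  have e4 : ∑ i, ∑ j, ∑ l, F l * c j i l * V i * V j
      = ∑ i, ∑ j, ∑ l, F l * c i j l * V i * V j := by
    rw [Finset.sum_comm]
    exact Finset.sum_congr rfl fun i _ => Finset.sum_congr rfl fun j _ =>
      Finset.sum_congr rfl fun l _ => by ring
  have e5 : ∑ i, ∑ j, ∑ l, F l * c i j l * V i * V j
      = ∑ k, V k * ∑ r, ∑ s, c k r s * F r * V s := by
    simp only [Finset.mul_sum]
    refine Finset.sum_congr rfl fun i _ => ?_
    rw [Finset.sum_comm]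
    exact Finset.sum_congr rfl fun j _ => Finset.sum_congr rfl fun l _ => by rw [hc i l j]; ring
  have e6 : ∑ i, ∑ j, ∑ l, F l * c l i j * V i * V j
      = ∑ k, F k * ∑ r, ∑ s, c k r s * V r * V s := by
    simp only [Finset.mul_sum]
    calc _ = ∑ i, ∑ l, ∑ j, F l * c l i j * V i * V j :=
          Finset.sum_congr rfl fun i _ => Finset.sum_comm
      _ = _ := by
          rw [Finset.sum_comm]
          exact Finset.sum_congr rfl fun i _ => Finset.sum_congr rfl fun j _ =>
            Finset.sum_congr rfl fun l _ => by ring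
  simp only [mul_add, mul_neg, Finset.sum_add_distrib, Finset.sum_neg_distrib, sub_mul,
    Finset.sum_sub_distrib]
  rw [e1, e2, e3, e4, e5, e6]
  ring

/-- `⟨∇f, ∇|∇u|²⟩ = 2 ⟨∇u, ∇⟨∇f, ∇u⟩⟩ - 2 Hess f (∇u, ∇u)`. -/
theorem coordInner_coordInner_self (hU : IsOpen U)
    (hG : ∀ i j, ContDiffOn ℝ ∞ (fun y => G y i j) U)
    (hdet : ∀ y ∈ U, (G y).det ≠ 0) (hs : ∀ y i j, G y i j = G y j i) {f : Model n → ℝ}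
    (hf : ContDiffOn ℝ ∞ f U) (hu : ContDiffOn ℝ ∞ u U) (hy : y ∈ U) :
    coordInner G f (coordInner G u u) y
      = 2 * coordInner G u (coordInner G f u) y
        - 2 * ∑ i, ∑ j, hessCoord G f y i j * coordGrad G u y i * coordGrad G u y j := by
  rw [coordInner_eq_grad (hs y), coordInner_eq_grad (hs y)]
  simp only [pd_coordInner hU hG hdet (hs y) hu hu hy, pd_coordInner hU hG hdet (hs y) hf hu hy]
  rw [hessian_contraction (fun k r s => pd k (fun z => G z r s) y)
    (fun i j k => by simp only [hs _ j k]) (fun i j => pd i (pd j f) y) _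
    (pd_comm hU hu hy)]
  congr 2
  refine Finset.sum_congr rfl fun i _ => Finset.sum_congr rfl fun j _ => ?_
  congr 2
  simp only [hessCoord, christoffel, coordGrad, Finset.mul_sum, Finset.sum_mul]
  congr 1
  rw [Finset.sum_comm]
  exact Finset.sum_congr rfl fun k _ => Finset.sum_congr rfl fun l _ => by
    rw [inv_symm_apply (hs y)]; ring

end Gradient

/-! ### Time derivatives of the inverse and of the volume density. -/

section MatrixEvolution

variable {ι : Type*} [Fintype ι] [DecidableEq ι] {A : ℝ → Matrix ι ι ℝ} {A' : ι → ι → ℝ}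
  {S : Set ℝ} {t : ℝ}

theorem hasDerivWithinAt_matrix_inv
    (h : ∀ i j, HasDerivWithinAt (fun s => A s i j) (A' i j) S t) (hdet : (A t).det ≠ 0)
    (hS : UniqueDiffWithinAt ℝ S t) (i j : ι) : HasDerivWithinAt (fun s => (A s)⁻¹ i j)
      (-∑ k, ∑ l, (A t)⁻¹ i k * (A t)⁻¹ l j * A' k l) S t := by
  convert (hasFDerivWithinAt_matrix_inv (fun i j => (h i j).hasFDerivWithinAt) hdet hS
    i j).hasDerivWithinAt using 1
  simp [_root_.sum_apply]

theorem hasDerivWithinAt_sqrt_det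
    (h : ∀ i j, HasDerivWithinAt (fun s => A s i j) (A' i j) S t) (hdet : 0 < (A t).det) :
    HasDerivWithinAt (fun s => Real.sqrt (A s).det)
      ((1 / 2) * (∑ i, ∑ j, (A t)⁻¹ i j * A' j i) * Real.sqrt (A t).det) S t := by
  have h1 : HasDerivWithinAt (fun s => (A s).det) (∑ i, ∑ j, (A t).adjugate i j * A' j i) S t := by
    convert (hasFDerivWithinAt_matrix_det (fun i j =>
      (h i j).hasFDerivWithinAt)).hasDerivWithinAt using 1
    simp [_root_.sum_apply]
  convert h1.sqrt hdet.ne' using 1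
  have hs : 0 < Real.sqrt (A t).det := Real.sqrt_pos.2 hdet
  have hs2 : Real.sqrt (A t).det ^ 2 = (A t).det := Real.sq_sqrt hdet.le
  have hadj : ∀ r s, (A t).adjugate r s = (A t).det * (A t)⁻¹ r s := fun r s => by
    rw [Matrix.inv_def, Matrix.smul_apply, Ring.inverse_eq_inv', smul_eq_mul,
      mul_inv_cancel_left₀ hdet.ne']
  simp only [hadj, mul_assoc, ← Finset.mul_sum]
  generalize (∑ r, ∑ s, (A t)⁻¹ r s * A' s r) = c
  field_simp
  rw [hs2]

end MatrixEvolution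

/-! ### Evolution of the volume and of |∇v|² under a varying metric. -/

section Evolution

variable {n : ℕ} {M : Type*} [TopologicalSpace M] [ChartedSpace (Model n) M]
  [IsManifold (𝓡 n) ∞ M] {t₀ t₁ t : ℝ}

set_option linter.unusedSectionVars false

/-- The density of the volume measure of `g` with respect to that of `g'`. -/
def densityRatio (g g' : Metric n M) (x : M) : ℝ :=
  chartDensity g x (extChartAt (𝓡 n) x x) / chartDensity g' x (extChartAt (𝓡 n) x x)

/-- Both densities acquire the same Jacobian factor under a change of chart, so their quotient is a
function on M that any chart computes. -/
theorem inChart_densityRatio (g g' : Metric n M) {a : M} {y : Model n}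
    (hy : y ∈ (extChartAt (𝓡 n) a).target) :
    inChart a (densityRatio g g') y = chartDensity g a y / chartDensity g' a y := by
  have hov : y ∈ overlap a ((extChartAt (𝓡 n) a).symm y) := ⟨hy, mem_extChartAt_source _⟩
  have h' := chartDensity_transition g' hov
  have hne : |(fderiv ℝ (transition (n := n) a ((extChartAt (𝓡 n) a).symm y)) y).det| ≠ 0 :=
    fun h => (chartDensity_pos g' hy).ne' (by rw [h', h, zero_mul])
  rw [chartDensity_transition g hov, h', mul_div_mul_left _ _ hne]
  rfl

theorem densityRatio_self (g : Metric n M) (x : M) : densityRatio g g x = 1 :=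
  div_self (chartDensity_pos g (mem_extChartAt_target x)).ne'

theorem SlabSmoothGram.densityRatio {g : ℝ → Metric n M} (hg : SlabSmoothGram t₀ t₁ g)
    (ht : t ∈ Icc t₀ t₁) : SlabSmooth n t₀ t₁ fun s => densityRatio (g s) (g t) := fun a => by
  have h1 : ContDiffOn ℝ ∞ (fun q : ℝ × Model n => chartDensity (g q.1) a q.2)
      (Icc t₀ t₁ ×ˢ (extChartAt (𝓡 n) a).target) := fun q hq =>
    (contDiffWithinAt_matrix_det (A := fun q : ℝ × Model n => gram (g q.1) a q.2)
      fun i j => hg a i j q hq).sqrt (gram_det_pos _ hq.2).ne'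
  have h2 : ContDiffOn ℝ ∞ (fun q : ℝ × Model n => chartDensity (g t) a q.2)
      (Icc t₀ t₁ ×ˢ (extChartAt (𝓡 n) a).target) :=
    ((hg.slice ht).contDiffOn_density a).comp contDiff_snd.contDiffOn fun q hq => hq.2
  exact (h1.div h2 fun q hq => (chartDensity_pos _ hq.2).ne').congr fun q hq =>
    inChart_densityRatio _ _ hq.2

theorem hasDerivWithinAt_densityRatio {g : ℝ → Metric n M} {x : M} {A' : Fin n → Fin n → ℝ}
    (h : ∀ i j, HasDerivWithinAt (fun s => metricAt (g s) x i j) (A' i j) (Icc t₀ t₁) t) :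
    HasDerivWithinAt (fun s => densityRatio (g s) (g t) x)
      ((1 / 2) * ∑ i, ∑ j, (metricAt (g t) x)⁻¹ i j * A' j i) (Icc t₀ t₁) t := by
  have hp := gram_det_pos (g t) (mem_extChartAt_target (I := 𝓡 n) x)
  have h1 := (hasDerivWithinAt_sqrt_det h hp).div_const
    (chartDensity (g t) x (extChartAt (𝓡 n) x x))
  exact h1.congr_deriv (mul_div_cancel_right₀ _ (Real.sqrt_pos.2 hp).ne')

/-- The components of the gradient of `u` at `x`. -/
def gradAt (g : Metric n M) (u : M → ℝ) (x : M) : Fin n → ℝ :=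
  coordGrad (gram g x) (inChart x u) (extChartAt (𝓡 n) x x)

theorem gradInner_comm (g : Metric n M) (u w : M → ℝ) (x : M) :
    gradInner g u w x = gradInner g w u x := coordInner_comm (gram_symm g x _) _ _

theorem quadratic_gradAt (g : Metric n M) (u : M → ℝ) (x : M) :
    ∑ i, ∑ j, metricAt g x i j * gradAt g u x i * gradAt g u x j = gradInner g u u x :=
  quadratic_coordGrad (gram_det_pos g (mem_extChartAt_target x)).ne'

theorem hasDerivWithinAt_gradInner_self (h01 : t₀ < t₁) {g : ℝ → Metric n M} {x : M}
    {A' : Fin n → Fin n → ℝ} (ht : t ∈ Icc t₀ t₁)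
    (h : ∀ i j, HasDerivWithinAt (fun s => metricAt (g s) x i j) (A' i j) (Icc t₀ t₁) t)
    {v : ℝ → M → ℝ} (hv : SlabSmooth n t₀ t₁ v) :
    HasDerivWithinAt (fun s => gradInner (g s) (v s) (v s) x)
      (-(∑ k, ∑ l, A' k l * gradAt (g t) (v t) x k * gradAt (g t) (v t) x l)
        + 2 * gradInner (g t) (v t) (fun z => derivWithin (fun s => v s z) (Icc t₀ t₁) t) x)
      (Icc t₀ t₁) t := by
  set y := extChartAt (𝓡 n) x x with hy
  have hpd : ∀ i, HasDerivWithinAt (fun s => pd i (inChart x (v s)) y)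
      (pd i (inChart x fun z => derivWithin (fun s => v s z) (Icc t₀ t₁) t) y) (Icc t₀ t₁) t :=
    fun i => hasDerivWithinAt_pd h01 (isOpen_target x) (hv x) ht (mem_extChartAt_target x) i
  have hinv := hasDerivWithinAt_matrix_inv h
    (gram_det_pos (g t) (mem_extChartAt_target (I := 𝓡 n) x)).ne' (uniqueDiffOn_Icc h01 t ht)
  have h1 : HasDerivWithinAt (fun s => gradInner (g s) (v s) (v s) x)
      (∑ i, ∑ j, (((-∑ k, ∑ l, (metricAt (g t) x)⁻¹ i k * (metricAt (g t) x)⁻¹ l j * A' k l)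
          * pd i (inChart x (v t)) y + (metricAt (g t) x)⁻¹ i j
            * pd i (inChart x fun z => derivWithin (fun s => v s z) (Icc t₀ t₁) t) y)
          * pd j (inChart x (v t)) y
        + (metricAt (g t) x)⁻¹ i j * pd i (inChart x (v t)) y
          * pd j (inChart x fun z => derivWithin (fun s => v s z) (Icc t₀ t₁) t) y))
      (Icc t₀ t₁) t := by
    change HasDerivWithinAt (fun s => ∑ i, ∑ j, (metricAt (g s) x)⁻¹ i j
      * pd i (inChart x (v s)) y * pd j (inChart x (v s)) y) _ _ _
    exact HasDerivWithinAt.fun_sum fun i _ => HasDerivWithinAt.fun_sum fun j _ =>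
      ((hinv i j).fun_mul (hpd i)).fun_mul (hpd j)
  convert h1 using 1
  simp only [add_mul, Finset.sum_add_distrib]
  rw [sum_quadratic_inv (A := metricAt (g t) x) (gram_symm (g t) x y)]
  have h2 := gradInner_comm (g t) (v t) (fun z => derivWithin (fun s => v s z) (Icc t₀ t₁) t) x
  rw [two_mul, ← add_assoc]
  congr 2

/-- `⟨∇f, ∇|∇u|²⟩ = 2 ⟨∇u, ∇⟨∇f, ∇u⟩⟩ - 2 Hess f (∇u, ∇u)`. -/
theorem gradInner_gradInner_self {g : Metric n M} (hg : SmoothGram g) {f u : M → ℝ}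
    (hf : Smooth n f) (hu : Smooth n u) (x : M) :
    gradInner g f (gradInner g u u) x = 2 * gradInner g u (gradInner g f u) x
      - 2 * ∑ i, ∑ j, hess g f x i j * gradAt g u x i * gradAt g u x j := by
  have hx := mem_extChartAt_target (I := 𝓡 n) x
  have key := coordInner_coordInner_self (isOpen_target x) (hg x)
    (fun y hy => (gram_det_pos g hy).ne') (gram_symm g x) (hf.inChart x) (hu.inChart x) hx
  have hcongr : ∀ {a b b' : Model n → ℝ}, b =ᶠ[nhds (extChartAt (𝓡 n) x x)] b' →
      coordInner (gram g x) a b (extChartAt (𝓡 n) x x)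
        = coordInner (gram g x) a b' (extChartAt (𝓡 n) x x) := fun h => by
    simp only [coordInner, pd_congr h]
  have h1 : ∀ {a : M → ℝ}, Smooth n a → inChart x (gradInner g a u)
      =ᶠ[nhds (extChartAt (𝓡 n) x x)] coordInner (gram g x) (inChart x a) (inChart x u) :=
    fun ha => by
      filter_upwards [(isOpen_target x).mem_nhds hx] with y hy using inChart_gradInner g ha hu hy
  rw [← hcongr (h1 hu), ← hcongr (h1 hf)] at key
  exact key

theorem gradInner_mul_right (g : Metric n M) (u : M → ℝ) {φ ψ : M → ℝ} (hφ : Smooth n φ)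
    (hψ : Smooth n ψ) (x : M) : gradInner g u (fun z => φ z * ψ z) x
      = φ x * gradInner g u ψ x + ψ x * gradInner g u φ x := by
  have hx := mem_extChartAt_target (I := 𝓡 n) x
  have h1 : ∀ j, pd j (inChart x fun z => φ z * ψ z) (extChartAt (𝓡 n) x x)
      = φ x * pd j (inChart x ψ) (extChartAt (𝓡 n) x x)
        + ψ x * pd j (inChart x φ) (extChartAt (𝓡 n) x x) := fun j => by
    have := pd_mul (hφ.differentiableAt_inChart hx) (hψ.differentiableAt_inChart hx) j
    simp only [inChart, extChartAt_to_inv] at this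
    exact this
  simp only [gradInner, coordInner, h1, mul_add, Finset.sum_add_distrib, Finset.mul_sum]
  congr 1 <;>
  exact Finset.sum_congr rfl fun i _ => Finset.sum_congr rfl fun j _ => by ring

theorem gradInner_sub_right (g : Metric n M) (u : M → ℝ) {φ ψ : M → ℝ} (hφ : Smooth n φ)
    (hψ : Smooth n ψ) (x : M) : gradInner g u (fun z => φ z - ψ z) x
      = gradInner g u φ x - gradInner g u ψ x := by
  have hx := mem_extChartAt_target (I := 𝓡 n) x
  have h1 : ∀ j, pd j (inChart x fun z => φ z - ψ z) (extChartAt (𝓡 n) x x)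
      = pd j (inChart x φ) (extChartAt (𝓡 n) x x)
        - pd j (inChart x ψ) (extChartAt (𝓡 n) x x) := fun j => by
    rw [HasFDerivAt.pd_eq (F := inChart x fun z => φ z - ψ z)
      ((hφ.differentiableAt_inChart hx).hasFDerivAt.sub
        (hψ.differentiableAt_inChart hx).hasFDerivAt)]
    rfl
  simp only [gradInner, coordInner, h1, mul_sub, Finset.sum_sub_distrib]

theorem gradInner_exp_neg (g : Metric n M) (u : M → ℝ) {f : M → ℝ} (hf : Smooth n f) (c : ℝ)
    (x : M) : gradInner g u (fun z => c * Real.exp (-f z)) x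
      = -(c * Real.exp (-f x)) * gradInner g u f x := by
  have hx := mem_extChartAt_target (I := 𝓡 n) x
  have h1 : ∀ j, pd j (inChart x fun z => c * Real.exp (-f z)) (extChartAt (𝓡 n) x x)
      = -(c * Real.exp (-f x)) * pd j (inChart x f) (extChartAt (𝓡 n) x x) := fun j => by
    rw [HasFDerivAt.pd_eq (F := inChart x fun z => c * Real.exp (-f z))
      (((hf.differentiableAt_inChart hx).hasFDerivAt.neg.exp).const_mul c)]
    simp [inChart, pd]
    ring
  simp only [gradInner, coordInner, h1, Finset.mul_sum]
  exact Finset.sum_congr rfl fun i _ => Finset.sum_congr rfl fun j _ => by ring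

variable [MeasurableSpace M] [BorelSpace M] [T2Space M] [CompactSpace M]

/-- This refers the volumes at all times to the measure at one fixed time, so that integrals against
a moving measure can be differentiated under the integral sign. -/
theorem integral_eq_integral_mul_densityRatio {g g' : Metric n M} (hg : SmoothGram g)
    (hg' : SmoothGram g') [IsFiniteMeasure (riemannianVolume g)]
    [IsFiniteMeasure (riemannianVolume g')] (hr : Continuous (densityRatio g g')) {F : M → ℝ}
    (hF : Continuous F) : ∫ x, F x ∂(riemannianVolume g)
      = ∫ x, F x * densityRatio g g' x ∂(riemannianVolume g') := by
  obtain ⟨S, ρ, hρ, hsub, hsum⟩ := exists_finite_partition n M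
  have e : ∀ x, F x = ∑ i, ρ i x * F x := fun x => by rw [← Finset.sum_mul, hsum, one_mul]
  have e' : ∀ x, F x * densityRatio g g' x = ∑ i, ρ i x * (F x * densityRatio g g' x) :=
    fun x => by rw [← Finset.sum_mul, hsum, one_mul]
  have c1 : ∀ i, Continuous fun x => ρ i x * F x := fun i => (hρ i).continuous.mul hF
  have c2 : ∀ i, Continuous fun x => ρ i x * (F x * densityRatio g g' x) := fun i =>
    (hρ i).continuous.mul (hF.mul hr)
  have h0 : ∀ i : S, ∀ x ∉ (extChartAt (𝓡 n) (i : M)).source, ρ i x = 0 := fun i x hx =>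
    image_eq_zero_of_notMem_tsupport fun h => hx (hsub i h)
  rw [integral_congr_ae (Filter.Eventually.of_forall e),
    integral_congr_ae (Filter.Eventually.of_forall e'),
    integral_finsetSum _ fun i _ => (c1 i).integrable_of_compactSpace,
    integral_finsetSum _ fun i _ => (c2 i).integrable_of_compactSpace]
  refine Finset.sum_congr rfl fun i _ => ?_
  rw [integral_riemannianVolume hg i (c1 i).aestronglyMeasurable
      fun x hx => by rw [h0 i x hx, zero_mul],
    integral_riemannianVolume hg' i (c2 i).aestronglyMeasurable
      fun x hx => by rw [h0 i x hx, zero_mul]]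
  refine setIntegral_congr_fun (isOpen_target (i : M)).measurableSet fun y hy => ?_
  have h1 := inChart_densityRatio g g' hy
  have h2 := (chartDensity_pos g' hy).ne'
  simp only [inChart] at h1 ⊢
  rw [h1]
  field_simp

end Evolution

/-! ### Positivity of traces and norms taken with the metric. -/

section TraceInequalities

variable {n : ℕ} {M : Type*} [TopologicalSpace M] [ChartedSpace (Model n) M]
  [IsManifold (𝓡 n) ∞ M]

open scoped MatrixOrder Matrix.Norms.L2Operator in
-- The rows of S form a g-orthonormal frame. In this frame a trace is a sum of values of the
-- quadratic form, and a squared norm is a sum of squares of components.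
theorem exists_inv_factor (g : Metric n M) (x : M) : ∃ S : Matrix (Fin n) (Fin n) ℝ,
    ∀ i j, (metricAt g x)⁻¹ i j = ∑ k, S k i * S k j := by
  have h := (gram_posDef g (mem_extChartAt_target (I := 𝓡 n) x)).inv.posSemidef
  obtain ⟨S, hS⟩ := CStarAlgebra.nonneg_iff_eq_star_mul_self.1 h.nonneg
  refine ⟨S, fun i j => ?_⟩
  change (gram g x _)⁻¹ i j = _
  rw [hS, Matrix.mul_apply]
  rfl

theorem traceAt_le_of_formLE (g : Metric n M) (x : M) {A B : Matrix (Fin n) (Fin n) ℝ}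
    (h : FormLE A B) : traceAt g x A ≤ traceAt g x B := by
  obtain ⟨S, hS⟩ := exists_inv_factor g x
  have e : ∀ C : Matrix (Fin n) (Fin n) ℝ,
      traceAt g x C = ∑ k, ∑ i, ∑ j, C i j * S k i * S k j := fun C => by
    simp only [traceAt, hS, Finset.sum_mul]
    rw [Finset.sum_comm' (t' := Finset.univ) (s' := fun _ => Finset.univ) (by simp)]
    calc _ = ∑ j, ∑ k, ∑ i, S k i * S k j * C i j :=
          Finset.sum_congr rfl fun j _ => Finset.sum_comm
      _ = _ := by
          rw [Finset.sum_comm]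
          refine Finset.sum_congr rfl fun k _ => ?_
          rw [Finset.sum_comm]
          exact Finset.sum_congr rfl fun i _ => Finset.sum_congr rfl fun j _ => by ring
  rw [e, e]
  exact Finset.sum_le_sum fun k _ => h (S k)

theorem normSqAt_nonneg (g : Metric n M) (x : M) (A : Matrix (Fin n) (Fin n) ℝ) :
    0 ≤ normSqAt g x A := by
  obtain ⟨S, hS⟩ := exists_inv_factor g x
  have e : normSqAt g x A = ∑ r, ∑ s, (∑ i, ∑ j, S r i * S s j * A i j) ^ 2 := by
    have h1 : ∀ r s, (∑ i, ∑ j, S r i * S s j * A i j) ^ 2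
        = ∑ i, ∑ j, ∑ k, ∑ l, S r i * S r k * (S s j * S s l) * A i j * A k l := fun r s => by
      rw [sq, Finset.sum_mul]
      refine Finset.sum_congr rfl fun i _ => ?_
      rw [Finset.sum_mul]
      refine Finset.sum_congr rfl fun j _ => ?_
      rw [Finset.mul_sum]
      refine Finset.sum_congr rfl fun k _ => ?_
      rw [Finset.mul_sum]
      exact Finset.sum_congr rfl fun l _ => by ring
    simp only [h1]
    -- With the indices grouped into a pair and a quadruple, the interchange is a single use of
    -- `Finset.sum_comm`.
    have h2 : ∀ F : Fin n → Fin n → Fin n → Fin n → Fin n → Fin n → ℝ,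
        ∑ r, ∑ s, ∑ i, ∑ j, ∑ k, ∑ l, F r s i j k l
          = ∑ i, ∑ j, ∑ k, ∑ l, ∑ r, ∑ s, F r s i j k l := fun F => by
      calc _ = ∑ p : Fin n × Fin n, ∑ q : Fin n × Fin n × Fin n × Fin n,
            F p.1 p.2 q.1 q.2.1 q.2.2.1 q.2.2.2 := by simp only [Fintype.sum_prod_type]
        _ = _ := by rw [Finset.sum_comm]; simp only [Fintype.sum_prod_type]
    rw [h2]
    refine Finset.sum_congr rfl fun i _ => Finset.sum_congr rfl fun j _ =>
      Finset.sum_congr rfl fun k _ => Finset.sum_congr rfl fun l _ => ?_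
    rw [hS, hS, Finset.sum_mul_sum]
    simp only [Finset.sum_mul]
  rw [e]
  exact Finset.sum_nonneg fun r _ => Finset.sum_nonneg fun s _ => sq_nonneg _

theorem gradInner_self_nonneg (g : Metric n M) (u : M → ℝ) (x : M) : 0 ≤ gradInner g u u x := by
  have h := (gram_posDef g (mem_extChartAt_target (I := 𝓡 n) x)).inv.posSemidef
  rw [gradInner, coordInner_eq_dotProduct]
  exact h.dotProduct_mulVec_nonneg _

theorem traceAt_metricAt (g : Metric n M) (x : M) : traceAt g x (metricAt g x) = n := by
  have hdet : IsUnit (metricAt g x).det :=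
    isUnit_iff_ne_zero.2 (gram_det_pos g (mem_extChartAt_target x)).ne'
  have h1 : traceAt g x (metricAt g x) = ((metricAt g x)⁻¹ * metricAt g x).trace := by
    simp only [traceAt, Matrix.trace, Matrix.diag, Matrix.mul_apply]
    exact Finset.sum_congr rfl fun i _ => Finset.sum_congr rfl fun j _ => by
      rw [show metricAt g x i j = metricAt g x j i from gram_symm g x _ i j]
  rw [h1, Matrix.nonsing_inv_mul _ hdet, Matrix.trace_one, Fintype.card_fin]

theorem traceAt_add (g : Metric n M) (x : M) (A B : Matrix (Fin n) (Fin n) ℝ) :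
    traceAt g x (A + B) = traceAt g x A + traceAt g x B := by
  simp only [traceAt, Matrix.add_apply, mul_add, Finset.sum_add_distrib]

theorem traceAt_smul (g : Metric n M) (x : M) (c : ℝ) (A : Matrix (Fin n) (Fin n) ℝ) :
    traceAt g x (c • A) = c * traceAt g x A := by
  simp only [traceAt, Matrix.smul_apply, smul_eq_mul, Finset.mul_sum]
  exact Finset.sum_congr rfl fun i _ => Finset.sum_congr rfl fun j _ => by ring

theorem traceAt_transpose (g : Metric n M) (x : M) (A : Matrix (Fin n) (Fin n) ℝ) :
    ∑ i, ∑ j, (metricAt g x)⁻¹ i j * A j i = traceAt g x A := by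
  rw [traceAt, Finset.sum_comm]
  exact Finset.sum_congr rfl fun i _ => Finset.sum_congr rfl fun j _ => by
    rw [inv_symm_apply (A := metricAt g x) (gram_symm g x _)]

end TraceInequalities

/-! ### The conformal Ricci flow and the weighted measure dV. -/

section Flow

variable {m : ℕ} {M : Type*} [TopologicalSpace M] [ChartedSpace (Model (m + 1)) M]
  [IsManifold (𝓡 (m + 1)) ∞ M] {t₀ t₁ T t : ℝ} {g : ℝ → Metric (m + 1) M} {p f : ℝ → M → ℝ}

set_option linter.unusedSectionVars false

theorem kernelH_pos (f : ℝ → M → ℝ) (hT : t < T) (x : M) : 0 < kernelH m T f t x :=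
  mul_pos (Real.rpow_pos_of_pos (mul_pos (mul_pos four_pos Real.pi_pos) (sub_pos.2 hT)) _)
    (Real.exp_pos _)

theorem SlabSmooth.kernelH (hf : SlabSmooth (m + 1) t₀ t₁ f) (hT : t₁ < T) :
    SlabSmooth (m + 1) t₀ t₁ (kernelH m T f) := fun a => by
  refine ContDiffOn.mul (ContDiffOn.rpow_const_of_ne ?_ fun q hq => ?_) (hf a).neg.exp
  · exact (contDiff_const.mul (contDiff_const.sub contDiff_fst)).contDiffOn
  · exact (mul_pos (mul_pos four_pos Real.pi_pos) (sub_pos.2 (hq.1.2.trans_lt hT))).ne'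

theorem gradInner_kernelH (g' : Metric (m + 1) M) (u : M → ℝ) (hf : Smooth (m + 1) (f t)) (x : M) :
    gradInner g' u (kernelH m T f t) x = -kernelH m T f t x * gradInner g' u (f t) x :=
  gradInner_exp_neg g' u hf _ x

/-- Half the trace of ∂ₜg is -(R + (m+1)(m+p)), and the normalization R = -m(m+1) cancels everything
but the pressure. -/
theorem IsConformalRicciFlow.hasDerivWithinAt_densityRatio
    (hflow : IsConformalRicciFlow g p t₀ t₁)
    (hscal : ∀ t ∈ Icc t₀ t₁, ∀ x, scalarCurvature (g t) x = -((m : ℝ) * (m + 1)))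
    (ht : t ∈ Icc t₀ t₁) (x : M) : HasDerivWithinAt (fun s => densityRatio (g s) (g t) x)
      (-((m + 1) * p t x)) (Icc t₀ t₁) t := by
  refine (CRF.hasDerivWithinAt_densityRatio (hflow.evolution t ht x)).congr_deriv ?_
  have h1 := traceAt_transpose (g t) x
    ((-2 : ℝ) • (ricci (g t) x + ((m : ℝ) + p t x) • metricAt (g t) x))
  simp only [Matrix.smul_apply, Matrix.add_apply, smul_eq_mul] at h1
  rw [h1, traceAt_smul, traceAt_add, traceAt_smul, traceAt_metricAt]
  have h2 := hscal t ht x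
  rw [scalarCurvature] at h2
  rw [h2]
  push_cast
  ring

theorem IsConformalRicciFlow.hasDerivWithinAt_gradSq (h01 : t₀ < t₁)
    (hflow : IsConformalRicciFlow g p t₀ t₁) {v : ℝ → M → ℝ} (hv : SlabSmooth (m + 1) t₀ t₁ v)
    (ht : t ∈ Icc t₀ t₁) (x : M) :
    HasDerivWithinAt (fun s => gradInner (g s) (v s) (v s) x)
      (2 * ∑ i, ∑ j, ricci (g t) x i j * gradAt (g t) (v t) x i * gradAt (g t) (v t) x j
        + 2 * (m + p t x) * gradInner (g t) (v t) (v t) x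
        + 2 * gradInner (g t) (v t) (dt t₀ t₁ v t) x) (Icc t₀ t₁) t := by
  refine (hasDerivWithinAt_gradInner_self h01 ht (hflow.evolution t ht x) hv).congr_deriv ?_
  rw [← quadratic_gradAt]
  simp only [mul_add, add_mul, Finset.sum_add_distrib, Finset.mul_sum, neg_mul,
    Finset.sum_neg_distrib, neg_add, neg_neg]
  simp only [mul_assoc]
  congr 1

theorem add_hess_le_of_formLE {v : M → ℝ} {f : M → ℝ} {g : Metric (m + 1) M} {x : M}
    {c : ℝ} (h : FormLE (ricciBE g f x) (c • metricAt g x)) :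
    ∑ i, ∑ j, ricci g x i j * gradAt g v x i * gradAt g v x j
      + ∑ i, ∑ j, hess g f x i j * gradAt g v x i * gradAt g v x j ≤ c * gradInner g v v x := by
  have h1 := h (gradAt g v x)
  simp only [ricciBE, Matrix.add_apply, add_mul, Finset.sum_add_distrib, Matrix.smul_apply,
    smul_eq_mul] at h1
  rw [← quadratic_gradAt, Finset.mul_sum]
  simp only [Finset.mul_sum]
  exact h1.trans_eq (Finset.sum_congr rfl fun i _ => Finset.sum_congr rfl fun j _ => by ring)

variable [MeasurableSpace M] [BorelSpace M] [T2Space M] [CompactSpace M]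

theorem integral_weightedVolume (hf : SlabSmooth (m + 1) t₀ t₁ f) (hT : t₁ < T)
    (ht : t ∈ Icc t₀ t₁) (F : M → ℝ) : ∫ x, F x ∂(weightedVolume g T f t)
      = ∫ x, F x * kernelH m T f t x ∂(riemannianVolume (g t)) := by
  have hc : Continuous (kernelH m T f t) := ((hf.kernelH hT).slice ht).continuous
  rw [weightedVolume, integral_withDensity_eq_integral_toReal_smul₀
    hc.measurable.ennreal_ofReal.aemeasurable (by simp)]
  congr 1
  ext x
  rw [ENNReal.toReal_ofReal (kernelH_pos f (ht.2.trans_lt hT) x).le, smul_eq_mul, mul_comm]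

/-- On the compact M the kernel H has a positive minimum, so ∫ H dμ = 1 forces the volume to be
finite. -/
theorem IsConjugatePotential.isFiniteMeasure [Nonempty M] (hf : IsConjugatePotential g p f T t₀ t₁)
    (hT : t₁ < T) (ht : t ∈ Icc t₀ t₁) : IsFiniteMeasure (riemannianVolume (g t)) := by
  have hc : Continuous (kernelH m T f t) :=
    ((hf.smooth.slabSmooth.kernelH hT).slice ht).continuous
  obtain ⟨x, -, hx⟩ := isCompact_univ.exists_isMinOn univ_nonempty hc.continuousOn
  have hpos := kernelH_pos (m := m) f (ht.2.trans_lt hT) x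
  refine ⟨lt_of_le_of_ne le_top fun h => ?_⟩
  have h1 : ∫⁻ _, ENNReal.ofReal (kernelH m T f t x) ∂(riemannianVolume (g t))
      ≤ ∫⁻ z, ENNReal.ofReal (kernelH m T f t z) ∂(riemannianVolume (g t)) :=
    lintegral_mono fun z => ENNReal.ofReal_le_ofReal (hx (mem_univ z))
  have h2 := hf.normalized t ht
  rw [weightedVolume, withDensity_apply _ MeasurableSet.univ, Measure.restrict_univ] at h2
  rw [h2, lintegral_const, h, ENNReal.mul_top (by simpa using hpos)] at h1
  simp at h1

theorem IsConjugatePotential.isProbabilityMeasure (hf : IsConjugatePotential g p f T t₀ t₁)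
    (ht : t ∈ Icc t₀ t₁) : IsProbabilityMeasure (weightedVolume g T f t) :=
  ⟨hf.normalized t ht⟩

/-- The pressure term of the conjugate heat equation cancels the change of volume, so dV changes by
-ΔH dμ. Green's formula moves one derivative to φ and ∇H = -H∇f does the rest. Stopping at this
first-order form, without the Laplacian of φ, is what avoids Bochner's formula later. -/
theorem hasDerivWithinAt_integral_weightedVolume [Nonempty M] (h01 : t₀ < t₁) (hT : t₁ < T)
    (hflow : IsConformalRicciFlow g p t₀ t₁)
    (hscal : ∀ t ∈ Icc t₀ t₁, ∀ x, scalarCurvature (g t) x = -((m : ℝ) * (m + 1)))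
    (hf : IsConjugatePotential g p f T t₀ t₁) {φ : ℝ → M → ℝ} (hφ : SlabSmooth (m + 1) t₀ t₁ φ)
    (ht : t ∈ Icc t₀ t₁) :
    HasDerivWithinAt (fun s => ∫ x, φ s x ∂(weightedVolume g T f s))
      (∫ x, (dt t₀ t₁ φ t x - gradInner (g t) (f t) (φ t) x) ∂(weightedVolume g T f t))
      (Icc t₀ t₁) t := by
  have hG : SlabSmoothGram t₀ t₁ g := hflow.smooth_metric
  have hfS := hf.smooth.slabSmooth
  have hH := hfS.kernelH hT
  have hr := hG.densityRatio ht
  have := hf.isFiniteMeasure hT ht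
  have hu := (hφ.mul hH).mul hr
  have h1 := hu.hasDerivWithinAt_integral h01 ht (μ := riemannianVolume (g t))
  -- The density ratio has value 1 and derivative -(m+1)p at time t, which cancels the term (m+1)pH
  -- of ∂ₜH.
  have hpt : ∀ x, derivWithin (fun s => φ s x * kernelH m T f s x * densityRatio (g s) (g t) x)
      (Icc t₀ t₁) t = dt t₀ t₁ φ t x * kernelH m T f t x
        - φ t x * laplacian (g t) (kernelH m T f t) x := fun x => by
    rw [(((hφ.hasDerivWithinAt ht x).fun_mul (hH.hasDerivWithinAt ht x)).fun_mul
      (hflow.hasDerivWithinAt_densityRatio hscal ht x)).derivWithin (uniqueDiffOn_Icc h01 t ht)]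
    have h2 := hf.conjugate_heat t ht x
    rw [dt] at h2
    rw [h2, densityRatio_self, dt]
    ring
  have hdφ : Continuous (dt t₀ t₁ φ t) := ((hφ.dt h01).slice ht).continuous
  have hHc := (hH.slice ht).continuous
  have hval : ∫ x, (dt t₀ t₁ φ t x - gradInner (g t) (f t) (φ t) x) ∂(weightedVolume g T f t)
      = ∫ x, derivWithin (fun s => φ s x * kernelH m T f s x * densityRatio (g s) (g t) x)
        (Icc t₀ t₁) t ∂(riemannianVolume (g t)) := by
    have i1 : Integrable (fun x => dt t₀ t₁ φ t x * kernelH m T f t x)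
        (riemannianVolume (g t)) := (hdφ.mul hHc).integrable_of_compactSpace
    have hGt := hG.slice ht
    rw [integral_weightedVolume hfS hT ht]
    simp only [hpt]
    rw [integral_sub i1 (((hφ.slice ht).continuous.fun_mul
      (hGt.laplacian (hH.slice ht)).continuous).integrable_of_compactSpace),
      integral_mul_laplacian hGt (hH.slice ht) (hφ.slice ht), sub_neg_eq_add,
      ← integral_add i1 (hGt.gradInner (hφ.slice ht)
        (hH.slice ht)).continuous.integrable_of_compactSpace]
    congr 1
    ext x
    rw [gradInner_kernelH _ _ (hfS.slice ht), gradInner_comm (g t) (f t)]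
    ring
  rw [hval]
  refine h1.congr_of_mem (fun s hs => ?_) ht
  have := hf.isFiniteMeasure hT hs
  rw [integral_weightedVolume hfS hT hs]
  exact integral_eq_integral_mul_densityRatio (hG.slice hs) (hG.slice ht)
    (hr.slice hs).continuous (((hφ.slice hs).continuous).mul (hH.slice hs).continuous)

/-- Green's formula for the weighted measure. -/
theorem integral_gradInner_weightedVolume [Nonempty M] (hT : t₁ < T)
    (hG : SlabSmoothGram t₀ t₁ g) (hf : IsConjugatePotential g p f T t₀ t₁) {u ψ : M → ℝ}
    (hu : Smooth (m + 1) u) (hψ : Smooth (m + 1) ψ) (ht : t ∈ Icc t₀ t₁) :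
    ∫ x, gradInner (g t) u ψ x ∂(weightedVolume g T f t)
      = -∫ x, ψ x * (laplacian (g t) u x - gradInner (g t) (f t) u x)
          ∂(weightedVolume g T f t) := by
  have := hf.isFiniteMeasure hT ht
  have hfS := hf.smooth.slabSmooth
  have hH := (hfS.kernelH hT).slice ht
  have hGt := hG.slice ht
  have hft := hfS.slice ht
  rw [integral_weightedVolume hfS hT ht, integral_weightedVolume hfS hT ht]
  have h1 := integral_mul_laplacian hGt hu (hψ.mul hH)
  have e1 : ∀ x, gradInner (g t) (fun z => ψ z * kernelH m T f t z) u x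
      = gradInner (g t) u ψ x * kernelH m T f t x
        - ψ x * kernelH m T f t x * gradInner (g t) (f t) u x := fun x => by
    rw [gradInner_comm, gradInner_mul_right _ _ hψ hH, gradInner_kernelH _ _ hft,
      gradInner_comm (g t) (f t)]
    ring
  have i1 : Integrable (fun x => gradInner (g t) u ψ x * kernelH m T f t x)
      (riemannianVolume (g t)) :=
    ((hGt.gradInner hu hψ).continuous.mul hH.continuous).integrable_of_compactSpace
  have i2 : Integrable (fun x => ψ x * kernelH m T f t x * gradInner (g t) (f t) u x)
      (riemannianVolume (g t)) :=
    ((hψ.continuous.mul hH.continuous).mul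
      (hGt.gradInner hft hu).continuous).integrable_of_compactSpace
  have i3 : Integrable (fun x => ψ x * kernelH m T f t x * laplacian (g t) u x)
      (riemannianVolume (g t)) :=
    ((hψ.continuous.mul hH.continuous).mul
      (hGt.laplacian hu).continuous).integrable_of_compactSpace
  have h2 : ∫ x, ψ x * kernelH m T f t x * laplacian (g t) u x ∂(riemannianVolume (g t))
      = -∫ x, (gradInner (g t) u ψ x * kernelH m T f t x
        - ψ x * kernelH m T f t x * gradInner (g t) (f t) u x) ∂(riemannianVolume (g t)) := by
    rw [← integral_congr_ae (Filter.Eventually.of_forall e1)]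
    exact h1
  have e2 : ∀ x, ψ x * (laplacian (g t) u x - gradInner (g t) (f t) u x) * kernelH m T f t x
      = ψ x * kernelH m T f t x * laplacian (g t) u x
        - ψ x * kernelH m T f t x * gradInner (g t) (f t) u x := fun x => by ring
  simp only [e2]
  rw [integral_sub i1 i2] at h2
  rw [integral_sub i3 i2]
  linarith

theorem integral_laplacian_eq_zero {n : ℕ} {M : Type*} [TopologicalSpace M]
    [ChartedSpace (Model n) M] [IsManifold (𝓡 n) ∞ M] [MeasurableSpace M] [BorelSpace M]
    [T2Space M] [CompactSpace M] {g : Metric n M} (hg : SmoothGram g)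
    [IsFiniteMeasure (riemannianVolume g)] {u : M → ℝ} (hu : Smooth n u) :
    ∫ x, laplacian g u x ∂(riemannianVolume g) = 0 := by
  have h1 := integral_mul_laplacian hg hu (contMDiff_const (c := (1 : ℝ)))
  have h2 : ∀ x, gradInner g (fun _ => (1 : ℝ)) u x = 0 := fun x => by
    have : inChart (n := n) x (fun _ : M => (1 : ℝ)) = fun _ => 1 := rfl
    simp [gradInner, coordInner, this, pd]
  simpa [h2] using h1

end Flow

/-! ### Signs of p̄ and k, and continuity of p̄. -/

section Bounds

variable {m : ℕ} {M : Type*} [TopologicalSpace M] [ChartedSpace (Model (m + 1)) M]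
  [IsManifold (𝓡 (m + 1)) ∞ M] {t₀ t₁ T t : ℝ} {g : ℝ → Metric (m + 1) M} {p f : ℝ → M → ℝ}
  {h k : ℝ → ℝ}

set_option linter.unusedSectionVars false

variable [CompactSpace M]

theorem SlabSmooth.le_pmax (hp : SlabSmooth (m + 1) t₀ t₁ p) (ht : t ∈ Icc t₀ t₁) (x : M) :
    p t x ≤ pmax p t := by
  obtain ⟨C, hC⟩ := hp.exists_bound
  exact le_ciSup (f := p t) ⟨C, by rintro _ ⟨z, rfl⟩; exact (le_abs_self _).trans (hC t ht z)⟩ x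

/-- A supremum of functions of time with a common Lipschitz constant is Lipschitz. Continuity makes
the integral in the exponent of Q differentiable. -/
theorem SlabSmooth.continuousOn_pmax [Nonempty M] (h01 : t₀ < t₁)
    (hp : SlabSmooth (m + 1) t₀ t₁ p) : ContinuousOn (pmax p) (Icc t₀ t₁) := by
  obtain ⟨C, hC⟩ := (hp.dt h01).exists_bound
  have hlip : ∀ s ∈ Icc t₀ t₁, ∀ r ∈ Icc t₀ t₁, ∀ x, |p s x - p r x| ≤ C * |s - r| :=
    fun s hs r hr x => (convex_Icc t₀ t₁).norm_image_sub_le_of_norm_hasDerivWithin_le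
      (fun q hq => hp.hasDerivWithinAt hq x) (fun q hq => hC q hq x) hr hs
  have hle : ∀ s ∈ Icc t₀ t₁, ∀ r ∈ Icc t₀ t₁, pmax p s ≤ pmax p r + C * |s - r| :=
    fun s hs r hr => ciSup_le fun x => by
      have h1 := (abs_le.1 (hlip s hs r hr x)).2
      have h2 := hp.le_pmax hr x
      linarith
  have hC0 : 0 ≤ C := (abs_nonneg _).trans
    (hC t₀ (left_mem_Icc.2 h01.le) (Classical.arbitrary M))
  refine (LipschitzOnWith.of_dist_le_mul (K := C.toNNReal) fun s hs r hr => ?_).continuousOn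
  rw [Real.dist_eq, Real.dist_eq, abs_le]
  have h1 := hle s hs r hr
  have h2 := hle r hr s hs
  rw [abs_sub_comm r s] at h2
  rw [Real.coe_toNNReal _ hC0]
  constructor <;> linarith

variable [MeasurableSpace M] [BorelSpace M] [T2Space M] [Nonempty M]

theorem measureReal_riemannianVolume_pos (hT : t₁ < T) (hflow : IsConformalRicciFlow g p t₀ t₁)
    (hf : IsConjugatePotential g p f T t₀ t₁) (ht : t ∈ Icc t₀ t₁) :
    0 < (riemannianVolume (g t)).real univ := by
  have := hf.isFiniteMeasure hT ht
  have := isOpenPosMeasure_riemannianVolume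
    (SlabSmoothGram.slice (g := g) hflow.smooth_metric ht)
  exact ENNReal.toReal_pos (isOpen_univ.measure_pos _ univ_nonempty).ne' (measure_ne_top _ _)

/-- The pressure equation gives Δp ≤ (m+1)p ≤ (m+1)p̄, because the norm squared is nonnegative. The
Laplacian integrates to zero over M, and the volume is positive. -/
theorem pmax_nonneg (hT : t₁ < T) (hflow : IsConformalRicciFlow g p t₀ t₁)
    (hf : IsConjugatePotential g p f T t₀ t₁) (ht : t ∈ Icc t₀ t₁) : 0 ≤ pmax p t := by
  have := hf.isFiniteMeasure hT ht
  have hG : SlabSmoothGram t₀ t₁ g := hflow.smooth_metric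
  have hp := hflow.smooth_pressure.slabSmooth
  have hvol := measureReal_riemannianVolume_pos hT hflow hf ht
  have hle : ∀ x, laplacian (g t) (p t) x ≤ (m + 1) * pmax p t := fun x => by
    have h1 := hflow.pressure_eq t ht x
    have h2 : 0 ≤ 1 / (m : ℝ) * normSqAt (g t) x (ricci (g t) x + (m : ℝ) • metricAt (g t) x) :=
      mul_nonneg (by positivity) (normSqAt_nonneg _ _ _)
    have h3 := mul_le_mul_of_nonneg_left (hp.le_pmax ht x) (by positivity : (0 : ℝ) ≤ m + 1)
    linarith
  have h1 : ∫ x, laplacian (g t) (p t) x ∂(riemannianVolume (g t))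
      ≤ ∫ _, (m + 1) * pmax p t ∂(riemannianVolume (g t)) :=
    integral_mono ((hG.slice ht).laplacian (hp.slice ht)).continuous.integrable_of_compactSpace
      (integrable_const _) hle
  rw [integral_laplacian_eq_zero (hG.slice ht) (hp.slice ht), integral_const, smul_eq_mul] at h1
  have h2 := nonneg_of_mul_nonneg_right h1 hvol
  exact nonneg_of_mul_nonneg_right h2 (by positivity)

/-- Tracing cancels the scalar curvature and leaves Δf ≤ (m+1)c; integration over M gives the sign.
With c = k/(2h) this yields k ≥ 0. -/
theorem nonneg_of_ricciBE_le (hT : t₁ < T) (hflow : IsConformalRicciFlow g p t₀ t₁)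
    (hf : IsConjugatePotential g p f T t₀ t₁) (ht : t ∈ Icc t₀ t₁) {c : ℝ}
    (hric : ∀ x, FormLE (ricciBE (g t) (f t) x)
      ((c + scalarCurvature (g t) x / (m + 1)) • metricAt (g t) x)) : 0 ≤ c := by
  have := hf.isFiniteMeasure hT ht
  have hG : SlabSmoothGram t₀ t₁ g := hflow.smooth_metric
  have hfS := hf.smooth.slabSmooth
  have hvol := measureReal_riemannianVolume_pos hT hflow hf ht
  have hm : (0 : ℝ) < m + 1 := by positivity
  have hle : ∀ x, laplacian (g t) (f t) x ≤ (m + 1) * c := fun x => by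
    have h1 := traceAt_le_of_formLE (g t) x (hric x)
    rw [ricciBE, traceAt_add, traceAt_smul, traceAt_metricAt] at h1
    change scalarCurvature (g t) x + laplacian (g t) (f t) x ≤ _ at h1
    push_cast at h1
    rw [add_mul, div_mul_cancel₀ _ hm.ne'] at h1
    linarith
  have h1 : ∫ x, laplacian (g t) (f t) x ∂(riemannianVolume (g t))
      ≤ ∫ _, (m + 1) * c ∂(riemannianVolume (g t)) :=
    integral_mono ((hG.slice ht).laplacian (hfS.slice ht)).continuous.integrable_of_compactSpace
      (integrable_const _) hle
  rw [integral_laplacian_eq_zero (hG.slice ht) (hfS.slice ht), integral_const, smul_eq_mul] at h1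
  exact nonneg_of_mul_nonneg_right (nonneg_of_mul_nonneg_right h1 hvol) hm

end Bounds

/-! ### The exponential factor in the frequency. -/

section Rate

variable {M : Type*} {t₀ t₁ t : ℝ} {p : ℝ → M → ℝ} {h k : ℝ → ℝ}

theorem hasDerivWithinAt_intervalIntegral_of_continuousOn {r : ℝ → ℝ} (h01 : t₀ ≤ t₁)
    (hr : ContinuousOn r (Icc t₀ t₁)) (ht : t ∈ Icc t₀ t₁) :
    HasDerivWithinAt (fun s => ∫ x in t₀..s, r x) (r t) (Icc t₀ t₁) t := by
  -- Extending r by its end values makes it continuous on the line, so the fundamental theorem of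
  -- calculus also gives the one-sided derivatives at the end points.
  set r' := IccExtend h01 ((Icc t₀ t₁).domRestrict r) with hr'
  have hc : Continuous r' := hr.domRestrict.Icc_extend'
  have he : ∀ s ∈ Icc t₀ t₁, r' s = r s := fun s hs => IccExtend_of_mem h01 _ hs
  have h1 := (hc.integral_hasStrictDerivAt t₀ t).hasDerivAt.hasDerivWithinAt (s := Icc t₀ t₁)
  rw [he t ht] at h1
  refine h1.congr_of_mem (fun s hs => intervalIntegral.integral_congr fun x hx => ?_) ht
  rw [uIcc_of_le hs.1] at hx
  exact (he x ⟨hx.1, hx.2.trans hs.2⟩).symm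

theorem hasDerivWithinAt_rate (h01 : t₀ < t₁) (hp : ContinuousOn (pmax p) (Icc t₀ t₁))
    (hh : ContDiffOn ℝ ∞ h (Icc t₀ t₁)) (hk : ContDiffOn ℝ ∞ k (Icc t₀ t₁))
    (hpos : ∀ t ∈ Icc t₀ t₁, 0 < h t) (ht : t ∈ Icc t₀ t₁) :
    HasDerivWithinAt (rate p h k t₀ t₁)
      (2 * pmax p t + (derivWithin h (Icc t₀ t₁) t + k t) / h t) (Icc t₀ t₁) t := by
  have hr : ContinuousOn (fun s => 2 * pmax p s + (derivWithin h (Icc t₀ t₁) s + k s) / h s)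
      (Icc t₀ t₁) :=
    (continuousOn_const.mul hp).add (((hh.continuousOn_derivWithin (uniqueDiffOn_Icc h01)
      (by simp)).add hk.continuousOn).div hh.continuousOn fun s hs => (hpos s hs).ne')
  exact hasDerivWithinAt_intervalIntegral_of_continuousOn h01.le hr ht

/-- The term h'/h in the rate compensates the derivative of h and leaves -(2p̄h + k)e^{-r} ≤ 0, so
the product is at most its value at t₀, where the exponent vanishes. -/
theorem mul_exp_neg_rate_le (h01 : t₀ < t₁) (hp : ContinuousOn (pmax p) (Icc t₀ t₁))
    (hh : ContDiffOn ℝ ∞ h (Icc t₀ t₁)) (hk : ContDiffOn ℝ ∞ k (Icc t₀ t₁))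
    (hpos : ∀ t ∈ Icc t₀ t₁, 0 < h t) (hp0 : ∀ t ∈ Icc t₀ t₁, 0 ≤ pmax p t)
    (hk0 : ∀ t ∈ Icc t₀ t₁, 0 ≤ k t) (ht : t ∈ Icc t₀ t₁) :
    h t * Real.exp (-rate p h k t₀ t₁ t) ≤ h t₀ := by
  have hd : ∀ s ∈ Icc t₀ t₁, HasDerivWithinAt (fun s => h s * Real.exp (-rate p h k t₀ t₁ s))
      (-(2 * pmax p s * h s + k s) * Real.exp (-rate p h k t₀ t₁ s)) (Icc t₀ t₁) s :=
    fun s hs => by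
      have h1 := (hh.differentiableOn (by simp) s hs).hasDerivWithinAt
      have h2 := (hasDerivWithinAt_rate h01 hp hh hk hpos hs).fun_neg.exp
      refine (h1.fun_mul h2).congr_deriv ?_
      have := (hpos s hs).ne'
      field_simp
      ring
  have hanti : AntitoneOn (fun s => h s * Real.exp (-rate p h k t₀ t₁ s)) (Icc t₀ t₁) := by
    refine antitoneOn_of_hasDerivWithinAt_nonpos (convex_Icc t₀ t₁)
      (fun s hs => (hd s hs).continuousWithinAt)
      (fun s hs => (hd s (interior_subset hs)).mono interior_subset) fun s hs => ?_
    have hs' := interior_subset hs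
    have := mul_nonneg (hp0 s hs') (hpos s hs').le
    have := hk0 s hs'
    exact mul_nonpos_of_nonpos_of_nonneg (by linarith) (Real.exp_pos _).le
  have h0 := hanti (left_mem_Icc.2 h01.le) ht ht.1
  have e0 : rate p h k t₀ t₁ t₀ = 0 := intervalIntegral.integral_same
  simpa [e0] using h0

end Rate

/-! ### Cauchy-Schwarz and the algebra of the frequency. -/

theorem integral_mul_sq_le {X : Type*} [TopologicalSpace X] [CompactSpace X] [T2Space X]
    [MeasurableSpace X] [BorelSpace X] {ν : Measure X} [IsFiniteMeasure ν] {a b : X → ℝ}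
    (ha : Continuous a) (hb : Continuous b) (hpos : 0 < ∫ x, a x ^ 2 ∂ν) :
    (∫ x, a x * b x ∂ν) ^ 2 ≤ (∫ x, a x ^ 2 ∂ν) * ∫ x, b x ^ 2 ∂ν := by
  -- The coefficient of the L² projection of b on a, for which ∫ (b - la)² is smallest.
  set l := (∫ x, a x * b x ∂ν) / ∫ x, a x ^ 2 ∂ν with hl
  have h1 : 0 ≤ ∫ x, (b x - l * a x) ^ 2 ∂ν := integral_nonneg fun x => sq_nonneg _
  have e : ∀ x, (b x - l * a x) ^ 2 = b x ^ 2 - 2 * l * (a x * b x) + l ^ 2 * a x ^ 2 :=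
    fun x => by ring
  have i1 : Integrable (fun x => b x ^ 2) ν := (hb.pow 2).integrable_of_compactSpace
  have i2 : Integrable (fun x => 2 * l * (a x * b x)) ν :=
    (continuous_const.mul (ha.mul hb)).integrable_of_compactSpace
  have i3 : Integrable (fun x => l ^ 2 * a x ^ 2) ν :=
    (continuous_const.mul (ha.pow 2)).integrable_of_compactSpace
  have i12 : Integrable (fun x => b x ^ 2 - 2 * l * (a x * b x)) ν := i1.sub i2
  simp only [e] at h1
  rw [integral_add i12 i3, integral_sub i1 i2, integral_const_mul, integral_const_mul] at h1
  have h2 : l * ∫ x, a x ^ 2 ∂ν = ∫ x, a x * b x ∂ν := div_mul_cancel₀ _ hpos.ne'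
  have h3 : 0 ≤ (∫ x, a x ^ 2 ∂ν) * ∫ x, b x ^ 2 ∂ν
      - (l * ∫ x, a x ^ 2 ∂ν) * ∫ x, a x * b x ∂ν := by
    have h3 := mul_nonneg hpos.le h1
    have h4 : (l * ∫ x, a x ^ 2 ∂ν) * (l * ∫ x, a x ^ 2 ∂ν - ∫ x, a x * b x ∂ν) = 0 := by
      rw [h2, sub_self, mul_zero]
    generalize (∫ x, a x ^ 2 ∂ν) = A at h3 h4 ⊢
    generalize (∫ x, a x * b x ∂ν) = X at h3 h4 ⊢
    generalize (∫ x, b x ^ 2 ∂ν) = Y at h3 h4 ⊢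
    linarith
  rw [h2] at h3
  linarith

/-- The algebraic core of the monotonicity of the frequency. -/
theorem frequency_deriv_le {I D D' a b c d e h h' k P r B : ℝ} (hI : 0 < I)
    (hh : 0 < h) (hD : D = -a + b)
    (hD' : D' ≤ (k / h + 2 * P) * D - 2 * c + 2 * d) (hCS : (a - b / 2) ^ 2 ≤ I * (c - d + e / 4))
    (he : e ≤ 2 * P ^ 2 * (I + D)) (hB : h * Real.exp (-r) ≤ B) :
    ((h' * D + h * D') * I - h * D * (2 * a)) / I ^ 2 * Real.exp (-r)
        + h * D / I * (Real.exp (-r) * -(2 * P + (h' + k) / h))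
      ≤ P ^ 2 * (h * D / I * Real.exp (-r) + B) := by
  have hexp := Real.exp_pos (-r)
  -- Here a = ∫ vψ, b = ∫ vw, c = ∫ ψ², d = ∫ ψw and e = ∫ w². The squares are -Da = (a - b/2)² -
  -- b²/4 and -2c + 2d = -2(c - d + e/4) + e/2. By `hCS` the main terms have a nonpositive sum, and
  -- what remains is at most Ie/2, which `he` bounds by P²(I + D)I.
  have key : h * (-2 * c + 2 * d) * I - 2 * h * D * a ≤ h * P ^ 2 * (I + D) * I := by
    have h1 : (-2 * c + 2 * d) * I - 2 * D * a ≤ P ^ 2 * (I + D) * I := by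
      have h2 := mul_le_mul_of_nonneg_right he hI.le
      subst hD
      nlinarith [sq_nonneg b]
    nlinarith
  have hD2 : h * D' ≤ k * D + 2 * P * h * D + h * (-2 * c + 2 * d) := by
    have h1 := mul_le_mul_of_nonneg_left hD' hh.le
    have h2 : h * ((k / h + 2 * P) * D - 2 * c + 2 * d)
        = k * D + 2 * P * h * D + h * (-2 * c + 2 * d) := by
      field_simp
      ring
    linarith
  -- The derivative of the exponential removes exactly the terms h'D, kD and 2PhD; the rate is
  -- chosen for this.
  have e1 : ((h' * D + h * D') * I - h * D * (2 * a)) / I ^ 2 * Real.exp (-r)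
        + h * D / I * (Real.exp (-r) * -(2 * P + (h' + k) / h))
      = ((h * D' - k * D - 2 * P * h * D) * I - 2 * h * D * a) / I ^ 2 * Real.exp (-r) := by
    field_simp
    ring
  have h3 : ((h * D' - k * D - 2 * P * h * D) * I - 2 * h * D * a) / I ^ 2
      ≤ P ^ 2 * (h * D / I + h) := by
    rw [div_le_iff₀ (by positivity)]
    have h4 : P ^ 2 * (h * D / I + h) * I ^ 2 = h * P ^ 2 * (I + D) * I := by
      field_simp
      ring
    rw [h4]
    have h5 := mul_le_mul_of_nonneg_right
      (show h * D' - k * D - 2 * P * h * D ≤ h * (-2 * c + 2 * d) by linarith) hI.le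
    linarith
  rw [e1]
  calc _ ≤ P ^ 2 * (h * D / I + h) * Real.exp (-r) := mul_le_mul_of_nonneg_right h3 hexp.le
    _ = P ^ 2 * (h * D / I * Real.exp (-r) + h * Real.exp (-r)) := by ring
    _ ≤ _ := mul_le_mul_of_nonneg_left (by linarith) (sq_nonneg P)

/-! ### The differential inequalities for I, D and Q. -/

section Frequency

variable {m : ℕ} {M : Type*} [TopologicalSpace M] [T2Space M] [CompactSpace M] [Nonempty M]
  [MeasurableSpace M] [BorelSpace M] [ChartedSpace (Model (m + 1)) M]
  [IsManifold (𝓡 (m + 1)) ∞ M] {t₀ t₁ T t : ℝ} {g : ℝ → Metric (m + 1) M} {p f v : ℝ → M → ℝ}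
  {h k : ℝ → ℝ}

set_option linter.unusedSectionVars false

/-- `∂ₜv - ⟨∇f, ∇v⟩`. -/
def driftDt (g : ℝ → Metric (m + 1) M) (f v : ℝ → M → ℝ) (t₀ t₁ t : ℝ) (x : M) : ℝ :=
  dt t₀ t₁ v t x - gradInner (g t) (f t) (v t) x

theorem smooth_driftDt (h01 : t₀ < t₁) (hG : SlabSmoothGram t₀ t₁ g)
    (hf : SlabSmooth (m + 1) t₀ t₁ f) (hv : SlabSmooth (m + 1) t₀ t₁ v) (ht : t ∈ Icc t₀ t₁) :
    Smooth (m + 1) (driftDt g f v t₀ t₁ t) :=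
  ContMDiff.sub ((hv.dt h01).slice ht) ((hG.slice ht).gradInner (hf.slice ht) (hv.slice ht))

theorem massI_pos (h1T : t₁ < T) (hflow : IsConformalRicciFlow g p t₀ t₁)
    (hf : IsConjugatePotential g p f T t₀ t₁) (hv : SlabSmooth (m + 1) t₀ t₁ v)
    (ht : t ∈ Icc t₀ t₁) (hne : ∃ x, v t x ≠ 0) : 0 < massI g T f v t := by
  obtain ⟨x, hx⟩ := hne
  have hfS := hf.smooth.slabSmooth
  have := hf.isFiniteMeasure h1T ht
  have := isOpenPosMeasure_riemannianVolume
    (SlabSmoothGram.slice (g := g) hflow.smooth_metric ht)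
  rw [massI, integral_weightedVolume hfS h1T ht]
  have hH : ∀ z, 0 < kernelH m T f t z := kernelH_pos f (ht.2.trans_lt h1T)
  exact (((hv.slice ht).continuous.pow 2).mul
    ((hfS.kernelH h1T).slice ht).continuous).integral_pos_of_hasCompactSupport_nonneg_nonzero
      (HasCompactSupport.of_compactSpace _) (fun z => mul_nonneg (sq_nonneg _) (hH z).le)
      (mul_ne_zero (pow_ne_zero 2 hx) (hH x).ne')

theorem hasDerivWithinAt_massI (h01 : t₀ < t₁) (h1T : t₁ < T)
    (hflow : IsConformalRicciFlow g p t₀ t₁)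
    (hscal : ∀ t ∈ Icc t₀ t₁, ∀ x, scalarCurvature (g t) x = -((m : ℝ) * (m + 1)))
    (hf : IsConjugatePotential g p f T t₀ t₁) (hv : SlabSmooth (m + 1) t₀ t₁ v)
    (ht : t ∈ Icc t₀ t₁) : HasDerivWithinAt (massI g T f v)
      (2 * ∫ x, v t x * driftDt g f v t₀ t₁ t x ∂(weightedVolume g T f t)) (Icc t₀ t₁) t := by
  have h1 := hasDerivWithinAt_integral_weightedVolume h01 h1T hflow hscal hf (hv.mul hv) ht
  have e0 : massI g T f v = fun s => ∫ x, v s x * v s x ∂(weightedVolume g T f s) := by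
    ext s
    simp only [massI, sq]
  rw [e0]
  refine h1.congr_deriv ?_
  rw [← integral_const_mul]
  congr 1
  ext x
  rw [gradInner_mul_right _ _ (hv.slice ht) (hv.slice ht), dt,
    ((hv.hasDerivWithinAt ht x).fun_mul (hv.hasDerivWithinAt ht x)).derivWithin
      (uniqueDiffOn_Icc h01 t ht), driftDt, dt]
  ring

/-- `∫ |∇v|² dV`. -/
def dirichlet (g : ℝ → Metric (m + 1) M) (T : ℝ) (f v : ℝ → M → ℝ) (t : ℝ) : ℝ :=
  ∫ x, gradSq (g t) (v t) x ∂(weightedVolume g T f t)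

/-- The integrand of D' is 2(Ric + Hess f)(∇v, ∇v) + 2(m + p)|∇v|² + 2⟨∇v, ∇ψ⟩ with ψ = `driftDt`:
Ric comes from the moving metric and Hess f from ⟨∇f, ∇|∇v|²⟩. The term 2m|∇v|² of the flow cancels
R/(m+1) = -m in the Ricci hypothesis. The lemma is applied with c = k/h. -/
theorem exists_hasDerivWithinAt_dirichlet (h01 : t₀ < t₁) (h1T : t₁ < T)
    (hflow : IsConformalRicciFlow g p t₀ t₁)
    (hscal : ∀ t ∈ Icc t₀ t₁, ∀ x, scalarCurvature (g t) x = -((m : ℝ) * (m + 1)))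
    (hf : IsConjugatePotential g p f T t₀ t₁) {c : ℝ} (ht : t ∈ Icc t₀ t₁)
    (hric : ∀ x, FormLE (ricciBE (g t) (f t) x)
      ((c / 2 + scalarCurvature (g t) x / (m + 1)) • metricAt (g t) x))
    (hv : SlabSmooth (m + 1) t₀ t₁ v) :
    ∃ D', HasDerivWithinAt (dirichlet g T f v) D' (Icc t₀ t₁) t ∧
      D' ≤ (c + 2 * pmax p t) * dirichlet g T f v t
        + 2 * ∫ x, gradInner (g t) (v t) (driftDt g f v t₀ t₁ t) x
          ∂(weightedVolume g T f t) := by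
  have hG : SlabSmoothGram t₀ t₁ g := hflow.smooth_metric
  have hfS := hf.smooth.slabSmooth
  have hp := hflow.smooth_pressure.slabSmooth
  have := hf.isProbabilityMeasure ht
  have hGt := hG.slice ht
  have hvt := hv.slice ht
  have hψ := smooth_driftDt h01 hG hfS hv ht
  have hE : SlabSmooth (m + 1) t₀ t₁ fun s => gradInner (g s) (v s) (v s) :=
    SlabSmooth.gradInner h01 hG hv hv
  refine ⟨_, hasDerivWithinAt_integral_weightedVolume h01 h1T hflow hscal hf hE ht, ?_⟩
  have i1 : Integrable (gradInner (g t) (v t) (v t)) (weightedVolume g T f t) :=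
    (hGt.gradInner hvt hvt).continuous.integrable_of_compactSpace
  have i2 : Integrable (gradInner (g t) (v t) (driftDt g f v t₀ t₁ t)) (weightedVolume g T f t) :=
    (hGt.gradInner hvt hψ).continuous.integrable_of_compactSpace
  rw [dirichlet, gradSq_eq, ← integral_const_mul, ← integral_const_mul,
    ← integral_add (i1.const_mul _) (i2.const_mul _)]
  refine integral_mono (((hE.dt h01).slice ht).continuous.sub
    (hGt.gradInner (hfS.slice ht) (hE.slice ht)).continuous).integrable_of_compactSpace
    ((i1.const_mul _).add (i2.const_mul _)) fun x => ?_
  have hpx := mul_le_mul_of_nonneg_right (hp.le_pmax ht x) (gradInner_self_nonneg (g t) (v t) x)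
  have hR := add_hess_le_of_formLE (v := v t) (hric x)
  have hm : (0 : ℝ) < m + 1 := by positivity
  rw [hscal t ht x, neg_div, mul_div_cancel_right₀ _ hm.ne'] at hR
  have hdt := (hflow.hasDerivWithinAt_gradSq h01 hv ht x).derivWithin (uniqueDiffOn_Icc h01 t ht)
  have hdrift : gradInner (g t) (v t) (driftDt g f v t₀ t₁ t) x
      = gradInner (g t) (v t) (dt t₀ t₁ v t) x
        - gradInner (g t) (v t) (gradInner (g t) (f t) (v t)) x :=
    gradInner_sub_right _ _ ((hv.dt h01).slice ht) (hGt.gradInner (hfS.slice ht) hvt) x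
  simp only [dt, gradSq_eq]
  rw [hdt, gradInner_gradInner_self hGt (hfS.slice ht) hvt, hdrift]
  linarith

/-- The differential inequalities for the weighted `L²` norm and the parabolic frequency. -/
theorem frequency_monotonicity (h01 : t₀ < t₁) (h1T : t₁ < T)
    (hflow : IsConformalRicciFlow g p t₀ t₁)
    (hscal : ∀ t ∈ Icc t₀ t₁, ∀ x, scalarCurvature (g t) x = -((m : ℝ) * (m + 1)))
    (hf : IsConjugatePotential g p f T t₀ t₁)
    (hh : ContDiffOn ℝ ∞ h (Icc t₀ t₁)) (hk : ContDiffOn ℝ ∞ k (Icc t₀ t₁))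
    (hpos : ∀ t ∈ Icc t₀ t₁, 0 < h t)
    (hric : ∀ t ∈ Icc t₀ t₁, ∀ x, FormLE (ricciBE (g t) (f t) x)
      ((k t / (2 * h t) + scalarCurvature (g t) x / (m + 1)) • metricAt (g t) x))
    (hv : SmoothOn m v t₀ t₁)
    (hineq : ∀ t ∈ Icc t₀ t₁, ∀ x, |dt t₀ t₁ v t x - laplacian (g t) (v t) x|
      ≤ pmax p t * (|v t x| + Real.sqrt (gradSq (g t) (v t) x)))
    (ht : t ∈ Icc t₀ t₁) (hne : ∃ x, v t x ≠ 0) :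
    (DifferentiableWithinAt ℝ (fun s => Real.log (massI g T f v s)) (Icc t₀ t₁) t ∧
      derivWithin (fun s => Real.log (massI g T f v s)) (Icc t₀ t₁) t
        ≥ -3 * pmax p t - (pmax p t + 2) / h t * freqQ g p T f v h k t₀ t₁ t
            * Real.exp (rate p h k t₀ t₁ t)) ∧
    (DifferentiableWithinAt ℝ (freqQ g p T f v h k t₀ t₁) (Icc t₀ t₁) t ∧
      derivWithin (freqQ g p T f v h k t₀ t₁) (Icc t₀ t₁) t
        ≤ pmax p t ^ 2 * (freqQ g p T f v h k t₀ t₁ t + h t₀)) ∧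
    (DifferentiableWithinAt ℝ (fun s => Real.log (freqQ g p T f v h k t₀ t₁ s + h t₀))
        (Icc t₀ t₁) t ∧
      derivWithin (fun s => Real.log (freqQ g p T f v h k t₀ t₁ s + h t₀)) (Icc t₀ t₁) t
        ≤ pmax p t ^ 2) := by
  have hG : SlabSmoothGram t₀ t₁ g := hflow.smooth_metric
  have hvS := hv.slabSmooth
  have hfS := hf.smooth.slabSmooth
  have hGt := hG.slice ht
  have hvt := hvS.slice ht
  have hft := hfS.slice ht
  have hp0 := fun s (hs : s ∈ Icc t₀ t₁) => pmax_nonneg h1T hflow hf hs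
  have hpc := hflow.smooth_pressure.slabSmooth.continuousOn_pmax h01
  have hud := uniqueDiffOn_Icc h01 t ht
  have hht := hpos t ht
  have := hf.isFiniteMeasure h1T ht
  have := hf.isProbabilityMeasure ht
  have hk0 : ∀ s ∈ Icc t₀ t₁, 0 ≤ k s := fun s hs => by
    have := nonneg_of_ricciBE_le h1T hflow hf hs (hric s hs)
    have h2 : k s = k s / (2 * h s) * (2 * h s) := by
      have := (hpos s hs).ne'
      field_simp
    rw [h2]
    exact mul_nonneg this (mul_pos two_pos (hpos s hs)).le
  set ν := weightedVolume g T f t with hν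
  set P := pmax p t with hP
  set ψ := driftDt g f v t₀ t₁ t with hψdef
  set w : M → ℝ := fun x => dt t₀ t₁ v t x - laplacian (g t) (v t) x with hw
  have hψ : Smooth (m + 1) ψ := smooth_driftDt h01 hG hfS hvS ht
  have hwS : Smooth (m + 1) w := ContMDiff.sub ((hvS.dt h01).slice ht) (hGt.laplacian hvt)
  have hI := massI_pos h1T hflow hf hvS ht hne
  have hI' := hasDerivWithinAt_massI h01 h1T hflow hscal hf hvS ht
  obtain ⟨D', hD', hD'le⟩ := exists_hasDerivWithinAt_dirichlet (c := k t / h t) h01 h1T hflow hscal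
    hf ht (fun x => by rw [div_div, mul_comm (h t) 2]; exact hric t ht x) hvS
  -- The drift Laplacian of v is ψ - w. This is used for φ = v, which expresses D, and for φ = ψ,
  -- which expresses the last term of D'.
  have hgreen : ∀ {φ : M → ℝ}, Smooth (m + 1) φ → ∫ x, gradInner (g t) (v t) φ x ∂ν
      = -∫ x, φ x * ψ x ∂ν + ∫ x, φ x * w x ∂ν := fun {φ} hφ => by
    have i1 : Integrable (fun x => φ x * ψ x) ν :=
      (hφ.continuous.mul hψ.continuous).integrable_of_compactSpace
    have i2 : Integrable (fun x => φ x * w x) ν :=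
      (hφ.continuous.mul hwS.continuous).integrable_of_compactSpace
    rw [integral_gradInner_weightedVolume h1T hG hf hvt hφ ht, neg_add_eq_sub,
      ← integral_sub i2 i1, ← integral_neg]
    congr 1
    ext x
    simp only [hw, hψdef, driftDt]
    ring
  set I := massI g T f v t with hIdef
  set D := dirichlet g T f v t with hDdef
  have hc := hvt.continuous
  have hcg : Continuous (gradSq (g t) (v t)) := (hGt.gradInner hvt hvt).continuous
  have hg0 : ∀ x, 0 ≤ gradSq (g t) (v t) x := gradInner_self_nonneg (g t) (v t)
  have hD0 : 0 ≤ D := integral_nonneg hg0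
  have hD : D = -∫ x, v t x * ψ x ∂ν + ∫ x, v t x * w x ∂ν := hgreen hvt
  have hsqrt : ∀ x, Real.sqrt (gradSq (g t) (v t) x) ^ 2 = gradSq (g t) (v t) x := fun x =>
    Real.sq_sqrt (hg0 x)
  have hP0 : 0 ≤ P := hp0 t ht
  have iv : Integrable (fun x => v t x ^ 2) ν := (hc.pow 2).integrable_of_compactSpace
  have ig : Integrable (fun x => gradSq (g t) (v t) x) ν := hcg.integrable_of_compactSpace
  -- From 2|v||w| ≤ 2P(v² + |v||∇v|) and 2|v||∇v| ≤ v² + |∇v|²; these are the constants 3 and 1 that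
  -- lead to -3P and P + 2 in the bound on (log I)'.
  have hb : -(P * (3 * I + D)) ≤ 2 * ∫ x, v t x * w x ∂ν := by
    have h1 : ∫ x, (-(P * 3) * v t x ^ 2 + -P * gradSq (g t) (v t) x) ∂ν
        ≤ ∫ x, 2 * (v t x * w x) ∂ν := by
      refine integral_mono ((iv.const_mul _).add (ig.const_mul _))
        (continuous_const.mul (hc.mul hwS.continuous)).integrable_of_compactSpace fun x => ?_
      have h2 := mul_le_mul_of_nonneg_left (hineq t ht x) (abs_nonneg (v t x))
      rw [← abs_mul] at h2
      have h3 := neg_abs_le (v t x * w x)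
      have h4 : |v t x| * (P * (|v t x| + Real.sqrt (gradSq (g t) (v t) x)))
          ≤ P * (3 / 2 * v t x ^ 2 + 1 / 2 * gradSq (g t) (v t) x) := by
        rw [mul_left_comm]
        refine mul_le_mul_of_nonneg_left ?_ hP0
        have h5 := hsqrt x
        rw [← sq_abs (v t x)]
        nlinarith [sq_nonneg (|v t x| - Real.sqrt (gradSq (g t) (v t) x))]
      simp only
      linarith
    rw [integral_add (iv.const_mul _) (ig.const_mul _), integral_const_mul, integral_const_mul,
      integral_const_mul] at h1
    change -(P * 3) * I + -P * D ≤ _ at h1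
    linarith
  have he : ∫ x, w x ^ 2 ∂ν ≤ 2 * P ^ 2 * (I + D) := by
    have h1 : ∫ x, w x ^ 2 ∂ν ≤ ∫ x, (2 * P ^ 2 * v t x ^ 2
        + 2 * P ^ 2 * gradSq (g t) (v t) x) ∂ν := by
      refine integral_mono (hwS.continuous.pow 2).integrable_of_compactSpace
        ((iv.const_mul _).add (ig.const_mul _)) fun x => ?_
      have h2 := pow_le_pow_left₀ (abs_nonneg _) (hineq t ht x) 2
      rw [sq_abs] at h2
      have h3 : (P * (|v t x| + Real.sqrt (gradSq (g t) (v t) x))) ^ 2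
          ≤ P ^ 2 * (2 * v t x ^ 2 + 2 * gradSq (g t) (v t) x) := by
        rw [mul_pow]
        refine mul_le_mul_of_nonneg_left ?_ (sq_nonneg P)
        have h5 := hsqrt x
        rw [← sq_abs (v t x)]
        nlinarith [sq_nonneg (|v t x| - Real.sqrt (gradSq (g t) (v t) x))]
      simp only
      linarith
    rw [integral_add (iv.const_mul _) (ig.const_mul _), integral_const_mul,
      integral_const_mul] at h1
    change _ ≤ 2 * P ^ 2 * I + 2 * P ^ 2 * D at h1
    linarith
  -- The function ψ - w/2 is the midpoint of ψ and the drift Laplacian ψ - w. With it, a = ∫ vψ and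
  -- D become symmetric: a = X + b/2 and D = -X + b/2, where X = ∫ v(ψ - w/2) and b = ∫ vw.
  have hCS : (∫ x, v t x * ψ x ∂ν - (∫ x, v t x * w x ∂ν) / 2) ^ 2
      ≤ I * (∫ x, ψ x * ψ x ∂ν - ∫ x, ψ x * w x ∂ν + (∫ x, w x ^ 2 ∂ν) / 4) := by
    have h1 := integral_mul_sq_le (ν := ν) (b := fun x => ψ x - w x / 2) hc
      (hψ.continuous.sub (hwS.continuous.div_const 2)) hI
    have j1 : Integrable (fun x => v t x * ψ x) ν :=
      (hc.mul hψ.continuous).integrable_of_compactSpace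
    have j2 : Integrable (fun x => v t x * w x / 2) ν :=
      ((hc.mul hwS.continuous).div_const 2).integrable_of_compactSpace
    have j3 : Integrable (fun x => ψ x * ψ x) ν :=
      (hψ.continuous.mul hψ.continuous).integrable_of_compactSpace
    have j4 : Integrable (fun x => ψ x * w x) ν :=
      (hψ.continuous.mul hwS.continuous).integrable_of_compactSpace
    have j5 : Integrable (fun x => w x ^ 2 / 4) ν :=
      ((hwS.continuous.pow 2).div_const 4).integrable_of_compactSpace
    have j34 : Integrable (fun x => ψ x * ψ x - ψ x * w x) ν := j3.sub j4
    have e1 : ∀ x, v t x * (ψ x - w x / 2) = v t x * ψ x - v t x * w x / 2 := fun x => by ring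
    have e2 : ∀ x, (ψ x - w x / 2) ^ 2 = ψ x * ψ x - ψ x * w x + w x ^ 2 / 4 := fun x => by ring
    simp only [e1, e2] at h1
    rwa [integral_sub j1 j2, integral_add j34 j5, integral_sub j3 j4, integral_div,
      integral_div] at h1
  have hQ : freqQ g p T f v h k t₀ t₁ = fun s => h s * dirichlet g T f v s / massI g T f v s
      * Real.exp (-rate p h k t₀ t₁ s) := rfl
  have hQ0 : 0 ≤ freqQ g p T f v h k t₀ t₁ t := by
    rw [hQ]
    exact mul_nonneg (div_nonneg (mul_nonneg hht.le hD0) hI.le) (Real.exp_pos _).le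
  have hQ' := ((((hh.differentiableOn (by simp) t ht).hasDerivWithinAt.fun_mul hD').fun_div hI'
    hI.ne').fun_mul (hasDerivWithinAt_rate h01 hpc hh hk hpos ht).fun_neg.exp)
  rw [← hQ] at hQ'
  have hQle : derivWithin (freqQ g p T f v h k t₀ t₁) (Icc t₀ t₁) t
      ≤ P ^ 2 * (freqQ g p T f v h k t₀ t₁ t + h t₀) := by
    rw [hQ'.derivWithin hud]
    rw [hgreen hψ] at hD'le
    exact frequency_deriv_le hI hht hD (by linarith) hCS he
      (mul_exp_neg_rate_le h01 hpc hh hk hpos hp0 hk0 ht)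
  -- Q may vanish, when v is constant in space; the summand h(t₀) > 0 keeps the logarithm
  -- differentiable.
  have hQpos : 0 < freqQ g p T f v h k t₀ t₁ t + h t₀ :=
    add_pos_of_nonneg_of_pos hQ0 (hpos t₀ (left_mem_Icc.2 h01.le))
  have hL := hI'.log hI.ne'
  have hLQ := (hQ'.add_const (h t₀)).log hQpos.ne'
  refine ⟨⟨hL.differentiableWithinAt, ?_⟩, ⟨hQ'.differentiableWithinAt, hQle⟩,
    hLQ.differentiableWithinAt, ?_⟩
  · rw [hL.derivWithin hud, ge_iff_le, le_div_iff₀ hI]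
    have e1 : (P + 2) / h t * freqQ g p T f v h k t₀ t₁ t * Real.exp (rate p h k t₀ t₁ t)
        = (P + 2) * D / I := by
      simp only [hQ]
      rw [← hIdef, ← hDdef, Real.exp_neg]
      have := (Real.exp_pos (rate p h k t₀ t₁ t)).ne'
      field_simp
    rw [e1, sub_mul, div_mul_cancel₀ _ hI.ne']
    linarith
  · rw [hLQ.derivWithin hud, div_le_iff₀ hQpos, ← hQ'.derivWithin hud]
    exact hQle

end Frequency

end CRF

end

theorem proposition4p2
    (m : ℕ) (hm : 2 ≤ m)
    (M : Type*) [TopologicalSpace M] [T2Space M] [CompactSpace M] [ConnectedSpace M]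
    [MeasurableSpace M] [BorelSpace M]
    [ChartedSpace (CRF.Model (m + 1)) M] [IsManifold (𝓡 (m + 1)) ∞ M]
    (t₀ t₁ T : ℝ) (h01 : t₀ < t₁) (h1T : t₁ < T)
    (g : ℝ → CRF.Metric (m + 1) M) (p f v : ℝ → M → ℝ) (h k : ℝ → ℝ)
    (hflow : CRF.IsConformalRicciFlow g p t₀ t₁)
    (hscal : ∀ t ∈ Icc t₀ t₁, ∀ x, CRF.scalarCurvature (g t) x = -((m : ℝ) * (m + 1)))
    (hf : CRF.IsConjugatePotential g p f T t₀ t₁)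
    (hh : ContDiffOn ℝ ∞ h (Icc t₀ t₁)) (hk : ContDiffOn ℝ ∞ k (Icc t₀ t₁))
    (hpos : ∀ t ∈ Icc t₀ t₁, 0 < h t)
    (hric : ∀ t ∈ Icc t₀ t₁, ∀ x,
      CRF.FormLE (CRF.ricciBE (g t) (f t) x)
        ((k t / (2 * h t) + CRF.scalarCurvature (g t) x / (m + 1)) • CRF.metricAt (g t) x))
    (hv : CRF.SmoothOn m v t₀ t₁)
    (hineq : ∀ t ∈ Icc t₀ t₁, ∀ x,
      |CRF.dt t₀ t₁ v t x - CRF.laplacian (g t) (v t) x|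
        ≤ CRF.pmax p t * (|v t x| + Real.sqrt (CRF.gradSq (g t) (v t) x))) :
    ∀ t ∈ Icc t₀ t₁, (∃ x, v t x ≠ 0) →
      (DifferentiableWithinAt ℝ (fun s => Real.log (CRF.massI g T f v s)) (Icc t₀ t₁) t ∧
        derivWithin (fun s => Real.log (CRF.massI g T f v s)) (Icc t₀ t₁) t
          ≥ -3 * CRF.pmax p t
            - (CRF.pmax p t + 2) / h t * CRF.freqQ g p T f v h k t₀ t₁ t
              * Real.exp (CRF.rate p h k t₀ t₁ t)) ∧
      (DifferentiableWithinAt ℝ (CRF.freqQ g p T f v h k t₀ t₁) (Icc t₀ t₁) t ∧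
        derivWithin (CRF.freqQ g p T f v h k t₀ t₁) (Icc t₀ t₁) t
          ≤ CRF.pmax p t ^ 2 * (CRF.freqQ g p T f v h k t₀ t₁ t + h t₀)) ∧
      (DifferentiableWithinAt ℝ
          (fun s => Real.log (CRF.freqQ g p T f v h k t₀ t₁ s + h t₀)) (Icc t₀ t₁) t ∧
        derivWithin (fun s => Real.log (CRF.freqQ g p T f v h k t₀ t₁ s + h t₀)) (Icc t₀ t₁) t
          ≤ CRF.pmax p t ^ 2) := by
  intro t ht hne
  exact CRF.frequency_monotonicity h01 h1T hflow hscal hf hh hk hpos hric hv hineq ht hne
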